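/- Let $(\Omega,\mathcal F,P)$ be a probability space, let $L^0_+(P)$ be the set of (classes of) non-negative random variables with convergence in probability, and let $\mathcal C\subset L^0_+(P)$ be closed, convex, solid (if $0\le f\le g$ and $g\in\mathcal C$, then $f\in\mathcal C$) and bounded in probability, with $1\in\mathcal C$. Put $\mathcal C(z)=z\,\mathcal C$ for $z>0$ and $$\mathcal C_b(x)=\bigcup_{n\ge 1,\ x+n>0}\{\mathcal C(x+n)-n\},\qquad x\in\mathbb R .$$ Let $\mathcal D=\mathcal C^\circ=\{h\in L^0_+(P): E[gh]\le 1\ \forall g\in\mathcal C\}$ be the polar of $\mathcal C$, let $D=\{h\in\mathcal D: h>0 \text{ a.s. and } E[h]=1\}$ and $\overline D=\{h\in\mathcal D: E[h]=1\}$, and assume that $D$ is non-empty and that $\mathcal D$ is the closed, convex and solid hull of $D$ in $L^0_+(P)$. Let $U:\mathbb R\to\mathbb R$ be increasing, strictly concave and continuously differentiable, with the Inada conditions $\lim_{x\to-\infty}U'(x)=\infty$ and $\lim_{x\to\infty}U'(x)=0$, and with reasonable asymptotic elasticity, that is, $$\limsup_{x\to\infty}\frac{xU'(x)}{U(x)}<1,\qquad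 \liminf_{x\to-\infty}\frac{xU'(x)}{U(x)}>1 .$$ Write $U(\infty)=\lim_{x\to\infty}U(x)\in(-\infty,\infty]$ and $U'(\infty)=0$, so that $(U')^{-1}$ is defined on $[0,\infty)$ with $(U')^{-1}(0)=\infty$; and put $V(y)=\sup_{x\in\mathbb R}\{U(x)-xy\}$ for $y>0$ and $V(0)=U(\infty)$. For $x\in\mathbb R$ let $\mathcal C_U(x)$ be the set of all $g\in L^0(P;\mathbb R\cup\{\infty\})$ for which there are $g_n\in\mathcal C_b(x)$ with $U(g_n)\in L^1(P)$ and $U(g_n)\to U(g)$ in $L^1(P)$. Define $$u(x)=\sup_{g\in\mathcal C_U(x)}E[U(g)]\quad(x\in\mathbb R),\qquad v(y)=\inf_{h\in\overline D}E[V(yh)]\quad(y>0),$$ and suppose that $u(x)<U(\infty)$ for some $x\in\mathbb R$. Then: 1) The functions $u$ on $\mathbb R$ and $v$ on $(0,\infty)$ are finite and conjugate, that is, $u(x)=\inf_{y>0}\{v(y)+xy\}$ for $x\in\mathbb R$ and $v(y)=\sup_{x\in\mathbb R}\{u(x)-xy\}$ for $y>0$. They are continuously differentiable, $u$ and $-v$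 are strictly concave, and $$\lim_{x\to-\infty}u'(x)=\infty,\quad \lim_{y\to\infty}v'(y)=\infty,\quad \lim_{x\to\infty}u'(x)=0,\quad \lim_{y\to0}v'(y)=-\infty .$$ The function $u$ has reasonable asymptotic elasticity (the two conditions above with $u$ in place of $U$). 2) For every $y>0$ the problem of minimising $E[V(yh)]$ over $h\in\overline D$ has a unique solution $\widehat h(y)\in\overline D$, and the map $y\mapsto\widehat h(y)$ from $(0,\infty)$ to $L^1(P)$ is continuous for the norm of $L^1(P)$ (that is, in variation norm). 3) For every $x\in\mathbb R$ the problem of maximising $E[U(g)]$ over $g\in\mathcal C_U(x)$ has a unique solution $\widehat g(x)\in\mathcal C_U(x)$, and, with $\widehat y(x)=u'(x)>0$, $$\widehat g(x)=(U')^{-1}\big(\widehat y(x)\,\widehat h(\widehat y(x))\big)\quad\text{a.s.}$$ 4) For all $y>0$ and $x\in\mathbb R$, $$v'(y)=E\big[\widehat h(y)\,V'\big(y\widehat h(y)\big)\big],\qquad x\,u'(x)=E\big[\widehat g(x)\,U'\big(\widehat g(x)\big)\big],$$ where the random variables on the right are integrable and $0\cdot\infty=0$ by convention (that is, the products are $0$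 where $\widehat h(y)=0$, respectively where $\widehat g(x)=\infty$). -/

import Mathlib

open MeasureTheory Filter Topology Set
open scoped ENNReal

namespace AbstractDuality

noncomputable section

/-! ### Utility functions -/

/-- A utility function on the whole real line: increasing, strictly concave, continuously
differentiable, with the Inada conditions `U'(-∞) = ∞` and `U'(∞) = 0`. -/
structure IsUtility (U : ℝ → ℝ) : Prop where
  strictMono : StrictMono U
  strictConcave : StrictConcaveOn ℝ univ U
  contDiff : ContDiff ℝ 1 U
  inada_bot : Tendsto (deriv U) atBot atTop
  inada_top : Tendsto (deriv U) atTop (𝓝 0)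

/-- The elasticity `x U'(x) / U(x)`, viewed in `[-∞, ∞]` so that its upper and lower limits
always exist. -/
def elasticity (U : ℝ → ℝ) (x : ℝ) : EReal := ((x * deriv U x / U x : ℝ) : EReal)

/-- Reasonable asymptotic elasticity: `limsup_{x → ∞} x U'(x) / U(x) < 1` and
`liminf_{x → -∞} x U'(x) / U(x) > 1`. -/
def HasReasonableAE (U : ℝ → ℝ) : Prop :=
  limsup (elasticity U) atTop < 1 ∧ 1 < liminf (elasticity U) atBot

/-- `U(∞) = lim_{x → ∞} U(x) = sup_x U(x)`, in `(-∞, ∞]`. -/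
def utilityTop (U : ℝ → ℝ) : EReal := ⨆ x : ℝ, ((U x : ℝ) : EReal)

open Classical in
/-- `U` extended to `[-∞, ∞]`, with `U(∞) = sup U` and `U(-∞) = -∞`. -/
def utilityExt (U : ℝ → ℝ) (g : EReal) : EReal :=
  if g = ⊤ then utilityTop U else if g = ⊥ then ⊥ else ((U g.toReal : ℝ) : EReal)

open Classical in
/-- `U'` extended to `[-∞, ∞]`, with `U'(∞) = 0` and `U'(-∞) = ∞`. -/
def marginalExt (U : ℝ → ℝ) (g : EReal) : EReal :=
  if g = ⊤ then 0 else if g = ⊥ then ⊤ else ((deriv U g.toReal : ℝ) : EReal)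

/-- The inverse `(U')⁻¹`, taken for `U'` as a bijection from `[-∞, ∞]` onto `[0, ∞]`; in
particular `(U')⁻¹(0) = ∞`. -/
def invMarginal (U : ℝ → ℝ) (y : EReal) : EReal := Function.invFun (marginalExt U) y

/-- The Legendre transform `V(y) = sup_x {U(x) - x y}`, with values in `(-∞, ∞]`; note that
`V(0) = U(∞)`. -/
def legendre (U : ℝ → ℝ) (y : ℝ) : EReal := ⨆ x : ℝ, ((U x - x * y : ℝ) : EReal)

/-- The derivative `V'(y)`, for `y > 0` (where `V` is finite). -/
def legendreDeriv (U : ℝ → ℝ) (y : ℝ) : ℝ := deriv (fun z => (legendre U z).toReal) y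

/-! ### Random variables -/

variable {Ω : Type*} [MeasurableSpace Ω]

/-- The expectation of an extended real random variable, `E[f⁺] - E[f⁻]`. It is a real number
if and only if both terms are finite, that is, if and only if `f` is integrable. -/
def expect (P : Measure Ω) (f : Ω → EReal) : EReal :=
  ((∫⁻ ω, (f ω).toENNReal ∂P : ℝ≥0∞) : EReal) - ((∫⁻ ω, (-f ω).toENNReal ∂P : ℝ≥0∞) : EReal)

variable {P : Measure Ω}

/-- Closedness in `L⁰(P)`, for the (metrizable) topology of convergence in probability. -/
def IsClosedL0 (A : Set (Ω →ₘ[P] ℝ)) : Prop :=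
  ∀ (f : ℕ → (Ω →ₘ[P] ℝ)) (g : Ω →ₘ[P] ℝ), (∀ n, f n ∈ A) →
    TendstoInMeasure P (fun n ω => f n ω) atTop (fun ω => g ω) → g ∈ A

/-- Boundedness in `L⁰(P)`, that is, boundedness in probability. -/
def IsBoundedL0 (A : Set (Ω →ₘ[P] ℝ)) : Prop :=
  ∀ ε : ℝ≥0∞, 0 < ε → ∃ M : ℝ, ∀ f ∈ A, P {ω | M < |f ω|} ≤ ε

/-- Solidity of a subset of `L⁰₊(P)`. -/
def IsSolidL0 (A : Set (Ω →ₘ[P] ℝ)) : Prop :=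
  ∀ f g : Ω →ₘ[P] ℝ, 0 ≤ f → f ≤ g → g ∈ A → f ∈ A

/-- The closed, convex and solid hull in `L⁰₊(P)`: the smallest closed, convex and solid subset
of `L⁰₊(P)` that contains `A`. -/
def closedConvexSolidHull (A : Set (Ω →ₘ[P] ℝ)) : Set (Ω →ₘ[P] ℝ) :=
  ⋂₀ {K | A ⊆ K ∧ (∀ f ∈ K, 0 ≤ f) ∧ IsClosedL0 K ∧ Convex ℝ K ∧ IsSolidL0 K}

/-- The polar `{h ∈ L⁰₊(P) | E[g h] ≤ 1 for all g ∈ C}` of a subset `C` of `L⁰₊(P)`. -/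
def polar (C : Set (Ω →ₘ[P] ℝ)) : Set (Ω →ₘ[P] ℝ) :=
  {h | 0 ≤ h ∧ ∀ g ∈ C, ∫⁻ ω, ENNReal.ofReal (g ω * h ω) ∂P ≤ 1}

/-- `D = {h ∈ C° | h > 0 and E[h] = 1}`. -/
def densities (C : Set (Ω →ₘ[P] ℝ)) : Set (Ω →ₘ[P] ℝ) :=
  {h | h ∈ polar C ∧ (∀ᵐ ω ∂P, 0 < h ω) ∧ ∫⁻ ω, ENNReal.ofReal (h ω) ∂P = 1}

/-- `D̄ = {h ∈ C° | E[h] = 1}`. -/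
def acDensities (C : Set (Ω →ₘ[P] ℝ)) : Set (Ω →ₘ[P] ℝ) :=
  {h | h ∈ polar C ∧ ∫⁻ ω, ENNReal.ofReal (h ω) ∂P = 1}

/-- The standing assumptions on the set `C ⊆ L⁰₊(P)`. -/
structure IsAdmissibleSet (C : Set (Ω →ₘ[P] ℝ)) : Prop where
  nonneg : ∀ g ∈ C, 0 ≤ g
  closed : IsClosedL0 C
  convex : Convex ℝ C
  solid : IsSolidL0 C
  bounded : IsBoundedL0 C
  one_mem : (1 : Ω →ₘ[P] ℝ) ∈ C
  densities_nonempty : (densities C).Nonempty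
  polar_eq_hull : polar C = closedConvexSolidHull (densities C)

/-! ### The primal and the dual problem -/

/-- `C_b(x) = ⋃_{n ≥ 1} (C(x + n) - n)`, where `C(z) = z C` is defined for `z > 0`. -/
def boundedClaims (C : Set (Ω →ₘ[P] ℝ)) (x : ℝ) : Set (Ω →ₘ[P] ℝ) :=
  {f | ∃ n : ℕ, 1 ≤ n ∧ 0 < x + n ∧ ∃ g ∈ C, f = (x + n) • g - AEEqFun.const Ω (n : ℝ)}

/-- `C_U(x)`: the `g ∈ L⁰(P; ℝ ∪ {∞})` for which there are `gₙ ∈ C_b(x)` with `U(gₙ) ∈ L¹(P)`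
and `U(gₙ) → U(g)` in `L¹(P)`. -/
def utilityClaims (C : Set (Ω →ₘ[P] ℝ)) (U : ℝ → ℝ) (x : ℝ) : Set (Ω →ₘ[P] EReal) :=
  {g | (∀ᵐ ω ∂P, g ω ≠ ⊥) ∧ ∃ f : ℕ → (Ω →ₘ[P] ℝ), (∀ n, f n ∈ boundedClaims C x) ∧
    (∀ n, Integrable (fun ω => U (f n ω)) P) ∧
    Tendsto (fun n => ∫⁻ ω, (((U (f n ω) : ℝ) : EReal) - utilityExt U (g ω)).abs ∂P) atTop (𝓝 0)}

/-- `E[U(g)]`. -/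
def expectedUtility (U : ℝ → ℝ) (g : Ω →ₘ[P] EReal) : EReal :=
  expect P (fun ω => utilityExt U (g ω))

/-- The primal value function `u(x) = sup_{g ∈ C_U(x)} E[U(g)]`. -/
def primalValue (C : Set (Ω →ₘ[P] ℝ)) (U : ℝ → ℝ) (x : ℝ) : EReal :=
  ⨆ g ∈ utilityClaims C U x, expectedUtility U g

/-- `g` solves `E[U(g)] → max!` over `g ∈ C_U(x)`. -/
def IsPrimalSolution (C : Set (Ω →ₘ[P] ℝ)) (U : ℝ → ℝ) (x : ℝ) (g : Ω →ₘ[P] EReal) : Prop :=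
  g ∈ utilityClaims C U x ∧ ∀ g' ∈ utilityClaims C U x, expectedUtility U g' ≤ expectedUtility U g

/-- The dual objective `E[V(y h)]`. -/
def dualObjective (U : ℝ → ℝ) (y : ℝ) (h : Ω →ₘ[P] ℝ) : EReal :=
  expect P (fun ω => legendre U (y * h ω))

/-- The dual value function `v(y) = inf_{h ∈ D̄} E[V(y h)]`. -/
def dualValue (C : Set (Ω →ₘ[P] ℝ)) (U : ℝ → ℝ) (y : ℝ) : EReal :=
  ⨅ h ∈ acDensities C, dualObjective U y h

/-- `h` solves `E[V(y h)] → min!` over `h ∈ D̄`. -/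
def IsDualSolution (C : Set (Ω →ₘ[P] ℝ)) (U : ℝ → ℝ) (y : ℝ) (h : Ω →ₘ[P] ℝ) : Prop :=
  h ∈ acDensities C ∧ ∀ h' ∈ acDensities C, dualObjective U y h ≤ dualObjective U y h'

end

end AbstractDuality

namespace AbstractDuality

noncomputable section

/-! ### Utility functions on the real line -/

/-- A function with a continuous selection of subgradients is differentiable. -/
lemma hasDerivAt_of_subgradient {f g : ℝ → ℝ} {x : ℝ} {s : Set ℝ} (hs : s ∈ 𝓝 x)
    (hlow : ∀ z ∈ s, f x + g x * (z - x) ≤ f z) (hup : ∀ z ∈ s, f z ≤ f x + g z * (z - x))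
    (hg : ContinuousAt g x) : HasDerivAt f (g x) x := by
  rw [hasDerivAt_iff_isLittleO, Asymptotics.isLittleO_iff]
  intro c hc
  have h1 : ∀ᶠ z in 𝓝 x, |g z - g x| < c := by
    have := Metric.tendsto_nhds.1 hg c hc
    simpa [Real.dist_eq] using this
  filter_upwards [h1, hs] with z hz hzs
  have h2 := hlow z hzs
  have h3 := hup z hzs
  have h4 : (g z - g x) * (z - x) ≤ |g z - g x| * |z - x| := by
    rw [← abs_mul]; exact le_abs_self _
  have h5 : |g z - g x| * |z - x| ≤ c * |z - x| := by gcongr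
  simp only [Real.norm_eq_abs, smul_eq_mul]
  rw [abs_of_nonneg (by linarith)]
  linarith

/-- `(U')⁻¹` as a real function on `(0, ∞)`. -/
def margInv (U : ℝ → ℝ) (q : ℝ) : ℝ := (invMarginal U (q : EReal)).toReal

/-- The Legendre transform as a real function. -/
def conj (U : ℝ → ℝ) (q : ℝ) : ℝ := (legendre U q).toReal

lemma le_legendre (U : ℝ → ℝ) (q x : ℝ) : ((U x - x * q : ℝ) : EReal) ≤ legendre U q :=
  le_iSup (fun x : ℝ => ((U x - x * q : ℝ) : EReal)) x

lemma legendre_ne_bot (U : ℝ → ℝ) (q : ℝ) : legendre U q ≠ ⊥ :=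
  ((EReal.bot_lt_coe _).trans_le (le_legendre U q 0)).ne'

lemma coe_conj {U : ℝ → ℝ} {q : ℝ} (h : legendre U q ≠ ⊤) : (conj U q : EReal) = legendre U q :=
  EReal.coe_toReal h (legendre_ne_bot U q)

lemma le_conj {U : ℝ → ℝ} {q : ℝ} (h : legendre U q ≠ ⊤) (x : ℝ) : U x - x * q ≤ conj U q := by
  have := le_legendre U q x
  rwa [← coe_conj h, EReal.coe_le_coe_iff] at this

lemma legendre_zero (U : ℝ → ℝ) : legendre U 0 = utilityTop U := by
  simp [legendre, utilityTop]

lemma measurable_legendre (U : ℝ → ℝ) : Measurable (legendre U) := by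
  have : LowerSemicontinuous (legendre U) := by
    unfold legendre
    refine lowerSemicontinuous_iSup fun x => Continuous.lowerSemicontinuous ?_
    exact continuous_coe_real_ereal.comp (by fun_prop)
  exact this.measurable

lemma measurable_conj (U : ℝ → ℝ) : Measurable (conj U) :=
  (measurable_legendre U).ereal_toReal

namespace IsUtility

variable {U : ℝ → ℝ} (hU : IsUtility U)
include hU

lemma differentiable : Differentiable ℝ U := hU.contDiff.differentiable one_ne_zero

lemma continuous : Continuous U := hU.contDiff.continuous

lemma continuous_deriv : Continuous (deriv U) := hU.contDiff.continuous_deriv le_rfl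

lemma deriv_strictAnti : StrictAnti (deriv U) := by
  have := hU.strictConcave.strictAntiOn_deriv fun x _ => hU.differentiable x
  exact fun a b hab => this (mem_univ _) (mem_univ _) hab

lemma deriv_pos (x : ℝ) : 0 < deriv U x := by
  have h1 : 0 ≤ deriv U (x + 1) :=
    hU.deriv_strictAnti.antitone.le_of_tendsto hU.inada_top (x + 1)
  exact h1.trans_lt (hU.deriv_strictAnti (by linarith))

lemma exists_deriv_eq {q : ℝ} (hq : 0 < q) : ∃ x, deriv U x = q := by
  obtain ⟨a, ha⟩ := (hU.inada_bot.eventually_ge_atTop q).exists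
  obtain ⟨b, hb⟩ := (hU.inada_top.eventually (eventually_le_nhds hq)).exists
  exact mem_range_of_exists_le_of_exists_ge hU.continuous_deriv ⟨b, hb⟩ ⟨a, ha⟩

lemma lt_tangent {x z : ℝ} (hxz : z ≠ x) : U z < U x + deriv U x * (z - x) := by
  rcases lt_or_gt_of_ne hxz with h | h
  · have := hU.strictConcave.deriv_lt_slope (mem_univ z) (mem_univ x) h (hU.differentiable x)
    rw [slope_def_field, lt_div_iff₀ (by linarith)] at this
    linarith
  · have := hU.strictConcave.slope_lt_deriv (mem_univ x) (mem_univ z) h (hU.differentiable x)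
    rw [slope_def_field, div_lt_iff₀ (by linarith)] at this
    linarith

lemma le_tangent (x z : ℝ) : U z ≤ U x + deriv U x * (z - x) := by
  rcases eq_or_ne z x with rfl | h
  · simp
  · exact (hU.lt_tangent h).le

omit hU in
lemma _root_.AbstractDuality.marginalExt_coe (U : ℝ → ℝ) (x : ℝ) :
    marginalExt U (x : EReal) = ((deriv U x : ℝ) : EReal) := by
  simp [marginalExt]

omit hU in
lemma _root_.AbstractDuality.marginalExt_top (U : ℝ → ℝ) : marginalExt U ⊤ = 0 := by
  simp [marginalExt]

omit hU in
lemma _root_.AbstractDuality.marginalExt_bot (U : ℝ → ℝ) : marginalExt U ⊥ = ⊤ := by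
  simp [marginalExt]

lemma marginalExt_injective : Function.Injective (marginalExt U) := by
  intro a b
  have h0 := fun x => (hU.deriv_pos x).ne'
  have h0' := fun x => (h0 x).symm
  induction a <;> induction b <;>
    simp [marginalExt_coe, marginalExt_top, marginalExt_bot, h0]
  · exact_mod_cast fun h => hU.deriv_strictAnti.injective h
  · exact_mod_cast h0' _

lemma invMarginal_zero : invMarginal U ((0 : ℝ) : EReal) = ⊤ := by
  have := Function.leftInverse_invFun hU.marginalExt_injective ⊤
  rwa [marginalExt_top] at this

lemma invMarginal_deriv (x : ℝ) : invMarginal U (deriv U x : ℝ) = x := by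
  have := Function.leftInverse_invFun hU.marginalExt_injective x
  rwa [marginalExt_coe] at this

lemma margInv_deriv (x : ℝ) : margInv U (deriv U x) = x := by
  simp [margInv, hU.invMarginal_deriv]

lemma deriv_margInv {q : ℝ} (hq : 0 < q) : deriv U (margInv U q) = q := by
  obtain ⟨x, rfl⟩ := hU.exists_deriv_eq hq
  rw [hU.margInv_deriv]

lemma invMarginal_coe {q : ℝ} (hq : 0 < q) : invMarginal U (q : EReal) = (margInv U q : ℝ) := by
  obtain ⟨x, rfl⟩ := hU.exists_deriv_eq hq
  rw [hU.margInv_deriv, hU.invMarginal_deriv]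

lemma invMarginal_ne_bot {q : ℝ} (hq : 0 ≤ q) : invMarginal U (q : EReal) ≠ ⊥ := by
  rcases hq.eq_or_lt with rfl | h
  · rw [hU.invMarginal_zero]; simp
  · rw [hU.invMarginal_coe h]; simp

lemma marginalExt_invMarginal {q : ℝ} (hq : 0 ≤ q) :
    marginalExt U (invMarginal U (q : EReal)) = q := by
  rcases hq.eq_or_lt with rfl | h
  · rw [hU.invMarginal_zero, marginalExt_top]; simp
  · rw [hU.invMarginal_coe h, marginalExt_coe, hU.deriv_margInv h]

lemma invMarginal_inj {p q : ℝ} (hp : 0 ≤ p) (hq : 0 ≤ q)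
    (h : invMarginal U (p : EReal) = invMarginal U (q : EReal)) : p = q := by
  have := congrArg (marginalExt U) h
  rw [hU.marginalExt_invMarginal hp, hU.marginalExt_invMarginal hq] at this
  exact_mod_cast this

lemma lt_margInv_iff {q x : ℝ} (hq : 0 < q) : x < margInv U q ↔ q < deriv U x := by
  conv_rhs => rw [← hU.deriv_margInv hq]
  exact hU.deriv_strictAnti.lt_iff_gt.symm

lemma margInv_lt_iff {q x : ℝ} (hq : 0 < q) : margInv U q < x ↔ deriv U x < q := by
  conv_rhs => rw [← hU.deriv_margInv hq]
  exact hU.deriv_strictAnti.lt_iff_gt.symm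

lemma lt_invMarginal_iff {q x : ℝ} (hq : 0 ≤ q) :
    (x : EReal) < invMarginal U (q : EReal) ↔ q < deriv U x := by
  rcases hq.eq_or_lt with rfl | h
  · rw [hU.invMarginal_zero]; simp [hU.deriv_pos x]
  · rw [hU.invMarginal_coe h, EReal.coe_lt_coe_iff, hU.lt_margInv_iff h]

lemma invMarginal_lt_iff {q x : ℝ} (hq : 0 ≤ q) :
    invMarginal U (q : EReal) < (x : EReal) ↔ deriv U x < q := by
  rcases hq.eq_or_lt with rfl | h
  · rw [hU.invMarginal_zero]; simp [(hU.deriv_pos x).le]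
  · rw [hU.invMarginal_coe h, EReal.coe_lt_coe_iff, hU.margInv_lt_iff h]

lemma exists_measurable_invMarginal :
    ∃ J : ℝ → EReal, Measurable J ∧ ∀ q, 0 ≤ q → J q = invMarginal U (q : EReal) := by
  refine ⟨fun q => invMarginal U ((max q 0 : ℝ) : EReal), Antitone.measurable ?_,
    fun q hq => by simp [max_eq_left hq]⟩
  intro p q hpq
  have hpq' : max p 0 ≤ max q 0 := max_le_max_right 0 hpq
  rcases hpq'.eq_or_lt with h | h
  · simp only [h, le_refl]
  · have hq : 0 < max q 0 := (le_max_right p 0).trans_lt h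
    simp only
    rw [hU.invMarginal_coe hq]
    refine ((hU.lt_invMarginal_iff (le_max_right p 0)).2 ?_).le
    rwa [hU.deriv_margInv hq]

lemma legendre_eq {q : ℝ} (hq : 0 < q) :
    legendre U q = ((U (margInv U q) - margInv U q * q : ℝ) : EReal) := by
  refine le_antisymm (iSup_le fun x => ?_) (le_legendre U q _)
  have := hU.le_tangent (margInv U q) x
  rw [hU.deriv_margInv hq] at this
  rw [EReal.coe_le_coe_iff]
  linarith

lemma legendre_ne_top {q : ℝ} (hq : 0 < q) : legendre U q ≠ ⊤ := by
  rw [hU.legendre_eq hq]; exact EReal.coe_ne_top _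

lemma conj_eq {q : ℝ} (hq : 0 < q) : conj U q = U (margInv U q) - margInv U q * q := by
  rw [conj, hU.legendre_eq hq, EReal.toReal_coe]

/-- The Fenchel gap dominates forward increments of the marginal utility. -/
lemma gap_ge_right {q : ℝ} (h : legendre U q ≠ ⊤) (x : ℝ) {d : ℝ} :
    d * (deriv U (x + d) - q) ≤ conj U q + q * x - U x := by
  have h1 := le_conj h (x + d)
  have h2 := hU.le_tangent (x + d) x
  nlinarith

lemma gap_ge_left {q : ℝ} (h : legendre U q ≠ ⊤) (x : ℝ) {d : ℝ} :
    d * (q - deriv U (x - d)) ≤ conj U q + q * x - U x := by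
  have h1 := le_conj h (x - d)
  have h2 := hU.le_tangent (x - d) x
  nlinarith

/-- Almost optimisers in the definition of `V(q)` converge to `(U')⁻¹(q)`. -/
lemma tendsto_of_gap {q : ℝ} (hq : 0 ≤ q) (hfin : legendre U q ≠ ⊤) {x : ℕ → ℝ}
    (h : Tendsto (fun n => conj U q + q * x n - U (x n)) atTop (𝓝 0)) :
    Tendsto (fun n => (x n : EReal)) atTop (𝓝 (invMarginal U (q : EReal))) := by
  rw [tendsto_order]
  constructor
  · intro a ha
    obtain ⟨b, hab, hb⟩ := EReal.exists_rat_btwn_of_lt ha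
    obtain ⟨c, hbc, hc⟩ := EReal.exists_rat_btwn_of_lt hb
    have hbc' : ((b : ℝ)) < (c : ℝ) := by exact_mod_cast hbc
    have hcq : q < deriv U (c : ℝ) := (hU.lt_invMarginal_iff hq).1 hc
    have hpos : 0 < ((c : ℝ) - b) * (deriv U c - q) :=
      mul_pos (by linarith) (by linarith)
    filter_upwards [h.eventually (gt_mem_nhds hpos)] with n hn
    refine hab.trans ?_
    have : (b : ℝ) < x n := by
      by_contra! hcon
      have h1 := hU.gap_ge_right hfin (x n) (d := (c : ℝ) - b)
      have h2 : deriv U (c : ℝ) ≤ deriv U (x n + ((c : ℝ) - b)) :=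
        hU.deriv_strictAnti.antitone (by linarith)
      nlinarith
    exact_mod_cast this
  · intro a ha
    obtain ⟨b, hb, hab⟩ := EReal.exists_rat_btwn_of_lt ha
    obtain ⟨c, hc, hbc⟩ := EReal.exists_rat_btwn_of_lt hb
    have hbc' : ((c : ℝ)) < (b : ℝ) := by exact_mod_cast hbc
    have hcq : deriv U (c : ℝ) < q := (hU.invMarginal_lt_iff hq).1 hc
    have hpos : 0 < ((b : ℝ) - c) * (q - deriv U c) :=
      mul_pos (by linarith) (by linarith)
    filter_upwards [h.eventually (gt_mem_nhds hpos)] with n hn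
    refine lt_trans ?_ hab
    have : x n < (b : ℝ) := by
      by_contra! hcon
      have h1 := hU.gap_ge_left hfin (x n) (d := (b : ℝ) - c)
      have h2 : deriv U (x n - ((b : ℝ) - c)) ≤ deriv U (c : ℝ) :=
        hU.deriv_strictAnti.antitone (by linarith)
      nlinarith
    exact_mod_cast this

/-- Stability of the dual variable in the Fenchel inequality. -/
lemma tendsto_dual_of_gap {q : ℝ} (hq : 0 ≤ q) {p : ℕ → ℝ} (hp : ∀ n, 0 ≤ p n)
    (hfin : ∀ n, legendre U (p n) ≠ ⊤) {x : ℕ → ℝ}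
    (hx : Tendsto (fun n => (x n : EReal)) atTop (𝓝 (invMarginal U (q : EReal))))
    (h : Tendsto (fun n => conj U (p n) + p n * x n - U (x n)) atTop (𝓝 0)) :
    Tendsto p atTop (𝓝 q) := by
  rw [tendsto_order]
  constructor
  · intro c hc
    rcases lt_or_ge c 0 with hc0 | hc0
    · exact Eventually.of_forall fun n => hc0.trans_le (hp n)
    have hq' : 0 < q := hc0.trans_lt hc
    obtain ⟨c', hcc', hc'⟩ := exists_between hc
    have hc'0 : 0 < c' := hc0.trans_lt hcc'
    obtain ⟨b, hb⟩ := hU.exists_deriv_eq hc'0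
    obtain ⟨c'', hcc'', hc''⟩ := exists_between hcc'
    obtain ⟨d, hd⟩ := hU.exists_deriv_eq (hc0.trans_lt hcc'')
    have hbd : b < d := by
      rw [← hU.deriv_strictAnti.lt_iff_gt, hb, hd]; exact hc''
    have hlt : invMarginal U (q : EReal) < (b : EReal) :=
      (hU.invMarginal_lt_iff hq).2 (by rw [hb]; exact hc')
    have hpos : 0 < (d - b) * (c'' - c) := mul_pos (by linarith) (by linarith)
    filter_upwards [hx.eventually (gt_mem_nhds hlt), h.eventually (gt_mem_nhds hpos)] with n h1 h2
    have h1' : x n < b := by exact_mod_cast h1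
    by_contra! hcon
    have h3 := hU.gap_ge_right (hfin n) (x n) (d := d - b)
    have h4 : c'' ≤ deriv U (x n + (d - b)) := by
      rw [← hd]; exact hU.deriv_strictAnti.antitone (by linarith)
    nlinarith
  · intro c hc
    have hc0 : 0 < c := hq.trans_lt hc
    obtain ⟨c', hcc', hc'⟩ := exists_between hc
    obtain ⟨b, hb⟩ := hU.exists_deriv_eq (hq.trans_lt hcc')
    obtain ⟨c'', hcc'', hc''⟩ := exists_between hc'
    obtain ⟨d, hd⟩ := hU.exists_deriv_eq ((hq.trans_lt hcc').trans hcc'')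
    have hbd : d < b := by
      rw [← hU.deriv_strictAnti.lt_iff_gt, hb, hd]; exact hcc''
    have hlt : (b : EReal) < invMarginal U (q : EReal) :=
      (hU.lt_invMarginal_iff hq).2 (by rw [hb]; exact hcc')
    have hpos : 0 < (b - d) * (c - c'') := mul_pos (by linarith) (by linarith)
    filter_upwards [hx.eventually (lt_mem_nhds hlt), h.eventually (gt_mem_nhds hpos)] with n h1 h2
    have h1' : b < x n := by exact_mod_cast h1
    by_contra! hcon
    have h3 := hU.gap_ge_left (hfin n) (x n) (d := b - d)
    have h4 : deriv U (x n - (b - d)) ≤ c'' := by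
      rw [← hd]; exact hU.deriv_strictAnti.antitone (by linarith)
    nlinarith

omit hU in
lemma _root_.AbstractDuality.le_utilityTop (U : ℝ → ℝ) (x : ℝ) : ((U x : ℝ) : EReal) ≤ utilityTop U :=
  le_iSup (fun x : ℝ => ((U x : ℝ) : EReal)) x

lemma lt_utilityTop (x : ℝ) : ((U x : ℝ) : EReal) < utilityTop U :=
  lt_of_lt_of_le (by exact_mod_cast hU.strictMono (lt_add_one x)) (le_utilityTop U (x + 1))

omit hU in
lemma _root_.AbstractDuality.utilityExt_coe (U : ℝ → ℝ) (x : ℝ) :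
    utilityExt U (x : EReal) = ((U x : ℝ) : EReal) := by
  simp [utilityExt]

omit hU in
lemma _root_.AbstractDuality.utilityExt_top (U : ℝ → ℝ) :
    utilityExt U ⊤ = utilityTop U := by
  simp [utilityExt]

/-- `U((U')⁻¹(q)) = V(q) + q (U')⁻¹(q)`. -/
lemma utilityExt_invMarginal {q : ℝ} (hq : 0 ≤ q) (hfin : legendre U q ≠ ⊤) :
    utilityExt U (invMarginal U (q : EReal)) = ((conj U q + q * margInv U q : ℝ) : EReal) := by
  rcases hq.eq_or_lt with rfl | h
  · rw [hU.invMarginal_zero, utilityExt_top, zero_mul, add_zero, coe_conj hfin, legendre_zero]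
  · rw [hU.invMarginal_coe h, utilityExt_coe, hU.conj_eq h]
    congr 1; ring

lemma utilityExt_injOn {a b : EReal} (ha : a ≠ ⊥) (hb : b ≠ ⊥)
    (h : utilityExt U a = utilityExt U b) : a = b := by
  induction a with
  | bot => exact absurd rfl ha
  | top =>
    induction b with
    | bot => exact absurd rfl hb
    | top => rfl
    | coe y =>
      rw [utilityExt_top, utilityExt_coe] at h
      exact absurd h (hU.lt_utilityTop y).ne'
  | coe x =>
    induction b with
    | bot => exact absurd rfl hb
    | top =>
      rw [utilityExt_top, utilityExt_coe] at h
      exact absurd h (hU.lt_utilityTop x).ne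
    | coe y =>
      rw [utilityExt_coe, utilityExt_coe, EReal.coe_eq_coe_iff] at h
      rw [hU.strictMono.injective h]

/-! ### The conjugate function -/

lemma continuousAt_margInv {q : ℝ} (hq : 0 < q) : ContinuousAt (margInv U) q := by
  rw [ContinuousAt, tendsto_order]
  constructor
  · intro a ha
    have := (hU.lt_margInv_iff hq).1 ha
    filter_upwards [gt_mem_nhds this, lt_mem_nhds hq] with z hz hz0
    exact (hU.lt_margInv_iff hz0).2 hz
  · intro a ha
    have := (hU.margInv_lt_iff hq).1 ha
    filter_upwards [lt_mem_nhds this, lt_mem_nhds hq] with z hz hz0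
    exact (hU.margInv_lt_iff hz0).2 hz

lemma strictAntiOn_margInv : StrictAntiOn (margInv U) (Ioi 0) := by
  intro p hp q hq hpq
  rw [hU.margInv_lt_iff hq, hU.deriv_margInv hp]
  exact hpq

lemma conj_ge_tangent {p q : ℝ} (hp : 0 < p) (hq : 0 < q) :
    conj U p - margInv U p * (q - p) ≤ conj U q := by
  have := le_conj (hU.legendre_ne_top hq) (margInv U p)
  rw [hU.conj_eq hp]
  linarith

lemma hasDerivAt_conj {q : ℝ} (hq : 0 < q) : HasDerivAt (conj U) (-margInv U q) q := by
  refine hasDerivAt_of_subgradient (g := fun q => -margInv U q) (Ioi_mem_nhds hq) ?_ ?_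
    (hU.continuousAt_margInv hq).neg
  · intro z hz
    have := hU.conj_ge_tangent hq hz
    linarith
  · intro z hz
    have := hU.conj_ge_tangent hz hq
    linarith

lemma deriv_conj {q : ℝ} (hq : 0 < q) : deriv (conj U) q = -margInv U q :=
  (hU.hasDerivAt_conj hq).deriv

lemma isLUB_conj {q : ℝ} (hq : 0 < q) : IsLUB (range fun x : ℝ => U x - x * q) (conj U q) := by
  constructor
  · rintro _ ⟨x, rfl⟩
    exact le_conj (hU.legendre_ne_top hq) x
  · intro b hb
    rw [hU.conj_eq hq]
    exact hb ⟨margInv U q, rfl⟩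

lemma isGLB_conj (x : ℝ) : IsGLB ((fun q : ℝ => conj U q + x * q) '' Ioi 0) (U x) := by
  constructor
  · rintro _ ⟨q, hq, rfl⟩
    have := le_conj (hU.legendre_ne_top hq) x
    simp only
    linarith
  · intro b hb
    have := hb ⟨deriv U x, hU.deriv_pos x, rfl⟩
    simp only at this
    rw [hU.conj_eq (hU.deriv_pos x), hU.margInv_deriv] at this
    linarith

lemma contDiffOn_conj : ContDiffOn ℝ 1 (conj U) (Ioi 0) := by
  rw [show (1 : WithTop ℕ∞) = 0 + 1 by simp, contDiffOn_succ_iff_deriv_of_isOpen isOpen_Ioi]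
  refine ⟨fun q hq => (hU.hasDerivAt_conj hq).differentiableAt.differentiableWithinAt, by simp, ?_⟩
  rw [contDiffOn_zero]
  have : ContinuousOn (fun q => -margInv U q) (Ioi 0) :=
    fun q hq => (hU.continuousAt_margInv hq).neg.continuousWithinAt
  exact this.congr fun q hq => hU.deriv_conj hq

lemma strictConcaveOn_neg_conj : StrictConcaveOn ℝ (Ioi 0) (fun q => -conj U q) := by
  refine StrictAntiOn.strictConcaveOn_of_deriv (convex_Ioi 0) hU.contDiffOn_conj.continuousOn.neg ?_
  rw [interior_Ioi]
  refine hU.strictAntiOn_margInv.congr fun q hq => ?_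
  simp [hU.deriv_conj hq]

lemma tendsto_deriv_conj_atTop : Tendsto (deriv (conj U)) atTop atTop := by
  rw [tendsto_atTop]
  intro b
  filter_upwards [eventually_gt_atTop (deriv U (-b)), eventually_gt_atTop 0] with q hq hq0
  rw [hU.deriv_conj hq0]
  have := (hU.margInv_lt_iff hq0).2 hq
  linarith

lemma tendsto_deriv_conj_zero : Tendsto (deriv (conj U)) (𝓝[>] 0) atBot := by
  rw [tendsto_atBot]
  intro b
  filter_upwards [self_mem_nhdsWithin, mem_nhdsWithin_of_mem_nhds
    (gt_mem_nhds (hU.deriv_pos (-b)))] with q hq0 hq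
  rw [hU.deriv_conj hq0]
  have := (hU.lt_margInv_iff hq0).2 hq
  linarith

end IsUtility

/-! ### Reasonable asymptotic elasticity -/

namespace IsUtility

variable {U : ℝ → ℝ} (hU : IsUtility U)
include hU

lemma zero_le_value_sub (x : ℝ) : 0 ≤ U x - x * deriv U x - U 0 := by
  have := hU.le_tangent x 0
  linarith

lemma tendsto_atBot : Tendsto U atBot atBot := by
  have h1 : Tendsto (fun x => U 0 + deriv U 0 * x) atBot atBot :=
    tendsto_atBot_add_const_left _ _ (tendsto_id.const_mul_atBot (hU.deriv_pos 0))
  refine tendsto_atBot_mono (fun x => ?_) h1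
  simpa using hU.le_tangent 0 x

lemma elastic_bound_top (h : limsup (elasticity U) atTop < 1) :
    ∃ A B : ℝ, 0 ≤ A ∧ 0 ≤ B ∧
      ∀ᶠ x in atTop, |x * deriv U x| ≤ A * (U x - x * deriv U x - U 0) + B := by
  by_cases hpos : ∃ x₁, 0 < U x₁
  · obtain ⟨x₁, hx₁⟩ := hpos
    obtain ⟨c, hc, hc1⟩ := EReal.lt_iff_exists_real_btwn.1 h
    have hc1' : c < 1 := by exact_mod_cast hc1
    set g := max c 0 with hg
    have hg0 : 0 ≤ g := le_max_right _ _
    have hg1 : 0 < 1 - g := by have := max_lt hc1' one_pos; linarith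
    refine ⟨g / (1 - g), g / (1 - g) * |U 0|, by positivity, by positivity, ?_⟩
    filter_upwards [eventually_lt_of_limsup_lt hc, eventually_ge_atTop x₁, eventually_ge_atTop 0]
      with x hx hx1 hx0
    have hUx : 0 < U x := hx₁.trans_le (hU.strictMono.monotone hx1)
    have h1 : x * deriv U x / U x < c := by
      rw [elasticity] at hx; exact_mod_cast hx
    rw [div_lt_iff₀ hUx] at h1
    have h2 : x * deriv U x ≤ g * U x :=
      h1.le.trans (mul_le_mul_of_nonneg_right (le_max_left _ _) hUx.le)
    rw [abs_of_nonneg (mul_nonneg hx0 (hU.deriv_pos x).le)]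
    have h3 : x * deriv U x ≤ g / (1 - g) * (U x - x * deriv U x) := by
      rw [div_mul_eq_mul_div, le_div_iff₀ hg1]; linarith
    have h4 : 0 ≤ g / (1 - g) * (|U 0| - U 0) :=
      mul_nonneg (by positivity) (by linarith [le_abs_self (U 0)])
    linarith
  · push Not at hpos
    refine ⟨0, |U 0|, le_rfl, abs_nonneg _, ?_⟩
    filter_upwards [eventually_ge_atTop 0] with x hx0
    rw [abs_of_nonneg (mul_nonneg hx0 (hU.deriv_pos x).le)]
    have := hU.zero_le_value_sub x
    have := hpos x
    have := neg_le_abs (U 0)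
    linarith

lemma elastic_bound_bot (h : 1 < liminf (elasticity U) atBot) :
    ∃ A B : ℝ, 0 ≤ A ∧ 0 ≤ B ∧
      ∀ᶠ x in atBot, |x * deriv U x| ≤ A * (U x - x * deriv U x - U 0) + B := by
  obtain ⟨g, hg1, hg⟩ := EReal.lt_iff_exists_real_btwn.1 h
  have hg1' : 0 < g - 1 := by have : 1 < g := by exact_mod_cast hg1
                              linarith
  refine ⟨g / (g - 1), g / (g - 1) * |U 0|, by have : 0 < g := by linarith
                                               positivity, by have : 0 < g := by linarith
                                                              positivity, ?_⟩
  filter_upwards [eventually_lt_of_lt_liminf hg, eventually_le_atBot 0,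
    hU.tendsto_atBot.eventually (eventually_lt_atBot 0)] with x hx hx0 hUx
  have h1 : g < x * deriv U x / U x := by
    rw [elasticity] at hx; exact_mod_cast hx
  rw [lt_div_iff_of_neg hUx] at h1
  rw [abs_of_nonpos (mul_nonpos_of_nonpos_of_nonneg hx0 (hU.deriv_pos x).le)]
  have h3 : -(x * deriv U x) ≤ g / (g - 1) * (U x - x * deriv U x) := by
    rw [div_mul_eq_mul_div, le_div_iff₀ hg1']
    nlinarith
  have h4 : 0 ≤ g / (g - 1) * (|U 0| - U 0) :=
    mul_nonneg (by have : 0 < g := by linarith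
                   positivity) (by linarith [le_abs_self (U 0)])
  linarith

/-- Reasonable asymptotic elasticity bounds `|x U'(x)|` by `U(x) - x U'(x) = V(U'(x))`. -/
lemma elastic_bound (h : HasReasonableAE U) :
    ∃ A B : ℝ, 0 ≤ A ∧ 0 ≤ B ∧
      ∀ x, |x * deriv U x| ≤ A * (U x - x * deriv U x - U 0) + B := by
  obtain ⟨A₁, B₁, hA₁, hB₁, h₁⟩ := hU.elastic_bound_top h.1
  obtain ⟨A₂, B₂, hA₂, hB₂, h₂⟩ := hU.elastic_bound_bot h.2
  obtain ⟨b, hb⟩ := eventually_atTop.1 h₁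
  obtain ⟨a, ha⟩ := eventually_atBot.1 h₂
  have hcont : Continuous fun x => |x * deriv U x| := by
    have := hU.continuous_deriv
    fun_prop
  obtain ⟨M, hM⟩ := (isCompact_Icc (a := a) (b := b)).bddAbove_image hcont.continuousOn
  refine ⟨A₁ + A₂, B₁ + B₂ + |M|, by positivity, by positivity, fun x => ?_⟩
  have h0 := hU.zero_le_value_sub x
  have h1 := mul_nonneg hA₁ h0
  have h2 := mul_nonneg hA₂ h0
  have h3 := abs_nonneg M
  rw [add_mul]
  rcases le_total x a with hxa | hxa
  · linarith [ha x hxa]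
  rcases le_total b x with hxb | hxb
  · linarith [hb x hxb]
  · have : |x * deriv U x| ≤ M := hM ⟨x, ⟨hxa, hxb⟩, rfl⟩
    linarith [le_abs_self M]

lemma limsup_elasticity_lt_one {A B : ℝ} (hA : 0 ≤ A)
    (h : ∀ x, |x * deriv U x| ≤ A * (U x - x * deriv U x) + B) :
    limsup (elasticity U) atTop < 1 := by
  have key : ∀ c : ℝ, c < 1 → (∀ᶠ x in atTop, x * deriv U x / U x ≤ c) →
      limsup (elasticity U) atTop < 1 := fun c hc hev =>
    (limsup_le_of_le (a := (c : EReal)) (by isBoundedDefault)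
      (hev.mono fun x hx => by rw [elasticity]; exact_mod_cast hx)).trans_lt (by exact_mod_cast hc)
  by_cases hpos : ∃ x₁, 0 < U x₁
  swap
  · push Not at hpos
    refine key 0 one_pos ?_
    filter_upwards [eventually_ge_atTop 0] with x hx
    exact div_nonpos_of_nonneg_of_nonpos (mul_nonneg hx (hU.deriv_pos x).le) (hpos x)
  obtain ⟨x₁, hx₁⟩ := hpos
  rcases tendsto_atTop_of_monotone hU.strictMono.monotone with htop | ⟨L, hL⟩
  · refine key ((A + 1 / 2) / (A + 1)) (by rw [div_lt_one (by linarith)]; linarith) ?_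
    filter_upwards [htop.eventually_ge_atTop (2 * B), htop.eventually_gt_atTop 0] with x h1 h2
    rw [div_le_div_iff₀ h2 (by linarith)]
    have h3 := (le_abs_self _).trans (h x)
    nlinarith
  · have hL0 : 0 < L := hx₁.trans_le (hU.strictMono.monotone.ge_of_tendsto hL x₁)
    refine key (1 / 2) (by norm_num) ?_
    have h2 : Tendsto (fun x : ℝ => U (x / 2)) atTop (𝓝 L) :=
      hL.comp (tendsto_id.atTop_div_const two_pos)
    filter_upwards [h2.eventually (lt_mem_nhds (show 7 / 8 * L < L by linarith)),
      hL.eventually (lt_mem_nhds (show 7 / 8 * L < L by linarith)), eventually_ge_atTop 0]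
      with x h3 h4 hx0
    have h5 := hU.le_tangent x (x / 2)
    have h6 : U x ≤ L := hU.strictMono.monotone.ge_of_tendsto hL x
    rw [div_le_iff₀ (by linarith)]
    linarith

lemma one_lt_liminf_elasticity {A B : ℝ} (hA : 1 < A)
    (h : ∀ x, |x * deriv U x| ≤ A * (U x - x * deriv U x) + B) :
    1 < liminf (elasticity U) atBot := by
  have hA1 : 0 < A - 1 := by linarith
  have hc : 1 < (A - 1 / 2) / (A - 1) := by rw [one_lt_div hA1]; linarith
  refine lt_of_lt_of_le (b := (((A - 1 / 2) / (A - 1) : ℝ) : EReal)) (by exact_mod_cast hc) ?_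
  refine le_liminf_of_le (by isBoundedDefault) ?_
  filter_upwards [hU.tendsto_atBot.eventually (eventually_lt_atBot 0),
    hU.tendsto_atBot.eventually (eventually_le_atBot (-2 * B))] with x hx hx2
  rw [elasticity, EReal.coe_le_coe_iff, le_div_iff_of_neg hx, div_mul_eq_mul_div, le_div_iff₀ hA1]
  have h3 := (neg_le_abs _).trans (h x)
  nlinarith

/-! ### Growth of the conjugate function -/

omit hU in
/-- `V(q) - U(0)` as an element of `[0, ∞]`. -/
def _root_.AbstractDuality.excess (U : ℝ → ℝ) (q : ℝ) : ℝ≥0∞ := (legendre U q - (U 0 : ℝ)).toENNReal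

omit hU in
lemma _root_.AbstractDuality.measurable_excess (U : ℝ → ℝ) : Measurable (excess U) :=
  ((measurable_legendre U).sub measurable_const).ereal_toENNReal

omit hU in
lemma _root_.AbstractDuality.excess_eq {q : ℝ} (h : legendre U q ≠ ⊤) :
    excess U q = ENNReal.ofReal (conj U q - U 0) := by
  rw [excess, ← coe_conj h, ← EReal.coe_sub, EReal.real_coe_toENNReal]

omit hU in
lemma _root_.AbstractDuality.excess_ne_top {q : ℝ} : excess U q ≠ ⊤ ↔ legendre U q ≠ ⊤ := by
  constructor
  · intro h h'
    apply h
    rw [excess, h', EReal.top_sub_coe]; rfl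
  · intro h
    rw [excess_eq h]; exact ENNReal.ofReal_ne_top

omit hU in
lemma _root_.AbstractDuality.zero_le_conj_sub {q : ℝ} (h : legendre U q ≠ ⊤) : 0 ≤ conj U q - U 0 := by
  have := le_conj h 0
  linarith

/-- The multiplicative growth of `V` near a point. -/
lemma conj_scale_near {A B : ℝ} (hA : 0 ≤ A) (hB : 0 ≤ B)
    (h : ∀ x, |x * deriv U x| ≤ A * (U x - x * deriv U x - U 0) + B) {l q : ℝ} (hq : 0 < q)
    (hl : 0 < l) (hlA : |l - 1| / l * (2 * (A + 1)) ≤ 1) :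
    conj U (l * q) - U 0 ≤ 2 * (conj U q - U 0) + 2 * B := by
  have hlq : 0 < l * q := mul_pos hl hq
  have h1 := hU.conj_ge_tangent hlq hq
  have h2 := h (margInv U (l * q))
  have h3 := hU.conj_eq hlq
  rw [hU.deriv_margInv hlq] at h2
  have h4 : 0 ≤ conj U (l * q) - U 0 := zero_le_conj_sub (hU.legendre_ne_top hlq)
  have h5 : margInv U (l * q) * (q - l * q) ≤
      |l - 1| / l * |margInv U (l * q) * (l * q)| := by
    refine (le_abs_self _).trans (le_of_eq ?_)
    rw [abs_mul, abs_mul, show q - l * q = -((l - 1) * q) by ring, abs_neg, abs_mul, abs_mul,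
      abs_of_pos hl]
    field_simp
  set t := |l - 1| / l with ht
  have ht0 : 0 ≤ t := by positivity
  set w := conj U (l * q) - U 0 with hw
  have h6 : t * |margInv U (l * q) * (l * q)| ≤ t * (A * w + B) := by
    refine mul_le_mul_of_nonneg_left (h2.trans (le_of_eq ?_)) ht0
    rw [hw, h3]
  have h7 : t * (A * w) ≤ 1 / 2 * w := by nlinarith
  have h8 : t * B ≤ B := by nlinarith
  nlinarith

/-- `V` grows at most like a power under scaling of its argument. -/
lemma exists_excess_scale (hAE : HasReasonableAE U) {l : ℝ} (hl : 0 < l) :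
    ∃ K : ℝ≥0∞, K ≠ ⊤ ∧ ∀ q, 0 ≤ q → excess U (l * q) ≤ K * excess U q + K := by
  obtain ⟨A, B, hA, hB, h⟩ := hU.elastic_bound hAE
  set S : Set ℝ := {l | ∃ K : ℝ≥0∞, 1 ≤ K ∧ K ≠ ⊤ ∧ ∀ q, 0 ≤ q →
    excess U (l * q) ≤ K * excess U q + K} with hS
  have hnear : ∀ m : ℝ, 0 < m → |m - 1| / m * (2 * (A + 1)) ≤ 1 → m ∈ S := by
    intro m hm hmA
    refine ⟨2 + ENNReal.ofReal (2 * B), le_add_right (by norm_num),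
      by finiteness, fun q hq => ?_⟩
    rcases hq.eq_or_lt with rfl | hq
    · rw [mul_zero]
      refine le_add_right ?_
      calc excess U 0 = 1 * excess U 0 := (one_mul _).symm
        _ ≤ _ := by gcongr; exact le_add_right (by norm_num)
    · rw [excess_eq (hU.legendre_ne_top (mul_pos hm hq)), excess_eq (hU.legendre_ne_top hq)]
      calc ENNReal.ofReal (conj U (m * q) - U 0)
          ≤ ENNReal.ofReal (2 * (conj U q - U 0) + 2 * B) :=
            ENNReal.ofReal_le_ofReal (hU.conj_scale_near hA hB h hq hm hmA)
        _ ≤ ENNReal.ofReal (2 * (conj U q - U 0)) + ENNReal.ofReal (2 * B) :=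
            ENNReal.ofReal_add_le
        _ = 2 * ENNReal.ofReal (conj U q - U 0) + ENNReal.ofReal (2 * B) := by
            rw [ENNReal.ofReal_mul zero_le_two]; norm_num
        _ ≤ _ := by gcongr <;> simp
  have hmul : ∀ a b : ℝ, 0 < b → a ∈ S → b ∈ S → a * b ∈ S := by
    rintro a b hb ⟨K, hK1, hK, hKq⟩ ⟨M, hM1, hM, hMq⟩
    refine ⟨K * M + K, le_add_left hK1, by finiteness, fun q hq => ?_⟩
    calc excess U (a * b * q) = excess U (a * (b * q)) := by rw [mul_assoc]
      _ ≤ K * excess U (b * q) + K := hKq _ (by positivity)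
      _ ≤ K * (M * excess U q + M) + K := by gcongr; exact hMq q hq
      _ = K * M * excess U q + (K * M + K) := by ring
      _ ≤ _ := by gcongr; exact le_self_add
  have hlim : Tendsto (fun n : ℕ => Real.exp (Real.log l / n)) atTop (𝓝 1) := by
    have : Tendsto (fun n : ℕ => Real.log l / n) atTop (𝓝 0) :=
      tendsto_const_div_atTop_nhds_zero_nat _
    rw [← Real.exp_zero]
    exact (Real.continuous_exp.tendsto 0).comp this
  have hev : ∀ᶠ m in 𝓝 (1 : ℝ), |m - 1| / m * (2 * (A + 1)) < 1 := by
    have : ContinuousAt (fun m : ℝ => |m - 1| / m * (2 * (A + 1))) 1 := by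
      fun_prop (disch := norm_num)
    exact this.eventually (gt_mem_nhds (by simp))
  obtain ⟨n, hn, hn0⟩ := ((hlim.eventually hev).and (eventually_gt_atTop 0)).exists
  set m := Real.exp (Real.log l / n) with hm
  have hm0 : 0 < m := Real.exp_pos _
  have hmS : m ∈ S := hnear m hm0 hn.le
  have hpow : ∀ k : ℕ, m ^ (k + 1) ∈ S := by
    intro k
    induction k with
    | zero => simpa using hmS
    | succ k ih => rw [pow_succ]; exact hmul _ _ hm0 ih hmS
  have hlm : l = m ^ n := by
    rw [hm, ← Real.exp_nat_mul, mul_div_cancel₀ _ (by exact_mod_cast hn0.ne'), Real.exp_log hl]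
  obtain ⟨k, rfl⟩ := Nat.exists_eq_succ_of_ne_zero hn0.ne'
  obtain ⟨K, -, hK, hKq⟩ := hpow k
  refine ⟨K, hK, ?_⟩
  rw [hlm]
  exact hKq

end IsUtility

section

variable {Ω : Type*} [MeasurableSpace Ω] {P : Measure Ω}

/-! ### The cone of bounded claims -/

lemma const_eq_smul_one (a : ℝ) : (AEEqFun.const Ω a : Ω →ₘ[P] ℝ) = a • (1 : Ω →ₘ[P] ℝ) := by
  rw [AEEqFun.one_def, AEEqFun.const, AEEqFun.smul_mk]
  congr 1
  ext ω
  simp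

section
variable {C : Set (Ω →ₘ[P] ℝ)} (hC : IsAdmissibleSet C)
include hC

lemma mem_boundedClaims_iff {x : ℝ} {f : Ω →ₘ[P] ℝ} :
    f ∈ boundedClaims C x ↔
      ∃ a : ℝ, 0 < x + a ∧ ∃ g ∈ C, f = (x + a) • g - a • (1 : Ω →ₘ[P] ℝ) := by
  constructor
  · rintro ⟨n, -, hn, g, hg, rfl⟩
    exact ⟨n, hn, g, hg, by rw [const_eq_smul_one]⟩
  · rintro ⟨a, ha, g, hg, rfl⟩
    obtain ⟨n, hn⟩ := exists_nat_ge (max a 1)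
    have hna : a ≤ n := (le_max_left _ _).trans hn
    have hn1 : (1 : ℝ) ≤ n := (le_max_right _ _).trans hn
    have hxn : 0 < x + n := by linarith
    refine ⟨n, by exact_mod_cast hn1, hxn,
      ((x + a) / (x + n)) • g + ((n - a) / (x + n)) • (1 : Ω →ₘ[P] ℝ), ?_, ?_⟩
    · exact hC.convex hg hC.one_mem (by positivity) (div_nonneg (by linarith) hxn.le)
        (by rw [← add_div, div_eq_one_iff_eq hxn.ne']; ring)
    · rw [const_eq_smul_one, smul_add, smul_smul, smul_smul, mul_div_cancel₀ _ hxn.ne',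
        mul_div_cancel₀ _ hxn.ne']
      module

lemma const_mem_boundedClaims (c : ℝ) : c • (1 : Ω →ₘ[P] ℝ) ∈ boundedClaims C c := by
  rw [mem_boundedClaims_iff hC]
  exact ⟨1 - c, by simp, 1, hC.one_mem, by module⟩

lemma sub_one_mem_boundedClaims {g : Ω →ₘ[P] ℝ} (hg : g ∈ C) :
    g - (1 : Ω →ₘ[P] ℝ) ∈ boundedClaims C 0 := by
  rw [mem_boundedClaims_iff hC]
  exact ⟨1, by simp, g, hg, by simp⟩

lemma add_mem_boundedClaims {x y : ℝ} {f g : Ω →ₘ[P] ℝ} (hf : f ∈ boundedClaims C x)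
    (hg : g ∈ boundedClaims C y) : f + g ∈ boundedClaims C (x + y) := by
  rw [mem_boundedClaims_iff hC] at *
  obtain ⟨a, ha, f, hf, rfl⟩ := hf
  obtain ⟨b, hb, g, hg, rfl⟩ := hg
  have h : 0 < x + y + (a + b) := by linarith
  refine ⟨a + b, h, ((x + a) / (x + y + (a + b))) • f + ((y + b) / (x + y + (a + b))) • g,
    hC.convex hf hg (by positivity) (by positivity) ?_, ?_⟩
  · rw [← add_div, div_eq_one_iff_eq h.ne']; ring
  · rw [smul_add, smul_smul, smul_smul, mul_div_cancel₀ _ h.ne', mul_div_cancel₀ _ h.ne']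
    module

lemma smul_mem_boundedClaims {x l : ℝ} (hl : 0 < l) {f : Ω →ₘ[P] ℝ} (hf : f ∈ boundedClaims C x) :
    l • f ∈ boundedClaims C (l * x) := by
  rw [mem_boundedClaims_iff hC] at *
  obtain ⟨a, ha, f, hf, rfl⟩ := hf
  refine ⟨l * a, by rw [← mul_add]; positivity, f, hf, by module⟩

lemma combo_mem_boundedClaims {x y a b : ℝ} (ha : 0 < a) (hb : 0 < b) {f g : Ω →ₘ[P] ℝ}
    (hf : f ∈ boundedClaims C x) (hg : g ∈ boundedClaims C y) :
    a • f + b • g ∈ boundedClaims C (a * x + b * y) :=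
  add_mem_boundedClaims hC (smul_mem_boundedClaims hC ha hf) (smul_mem_boundedClaims hC hb hg)

end

/-! ### Densities -/

section
variable {C : Set (Ω →ₘ[P] ℝ)} {h : Ω →ₘ[P] ℝ}

lemma acDensities_nonneg (hh : h ∈ acDensities C) : ∀ᵐ ω ∂P, 0 ≤ h ω := by
  have := AEEqFun.coeFn_le.2 hh.1.1
  filter_upwards [this, AEEqFun.coeFn_zero (β := ℝ) (μ := P)] with ω h1 h2
  rwa [h2] at h1

lemma integrable_acDensities (hh : h ∈ acDensities C) : Integrable h P := by
  refine ⟨h.aestronglyMeasurable, ?_⟩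
  rw [hasFiniteIntegral_iff_ofReal (acDensities_nonneg hh), hh.2]
  exact ENNReal.one_lt_top

lemma integral_acDensities (hh : h ∈ acDensities C) : ∫ ω, h ω ∂P = 1 := by
  rw [integral_eq_lintegral_of_nonneg_ae (acDensities_nonneg hh) h.aestronglyMeasurable, hh.2]
  simp

/-- The budget inequality. -/
lemma integral_mul_le (hC : IsAdmissibleSet C) (hh : h ∈ acDensities C) {x : ℝ} {f : Ω →ₘ[P] ℝ}
    (hf : f ∈ boundedClaims C x) :
    Integrable (fun ω => h ω * f ω) P ∧ ∫ ω, h ω * f ω ∂P ≤ x := by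
  obtain ⟨a, ha, g, hg, rfl⟩ := (mem_boundedClaims_iff hC).1 hf
  have hg0 : ∀ᵐ ω ∂P, 0 ≤ g ω := by
    filter_upwards [AEEqFun.coeFn_le.2 (hC.nonneg g hg),
      AEEqFun.coeFn_zero (β := ℝ) (μ := P)] with ω h1 h2
    rwa [h2] at h1
  have hgh0 : ∀ᵐ ω ∂P, 0 ≤ g ω * h ω := by
    filter_upwards [hg0, acDensities_nonneg hh] with ω h1 h2 using mul_nonneg h1 h2
  have hmeas : AEStronglyMeasurable (fun ω => g ω * h ω) P :=
    g.aestronglyMeasurable.mul h.aestronglyMeasurable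
  have hle := hh.1.2 g hg
  have hint : Integrable (fun ω => g ω * h ω) P :=
    ⟨hmeas, by rw [hasFiniteIntegral_iff_ofReal hgh0]; exact hle.trans_lt ENNReal.one_lt_top⟩
  have hgh : ∫ ω, g ω * h ω ∂P ≤ 1 := by
    rw [integral_eq_lintegral_of_nonneg_ae hgh0 hmeas]
    exact ENNReal.toReal_le_of_le_ofReal zero_le_one (by simpa using hle)
  have heq : (fun ω => h ω * ((x + a) • g - a • (1 : Ω →ₘ[P] ℝ) : Ω →ₘ[P] ℝ) ω) =ᵐ[P]
      fun ω => (x + a) * (g ω * h ω) - a * h ω := by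
    filter_upwards [AEEqFun.coeFn_sub ((x + a) • g) (a • (1 : Ω →ₘ[P] ℝ)),
      AEEqFun.coeFn_smul (x + a) g, AEEqFun.coeFn_smul a (1 : Ω →ₘ[P] ℝ),
      AEEqFun.coeFn_one (β := ℝ) (μ := P)] with ω h1 h2 h3 h4
    rw [h1]
    simp only [Pi.sub_apply, h2, h3, Pi.smul_apply, h4, Pi.one_apply, smul_eq_mul]
    ring
  have hint2 := (hint.const_mul (x + a)).sub ((integrable_acDensities hh).const_mul a)
  refine ⟨(integrable_congr heq).2 hint2, ?_⟩
  rw [integral_congr_ae heq, integral_sub (hint.const_mul _)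
    ((integrable_acDensities hh).const_mul a), integral_const_mul, integral_const_mul,
    integral_acDensities hh]
  nlinarith

end

end

section

variable {Ω : Type*} [MeasurableSpace Ω] {P : Measure Ω}

/-! ### Expected utility on `L^∞` -/

section
variable {U : ℝ → ℝ} (hU : IsUtility U)
include hU

lemma IsUtility.abs_le_of_abs_le {M t : ℝ} (ht : |t| ≤ M) : |U t| ≤ |U M| + |U (-M)| := by
  have h1 := hU.strictMono.monotone (abs_le.1 ht).1
  have h2 := hU.strictMono.monotone (abs_le.1 ht).2
  rw [abs_le]
  constructor
  · linarith [neg_abs_le (U (-M)), abs_nonneg (U M)]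
  · linarith [le_abs_self (U M), abs_nonneg (U (-M))]

lemma IsUtility.integrable_comp_of_bound [IsFiniteMeasure P] {f : Ω → ℝ}
    (hf : AEStronglyMeasurable f P) {M : ℝ} (hM : ∀ᵐ ω ∂P, |f ω| ≤ M) :
    Integrable (fun ω => U (f ω)) P :=
  Integrable.of_bound (hU.continuous.comp_aestronglyMeasurable hf) (|U M| + |U (-M)|)
    (hM.mono fun ω h => by rw [Real.norm_eq_abs]; exact hU.abs_le_of_abs_le h)

lemma IsUtility.abs_sub_le {M a b : ℝ} (ha : |a| ≤ M) (hb : |b| ≤ M) :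
    |U a - U b| ≤ deriv U (-M) * |a - b| := by
  have key : ∀ a b : ℝ, |a| ≤ M → |b| ≤ M → U a - U b ≤ deriv U (-M) * |a - b| := by
    intro a b ha hb
    have h1 := hU.le_tangent b a
    have h2 : deriv U b * (a - b) ≤ deriv U b * |a - b| :=
      mul_le_mul_of_nonneg_left (le_abs_self _) (hU.deriv_pos b).le
    have h3 : deriv U b * |a - b| ≤ deriv U (-M) * |a - b| :=
      mul_le_mul_of_nonneg_right (hU.deriv_strictAnti.antitone (abs_le.1 hb).1) (abs_nonneg _)
    linarith
  rw [abs_le]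
  constructor
  · have := key b a hb ha
    rw [abs_sub_comm] at this
    linarith
  · exact key a b ha hb

end

lemma ae_abs_le_norm (Z : Lp ℝ ∞ P) : ∀ᵐ ω ∂P, |Z ω| ≤ ‖Z‖ := by
  filter_upwards [ae_le_eLpNormEssSup (f := Z) (μ := P)] with ω hω
  rw [← Real.norm_eq_abs, Lp.norm_def, eLpNorm_exponent_top]
  rw [← toReal_enorm]
  refine ENNReal.toReal_mono ?_ hω
  have := Lp.eLpNorm_ne_top Z
  rwa [eLpNorm_exponent_top] at this

lemma IsUtility.continuous_expectation [IsProbabilityMeasure P] {U : ℝ → ℝ} (hU : IsUtility U) :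
    Continuous fun Z : Lp ℝ ∞ P => ∫ ω, U (Z ω) ∂P := by
  rw [continuous_iff_continuousAt]
  intro Z
  set M := ‖Z‖ + 1 with hM
  rw [ContinuousAt, tendsto_iff_dist_tendsto_zero]
  have hlim : Tendsto (fun W : Lp ℝ ∞ P => deriv U (-M) * ‖W - Z‖) (𝓝 Z) (𝓝 0) := by
    have : Continuous fun W : Lp ℝ ∞ P => deriv U (-M) * ‖W - Z‖ := by fun_prop
    simpa using this.tendsto Z
  refine squeeze_zero' (Eventually.of_forall fun _ => dist_nonneg) ?_ hlim
  filter_upwards [Metric.ball_mem_nhds Z one_pos] with W hW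
  have hW1 : ‖W - Z‖ < 1 := by rwa [← dist_eq_norm]
  have hWM : ‖W‖ ≤ M := by
    have := norm_add_le (W - Z) Z
    rw [sub_add_cancel] at this
    linarith
  have hZb := ae_abs_le_norm Z
  have hWb := ae_abs_le_norm W
  have hi : ∀ X : Lp ℝ ∞ P, Integrable (fun ω => U (X ω)) P := fun X =>
    hU.integrable_comp_of_bound (Lp.aestronglyMeasurable X) (ae_abs_le_norm X)
  rw [dist_eq_norm, ← integral_sub (hi W) (hi Z)]
  have := norm_integral_le_of_norm_le_const (μ := P) (f := fun ω => U (W ω) - U (Z ω))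
    (C := deriv U (-M) * ‖W - Z‖) ?_
  · simpa using this
  filter_upwards [hZb, hWb, ae_abs_le_norm (W - Z), Lp.coeFn_sub W Z] with ω h1 h2 h3 h4
  rw [h4] at h3
  rw [Real.norm_eq_abs]
  refine (hU.abs_sub_le (M := M) (by linarith) (by linarith)).trans ?_
  exact mul_le_mul_of_nonneg_left h3 (hU.deriv_pos _).le

/-- Hahn–Banach: a linear functional that dominates the expected utility and is dominated by the
cost on the cone of bounded claims. -/
lemma exists_functional [IsProbabilityMeasure P] {C : Set (Ω →ₘ[P] ℝ)} (hC : IsAdmissibleSet C)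
    {U : ℝ → ℝ} (hU : IsUtility U) {y s : ℝ}
    (hs : ∀ (x : ℝ) (Z : Lp ℝ ∞ P), (Z : Ω →ₘ[P] ℝ) ∈ boundedClaims C x →
      ∫ ω, U (Z ω) ∂P - x * y ≤ s) :
    ∃ m : Lp ℝ ∞ P →L[ℝ] ℝ, (∀ Z, ∫ ω, U (Z ω) ∂P - s ≤ m Z) ∧
      ∀ (x : ℝ) (Z : Lp ℝ ∞ P), (Z : Ω →ₘ[P] ℝ) ∈ boundedClaims C x → m Z ≤ x * y := by
  set A : Set (Lp ℝ ∞ P × ℝ) := {p | p.2 < ∫ ω, U (p.1 ω) ∂P - s} with hA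
  set B : Set (Lp ℝ ∞ P × ℝ) :=
    {p | ∃ x : ℝ, (p.1 : Ω →ₘ[P] ℝ) ∈ boundedClaims C x ∧ x * y ≤ p.2} with hB
  have hi : ∀ X : Lp ℝ ∞ P, Integrable (fun ω => U (X ω)) P := fun X =>
    hU.integrable_comp_of_bound (Lp.aestronglyMeasurable X) (ae_abs_le_norm X)
  have hAopen : IsOpen A :=
    isOpen_lt continuous_snd ((hU.continuous_expectation.comp continuous_fst).sub continuous_const)
  have hAconv : Convex ℝ A := by
    have hconc : ConcaveOn ℝ univ fun Z : Lp ℝ ∞ P => ∫ ω, U (Z ω) ∂P - s := by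
      refine ⟨convex_univ, fun Z _ W _ a b ha hb hab => ?_⟩
      have h1 : a • (∫ ω, U (Z ω) ∂P) + b • ∫ ω, U (W ω) ∂P ≤ ∫ ω, U ((a • Z + b • W : Lp ℝ ∞ P) ω) ∂P := by
        simp only [smul_eq_mul]
        rw [← integral_const_mul, ← integral_const_mul,
          ← integral_add ((hi Z).const_mul a) ((hi W).const_mul b)]
        refine integral_mono_ae (((hi Z).const_mul a).add ((hi W).const_mul b)) (hi _) ?_
        filter_upwards [Lp.coeFn_add (a • Z) (b • W), Lp.coeFn_smul a Z, Lp.coeFn_smul b W]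
          with ω h1 h2 h3
        rw [h1, Pi.add_apply, h2, h3]
        exact hU.strictConcave.concaveOn.2 (mem_univ _) (mem_univ _) ha hb hab
      simp only [smul_eq_mul] at h1 ⊢
      have : s = a * s + b * s := by rw [← add_mul, hab, one_mul]
      linarith
    have := hconc.convex_strict_hypograph
    simpa [hA] using this
  have hBcone : ∀ p ∈ B, ∀ l : ℝ, 0 < l → l • p ∈ B := by
    rintro p ⟨x, hx, hxp⟩ l hl
    refine ⟨l * x, ?_, ?_⟩
    · exact smul_mem_boundedClaims hC hl hx
    · simp only [Prod.smul_snd, smul_eq_mul, mul_assoc]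
      gcongr
  have hBadd : ∀ p ∈ B, ∀ q ∈ B, p + q ∈ B := by
    rintro p ⟨x, hx, hxp⟩ q ⟨x', hx', hxq⟩
    refine ⟨x + x', add_mem_boundedClaims hC hx hx', ?_⟩
    simp only [Prod.snd_add]
    linarith
  have hBconv : Convex ℝ B := by
    rw [convex_iff_forall_pos]
    exact fun p hp q hq a b ha hb _ => hBadd _ (hBcone p hp a ha) _ (hBcone q hq b hb)
  have hdisj : Disjoint A B := by
    rw [Set.disjoint_left]
    rintro p hpA ⟨x, hx, hxp⟩
    have h1 := hs x p.1 hx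
    have h2 : p.2 < ∫ ω, U (p.1 ω) ∂P - s := hpA
    linarith
  obtain ⟨φ, c, hφA, hφB⟩ := geometric_hahn_banach_open hAconv hAopen hBconv hdisj
  have hφ : ∀ (Z : Lp ℝ ∞ P) (t : ℝ), φ (Z, t) = φ (Z, 0) + t * φ (0, 1) := by
    intro Z t
    rw [← smul_eq_mul, ← map_smul, ← map_add]
    simp
  have hzero : ∀ t : ℝ, 0 ≤ t → ((0 : Lp ℝ ∞ P), t) ∈ B := by
    intro t ht
    refine ⟨0, ?_, by simpa using ht⟩
    have := const_mem_boundedClaims hC 0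
    simpa using this
  have hc0 : c ≤ 0 := by
    have := hφB _ (hzero 0 le_rfl)
    rwa [show ((0 : Lp ℝ ∞ P), (0 : ℝ)) = 0 from rfl, map_zero] at this
  have hBnonneg : ∀ p ∈ B, 0 ≤ φ p := by
    intro p hp
    by_contra! hneg
    have h1 : 0 < (c - 1) / φ p := div_pos_of_neg_of_neg (by linarith) hneg
    have h2 := hφB _ (hBcone p hp _ h1)
    rw [map_smul, smul_eq_mul, div_mul_cancel₀ _ hneg.ne] at h2
    linarith
  have hk0 : 0 ≤ φ (0, 1) := hBnonneg _ (hzero 1 zero_le_one)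
  have hk : 0 < φ (0, 1) := by
    refine hk0.lt_of_ne fun h => ?_
    have h1 := hφA (0, ∫ ω, U ((0 : Lp ℝ ∞ P) ω) ∂P - s - 1) (by simp [hA])
    rw [hφ, ← h] at h1
    have h2 : φ ((0 : Lp ℝ ∞ P), (0 : ℝ)) = 0 := map_zero φ
    have h3 := hφB _ (hzero 0 le_rfl)
    rw [h2] at h1 h3
    linarith
  set k := φ (0, 1) with hkdef
  refine ⟨-(k⁻¹ • φ.comp (ContinuousLinearMap.inl ℝ (Lp ℝ ∞ P) ℝ)), fun Z => ?_, fun x Z hZ => ?_⟩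
  · simp only [neg_apply, smul_apply,
      ContinuousLinearMap.comp_apply, ContinuousLinearMap.inl_apply, smul_eq_mul]
    refine le_of_forall_lt fun t ht => ?_
    have h1 := hφA (Z, t) ht
    rw [hφ] at h1
    have h2 : t * k < -φ (Z, 0) := by linarith
    rw [inv_mul_eq_div, ← neg_div, lt_div_iff₀ hk]
    exact h2
  · simp only [neg_apply, smul_apply,
      ContinuousLinearMap.comp_apply, ContinuousLinearMap.inl_apply, smul_eq_mul]
    have h1 := hBnonneg (Z, x * y) ⟨x, hZ, le_rfl⟩
    rw [hφ] at h1
    rw [inv_mul_eq_div, ← neg_div, div_le_iff₀ hk]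
    linarith

end

section

variable {Ω : Type*} [MeasurableSpace Ω] {P : Measure Ω} [IsProbabilityMeasure P]

/-! ### Functionals dominating an expected utility are densities -/

section
variable {U : ℝ → ℝ} (hU : IsUtility U) {s : ℝ} {m : Lp ℝ ∞ P →L[ℝ] ℝ}
  (hm : ∀ Z, ∫ ω, U (Z ω) ∂P - s ≤ m Z)
include hU hm

lemma eventually_functional_lt {Z : ℕ → Lp ℝ ∞ P} {M : ℝ} (hM : ∀ n, ∀ᵐ ω ∂P, |Z n ω| ≤ M)
    (hZ : ∀ᵐ ω ∂P, Tendsto (fun n => Z n ω) atTop (𝓝 0)) {c : ℝ} (hc : c < 0) :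
    ∀ᶠ n in atTop, c < m (Z n) := by
  obtain ⟨k, hk⟩ := exists_nat_gt ((U 0 - s - 1) / c)
  set k' : ℝ := max k 1 with hk'
  have hk0 : 0 < k' := zero_lt_one.trans_le (le_max_right _ _)
  have hkc : k' * c < U 0 - s - 1 := by
    have : (U 0 - s - 1) / c < k' := hk.trans_le (le_max_left _ _)
    rwa [div_lt_iff_of_neg hc] at this
  have hsm : ∀ n, ∀ᵐ ω ∂P, (k' • Z n : Lp ℝ ∞ P) ω = k' * Z n ω := fun n => by
    filter_upwards [Lp.coeFn_smul k' (Z n)] with ω h1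
    rw [h1]; rfl
  have hlim : Tendsto (fun n => ∫ ω, U ((k' • Z n : Lp ℝ ∞ P) ω) ∂P) atTop (𝓝 (∫ _, U 0 ∂P)) := by
    refine tendsto_integral_of_dominated_convergence (fun _ => |U (k' * M)| + |U (-(k' * M))|)
      (fun n => hU.continuous.comp_aestronglyMeasurable (Lp.aestronglyMeasurable _))
      (integrable_const _) (fun n => ?_) ?_
    · filter_upwards [hM n, hsm n] with ω h1 h2
      rw [Real.norm_eq_abs, h2]
      refine hU.abs_le_of_abs_le ?_
      rw [abs_mul, abs_of_pos hk0]
      gcongr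
    · filter_upwards [hZ, ae_all_iff.2 hsm] with ω h1 h2
      simp only [h2]
      have := (hU.continuous.tendsto _).comp (h1.const_mul k')
      rwa [mul_zero] at this
  simp only [integral_const, probReal_univ, one_smul] at hlim
  filter_upwards [hlim.eventually (lt_mem_nhds (show U 0 - 1 < U 0 by linarith))] with n hn
  have h1 := hm (k' • Z n)
  rw [map_smul, smul_eq_mul] at h1
  have h2 : k' * c < k' * m (Z n) := by linarith
  exact lt_of_mul_lt_mul_left h2 hk0.le

lemma tendsto_functional {Z : ℕ → Lp ℝ ∞ P} {M : ℝ} (hM : ∀ n, ∀ᵐ ω ∂P, |Z n ω| ≤ M)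
    (hZ : ∀ᵐ ω ∂P, Tendsto (fun n => Z n ω) atTop (𝓝 0)) :
    Tendsto (fun n => m (Z n)) atTop (𝓝 0) := by
  rw [tendsto_order]
  refine ⟨fun c hc => eventually_functional_lt hU hm hM hZ hc, fun c hc => ?_⟩
  have hneg : ∀ n, ∀ᵐ ω ∂P, (-Z n : Lp ℝ ∞ P) ω = -Z n ω := fun n => by
    filter_upwards [Lp.coeFn_neg (Z n)] with ω h1
    rw [h1]; rfl
  have := eventually_functional_lt hU hm (Z := fun n => -Z n) (M := M) (fun n => ?_) ?_
    (c := -c) (by linarith)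
  · filter_upwards [this] with n hn
    rw [map_neg] at hn
    linarith
  · filter_upwards [hM n, hneg n] with ω h1 h2
    rwa [h2, abs_neg]
  · filter_upwards [hZ, ae_all_iff.2 hneg] with ω h1 h2
    simp only [h2]
    simpa using h1.neg

lemma functional_nonneg {Z : Lp ℝ ∞ P} (hZ : ∀ᵐ ω ∂P, 0 ≤ Z ω) : 0 ≤ m Z := by
  by_contra! hneg
  obtain ⟨k, hk⟩ := exists_nat_gt ((U 0 - s) / m Z)
  have hkm : k * m Z < U 0 - s := by rwa [div_lt_iff_of_neg hneg] at hk
  have h1 := hm ((k : ℝ) • Z)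
  rw [map_smul, smul_eq_mul] at h1
  have h2 : U 0 ≤ ∫ ω, U (((k : ℝ) • Z : Lp ℝ ∞ P) ω) ∂P := by
    have h3 : ∫ _, U 0 ∂P = U 0 := by simp
    rw [← h3]
    refine integral_mono_ae (integrable_const _)
      (hU.integrable_comp_of_bound (Lp.aestronglyMeasurable _) (ae_abs_le_norm _)) ?_
    filter_upwards [hZ, Lp.coeFn_smul (k : ℝ) Z] with ω h4 h5
    rw [h5]
    exact hU.strictMono.monotone (mul_nonneg k.cast_nonneg h4)
  linarith

lemma functional_indicator_nonneg {S : Set Ω} (hS : MeasurableSet S) :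
    0 ≤ m (indicatorConstLp ∞ hS (measure_ne_top P _) (1 : ℝ)) := by
  refine functional_nonneg hU hm ?_
  filter_upwards [indicatorConstLp_coeFn (p := ∞) (hs := hS) (hμs := measure_ne_top P S)
    (c := (1 : ℝ))] with ω h1
  rw [h1]
  exact indicator_nonneg (fun _ _ => zero_le_one) ω

omit hU hm in
lemma functional_indicator_union {A B : Set Ω} (hA : MeasurableSet A) (hB : MeasurableSet B)
    (hAB : Disjoint A B) :
    m (indicatorConstLp ∞ (hA.union hB) (measure_ne_top P _) (1 : ℝ)) =
      m (indicatorConstLp ∞ hA (measure_ne_top P _) (1 : ℝ)) +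
      m (indicatorConstLp ∞ hB (measure_ne_top P _) (1 : ℝ)) := by
  rw [← map_add, ← indicatorConstLp_disjoint_union hA hB (measure_ne_top P _)
    (measure_ne_top P _) hAB (1 : ℝ)]

lemma hasSum_functional_indicator {A : ℕ → Set Ω} (hA : ∀ i, MeasurableSet (A i))
    (hd : Pairwise (Function.onFun Disjoint A)) :
    HasSum (fun i => m (indicatorConstLp ∞ (hA i) (measure_ne_top P _) (1 : ℝ)))
      (m (indicatorConstLp ∞ (MeasurableSet.iUnion hA) (measure_ne_top P _) (1 : ℝ))) := by
  rw [hasSum_iff_tendsto_nat_of_nonneg fun i => functional_indicator_nonneg hU hm (hA i)]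
  have hR : ∀ n, MeasurableSet (⋃ i, ⋃ _ : n ≤ i, A i) := fun n =>
    MeasurableSet.iUnion fun i => MeasurableSet.iUnion fun _ => hA i
  set ρ : ℕ → ℝ := fun n => m (indicatorConstLp ∞ (hR n) (measure_ne_top P _) (1 : ℝ)) with hρ
  have hsplit : ∀ n, ρ n = m (indicatorConstLp ∞ (hA n) (measure_ne_top P _) (1 : ℝ)) + ρ (n + 1) := by
    intro n
    have hdis : Disjoint (A n) (⋃ i, ⋃ _ : n + 1 ≤ i, A i) := by
      simp only [Set.disjoint_iUnion_right]
      intro i hi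
      exact hd (by omega)
    have hset : (⋃ i, ⋃ _ : n ≤ i, A i) = A n ∪ ⋃ i, ⋃ _ : n + 1 ≤ i, A i := by
      ext ω
      simp only [mem_iUnion, mem_union, exists_prop]
      constructor
      · rintro ⟨i, hi, hω⟩
        rcases hi.eq_or_lt with rfl | hlt
        · exact Or.inl hω
        · exact Or.inr ⟨i, hlt, hω⟩
      · rintro (hω | ⟨i, hi, hω⟩)
        · exact ⟨n, le_rfl, hω⟩
        · exact ⟨i, by omega, hω⟩
    rw [hρ]
    simp only [hset]
    exact functional_indicator_union (hA n) (hR (n + 1)) hdis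
  have hsum : ∀ n, ∑ i ∈ Finset.range n, m (indicatorConstLp ∞ (hA i) (measure_ne_top P _) (1 : ℝ))
      = ρ 0 - ρ n := by
    intro n
    induction n with
    | zero => simp
    | succ n ih => rw [Finset.sum_range_succ, ih, hsplit n]; ring
  have hρ0 : Tendsto ρ atTop (𝓝 0) := by
    have hcoe : ∀ n, ∀ᵐ ω ∂P, (indicatorConstLp ∞ (hR n) (measure_ne_top P _) (1 : ℝ) : Lp ℝ ∞ P) ω
        = (⋃ i, ⋃ _ : n ≤ i, A i).indicator (fun _ => (1 : ℝ)) ω := fun n =>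
      indicatorConstLp_coeFn
    refine tendsto_functional hU hm (M := 1) (fun n => ?_) ?_
    · filter_upwards [hcoe n] with ω h1
      rw [h1]
      by_cases h : ω ∈ ⋃ i, ⋃ _ : n ≤ i, A i <;> simp [indicator, h]
    · filter_upwards [ae_all_iff.2 hcoe] with ω h1
      simp only [h1]
      refine tendsto_const_nhds.congr' ?_
      by_cases hω : ∃ i, ω ∈ A i
      · obtain ⟨i, hi⟩ := hω
        filter_upwards [eventually_gt_atTop i] with n hn
        rw [indicator_of_notMem]
        simp only [mem_iUnion, exists_prop, not_exists, not_and]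
        intro j hj hωj
        exact Set.disjoint_left.1 (hd (show i ≠ j by omega)) hi hωj
      · refine Eventually.of_forall fun n => ?_
        beta_reduce
        rw [indicator_of_notMem]
        simp only [mem_iUnion, exists_prop, not_exists, not_and]
        exact fun j _ hωj => hω ⟨j, hωj⟩
  have hρU : ρ 0 = m (indicatorConstLp ∞ (MeasurableSet.iUnion hA) (measure_ne_top P _) (1 : ℝ)) := by
    simp [hρ]
  simp only [hsum]
  rw [← hρU]
  simpa using hρ0.const_sub (ρ 0)

/-- A functional that dominates an expected utility is given by a non-negative density. -/
lemma exists_density : ∃ q : Ω → ℝ, Measurable q ∧ (∀ ω, 0 ≤ q ω) ∧ Integrable q P ∧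
    ∀ Z : Lp ℝ ∞ P, Integrable (fun ω => q ω * Z ω) P ∧ m Z = ∫ ω, q ω * Z ω ∂P := by
  set ν : Measure Ω := Measure.ofMeasurable
    (fun S hS => ENNReal.ofReal (m (indicatorConstLp ∞ hS (measure_ne_top P _) (1 : ℝ))))
    (by simp) (fun A hA hd => by
      have := hasSum_functional_indicator hU hm hA hd
      rw [← this.tsum_eq, ENNReal.ofReal_tsum_of_nonneg (fun i => functional_indicator_nonneg hU hm (hA i)) this.summable])
    with hν
  have hνS : ∀ {S : Set Ω} (hS : MeasurableSet S), ν S =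
      ENNReal.ofReal (m (indicatorConstLp ∞ hS (measure_ne_top P _) (1 : ℝ))) := fun hS =>
    Measure.ofMeasurable_apply _ hS
  have hfin : IsFiniteMeasure ν := ⟨by rw [hνS MeasurableSet.univ]; exact ENNReal.ofReal_lt_top⟩
  have hac : ν ≪ P := by
    refine Measure.AbsolutelyContinuous.mk fun S hS hPS => ?_
    rw [hνS hS]
    have : indicatorConstLp ∞ hS (measure_ne_top P _) (1 : ℝ) = 0 := by
      rw [Lp.eq_zero_iff_ae_eq_zero]
      refine indicatorConstLp_coeFn.trans ?_
      exact indicator_meas_zero hPS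
    simp [this]
  have hsimple : ∀ f : SimpleFunc Ω ℝ, m ((f.memLp_top P).toLp f) = ∫ ω, f ω ∂ν := by
    intro f
    induction f using SimpleFunc.induction with
    | const c hS =>
      rename_i S
      have h1 : (SimpleFunc.memLp_top (SimpleFunc.piecewise S hS (SimpleFunc.const Ω c)
          (SimpleFunc.const Ω 0)) P).toLp _ =
          c • indicatorConstLp ∞ hS (measure_ne_top P _) (1 : ℝ) := by
        apply Lp.ext
        filter_upwards [MemLp.coeFn_toLp (SimpleFunc.memLp_top (SimpleFunc.piecewise S hS
          (SimpleFunc.const Ω c) (SimpleFunc.const Ω 0)) P), Lp.coeFn_smul c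
          (indicatorConstLp ∞ hS (measure_ne_top P _) (1 : ℝ) : Lp ℝ ∞ P),
          indicatorConstLp_coeFn (p := ∞) (hs := hS) (hμs := measure_ne_top P S)
            (c := (1 : ℝ))] with ω h1 h2 h3
        rw [h1, h2, Pi.smul_apply, h3]
        by_cases hω : ω ∈ S <;> simp [SimpleFunc.coe_piecewise, indicator, hω]
      rw [h1, map_smul, smul_eq_mul]
      have h2 : ∫ ω, (SimpleFunc.piecewise S hS (SimpleFunc.const Ω c)
          (SimpleFunc.const Ω 0)) ω ∂ν = c * ν.real S := by
        have : ∀ ω, (SimpleFunc.piecewise S hS (SimpleFunc.const Ω c)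
          (SimpleFunc.const Ω 0)) ω = S.indicator (fun _ => c) ω := fun ω => by
          by_cases hω : ω ∈ S <;> simp [SimpleFunc.coe_piecewise, indicator, hω]
        simp only [this]
        rw [integral_indicator_const _ hS, smul_eq_mul, mul_comm]
      rw [h2, Measure.real, hνS hS, ENNReal.toReal_ofReal (functional_indicator_nonneg hU hm hS)]
    | add hd hf hg =>
      rename_i f g
      have h1 : (SimpleFunc.memLp_top (f + g) P).toLp _ =
          (f.memLp_top P).toLp f + (g.memLp_top P).toLp g := MemLp.toLp_add _ _
      rw [h1, map_add, hf, hg, ← integral_add (f.integrable_of_isFiniteMeasure)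
        (g.integrable_of_isFiniteMeasure)]
      rfl
  have hrep : ∀ Z : Lp ℝ ∞ P, Integrable Z ν ∧ m Z = ∫ ω, Z ω ∂ν := by
    intro Z
    have hsm : StronglyMeasurable (Z : Ω → ℝ) := Lp.stronglyMeasurable Z
    set M := ‖Z‖
    have hM : ∀ᵐ ω ∂P, ‖Z ω‖ ≤ M := ae_abs_le_norm Z
    have hMν : ∀ᵐ ω ∂ν, ‖Z ω‖ ≤ M := hac.ae_le hM
    set f := hsm.approxBounded M
    have hf : ∀ n ω, ‖f n ω‖ ≤ M := hsm.norm_approxBounded_le (norm_nonneg Z)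
    have hlim : ∀ᵐ ω ∂P, Tendsto (fun n => f n ω) atTop (𝓝 (Z ω)) :=
      hsm.tendsto_approxBounded_ae hM
    refine ⟨Integrable.of_bound hsm.aestronglyMeasurable M hMν, ?_⟩
    have h1 : Tendsto (fun n => ∫ ω, f n ω ∂ν) atTop (𝓝 (∫ ω, Z ω ∂ν)) :=
      tendsto_integral_of_dominated_convergence (fun _ => M)
        (fun n => (f n).aestronglyMeasurable) (integrable_const _)
        (fun n => Eventually.of_forall (hf n)) (hac.ae_le hlim)
    have h2 : Tendsto (fun n => m (Z - ((f n).memLp_top P).toLp (f n))) atTop (𝓝 0) := by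
      have hcoe : ∀ n, ∀ᵐ ω ∂P,
          (Z - ((f n).memLp_top P).toLp (f n) : Lp ℝ ∞ P) ω = Z ω - f n ω := fun n => by
        filter_upwards [Lp.coeFn_sub Z (((f n).memLp_top P).toLp (f n)),
          MemLp.coeFn_toLp ((f n).memLp_top P)] with ω h1 h2
        rw [h1, Pi.sub_apply, h2]
      refine tendsto_functional hU hm (M := M + M) (fun n => ?_) ?_
      · filter_upwards [hcoe n, hM] with ω h1 h2
        rw [h1, ← Real.norm_eq_abs]
        exact (norm_sub_le _ _).trans (add_le_add h2 (hf n ω))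
      · filter_upwards [ae_all_iff.2 hcoe, hlim] with ω h1 h2
        simp only [h1]
        simpa using h2.const_sub (Z ω)
    have h3 : Tendsto (fun n => ∫ ω, f n ω ∂ν) atTop (𝓝 (m Z)) := by
      have := h2.const_sub (m Z)
      simpa [map_sub, hsimple] using this
    exact tendsto_nhds_unique h3 h1
  refine ⟨fun ω => (ν.rnDeriv P ω).toReal, (Measure.measurable_rnDeriv ν P).ennreal_toReal,
    fun ω => ENNReal.toReal_nonneg, Measure.integrable_toReal_rnDeriv, fun Z => ?_⟩
  obtain ⟨h1, h2⟩ := hrep Z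
  refine ⟨?_, ?_⟩
  · simpa using (integrable_rnDeriv_smul_iff hac).2 h1
  · rw [h2, ← integral_rnDeriv_smul hac]
    simp

end

end

section

variable {Ω : Type*} [MeasurableSpace Ω] {P : Measure Ω} [IsProbabilityMeasure P]

/-! ### Existence of dual densities -/

omit [IsProbabilityMeasure P] in
lemma mem_Lp_top_of_bound {f : Ω →ₘ[P] ℝ} {M : ℝ} (hf : ∀ᵐ ω ∂P, |f ω| ≤ M) :
    f ∈ Lp ℝ ∞ P :=
  Lp.mem_Lp_iff_memLp.2 (memLp_top_of_bound f.aestronglyMeasurable M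
    (by simpa [Real.norm_eq_abs] using hf))

omit [IsProbabilityMeasure P] in
lemma coeFn_const_smul_one (c : ℝ) : ∀ᵐ ω ∂P, (c • (1 : Ω →ₘ[P] ℝ)) ω = c := by
  filter_upwards [AEEqFun.coeFn_smul c (1 : Ω →ₘ[P] ℝ), AEEqFun.coeFn_one (β := ℝ) (μ := P)]
    with ω h1 h2
  rw [h1, Pi.smul_apply, h2]
  simp

/-- Truncated maximisers in the definition of `V(q)`. -/
def truncMargInv (U : ℝ → ℝ) (n : ℕ) (q : ℝ) : ℝ :=
  if q ≤ 0 then n else if |margInv U q| ≤ n then margInv U q else 0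

section
variable {U : ℝ → ℝ} (hU : IsUtility U)
include hU

lemma measurable_truncMargInv (n : ℕ) : Measurable (truncMargInv U n) := by
  obtain ⟨J, hJ, hJe⟩ := hU.exists_measurable_invMarginal
  have hJr : Measurable fun q => (J q).toReal := hJ.ereal_toReal
  have : truncMargInv U n = fun q => if q ≤ 0 then (n : ℝ) else
      if |(J q).toReal| ≤ n then (J q).toReal else 0 := by
    funext q
    unfold truncMargInv
    split_ifs with h1 h2 h3 h3
    · rfl
    · rw [hJe q (not_le.1 h1).le]; rfl
    · rw [hJe q (not_le.1 h1).le] at h3; exact absurd h2 h3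
    · rw [hJe q (not_le.1 h1).le] at h3; exact absurd h3 h2
    · rfl
  rw [this]
  refine Measurable.ite measurableSet_Iic measurable_const (Measurable.ite ?_ hJr measurable_const)
  exact measurableSet_le hJr.norm measurable_const

omit hU in
lemma abs_truncMargInv_le (n : ℕ) (q : ℝ) : |truncMargInv U n q| ≤ n := by
  unfold truncMargInv
  split_ifs with h1 h2
  · simp
  · exact h2
  · simp

lemma truncMargInv_value {n : ℕ} {q : ℝ} (hq : 0 ≤ q) :
    0 ≤ U (truncMargInv U n q) - q * truncMargInv U n q - U 0 := by
  unfold truncMargInv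
  split_ifs with h1 h2
  · obtain rfl : q = 0 := le_antisymm h1 hq
    have := hU.strictMono.monotone (Nat.cast_nonneg (α := ℝ) n)
    linarith
  · have h3 := hU.conj_eq (not_le.1 h1)
    have h4 := zero_le_conj_sub (hU.legendre_ne_top (not_le.1 h1))
    linarith
  · simp

lemma excess_le_liminf {q : ℝ} (hq : 0 ≤ q) :
    excess U q ≤ liminf (fun n => ENNReal.ofReal
      (U (truncMargInv U n q) - q * truncMargInv U n q - U 0)) atTop := by
  rcases hq.eq_or_lt with rfl | h
  · refine le_of_forall_lt fun c hc => ?_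
    have : ∃ x : ℝ, c < ENNReal.ofReal (U x - U 0) := by
      by_contra! hcon
      refine absurd hc (not_lt.2 ?_)
      rw [excess, legendre_zero]
      rcases eq_or_ne c ⊤ with rfl | hctop
      · exact le_top
      have h1 : utilityTop U ≤ ((c.toReal + U 0 : ℝ) : EReal) := by
        refine iSup_le fun x => ?_
        have h2 := (ENNReal.ofReal_le_iff_le_toReal hctop).1 (hcon x)
        rw [EReal.coe_le_coe_iff]
        linarith
      have h3 : utilityTop U - (U 0 : ℝ) ≤ (c.toReal : EReal) := by
        refine (EReal.sub_le_sub h1 le_rfl).trans ?_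
        rw [← EReal.coe_sub]
        simp
      refine (EReal.toENNReal_le_toENNReal h3).trans ?_
      rw [EReal.real_coe_toENNReal, ENNReal.ofReal_toReal hctop]
    obtain ⟨x, hx⟩ := this
    refine lt_of_lt_of_le hx (le_liminf_of_le (by isBoundedDefault) ?_)
    obtain ⟨N, hN⟩ := exists_nat_ge x
    filter_upwards [eventually_ge_atTop N] with n hn
    refine ENNReal.ofReal_le_ofReal ?_
    have h4 : x ≤ n := hN.trans (by exact_mod_cast hn)
    have := hU.strictMono.monotone h4
    simp only [truncMargInv, le_refl, if_true, zero_mul, sub_zero]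
    linarith
  · refine le_liminf_of_le (by isBoundedDefault) ?_
    obtain ⟨N, hN⟩ := exists_nat_ge |margInv U q|
    filter_upwards [eventually_ge_atTop N] with n hn
    have h4 : |margInv U q| ≤ n := hN.trans (by exact_mod_cast hn)
    rw [excess_eq (hU.legendre_ne_top h), hU.conj_eq h, truncMargInv, if_neg (not_le.2 h),
      if_pos h4]
    refine le_of_eq ?_
    congr 1; ring

/-- The dual problem has a solution whenever the primal side is bounded. -/
lemma exists_acDensity {C : Set (Ω →ₘ[P] ℝ)} (hC : IsAdmissibleSet C) {y s : ℝ} (hy : 0 < y)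
    (hs : ∀ (x : ℝ) (f : Ω →ₘ[P] ℝ), f ∈ boundedClaims C x → (∃ M : ℝ, ∀ᵐ ω ∂P, |f ω| ≤ M) →
      ∫ ω, U (f ω) ∂P - x * y ≤ s) :
    ∃ h ∈ acDensities C, ∫⁻ ω, excess U (y * h ω) ∂P ≤ ENNReal.ofReal (s - U 0) := by
  obtain ⟨m, hm1, hm2⟩ := exists_functional hC hU (y := y) (s := s)
    fun x Z hZ => hs x Z hZ ⟨_, ae_abs_le_norm Z⟩
  obtain ⟨q, hqm, hq0, hqi, hq⟩ := exists_density hU hm1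
  have hbd : ∀ {x : ℝ} {f : Ω →ₘ[P] ℝ}, f ∈ boundedClaims C x → ∀ {M : ℝ},
      (∀ᵐ ω ∂P, |f ω| ≤ M) → Integrable (fun ω => q ω * f ω) P ∧ ∫ ω, q ω * f ω ∂P ≤ x * y := by
    intro x f hf M hM
    obtain ⟨h1, h2⟩ := hq ⟨f, mem_Lp_top_of_bound hM⟩
    have h3 := hm2 x ⟨f, mem_Lp_top_of_bound hM⟩ hf
    rw [h2] at h3
    exact ⟨h1, h3⟩
  have hqc : ∀ c : ℝ, c * ∫ ω, q ω ∂P ≤ c * y := by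
    intro c
    have h1 := (hbd (const_mem_boundedClaims hC c) (M := |c|)
      ((coeFn_const_smul_one c).mono fun ω h => by rw [h])).2
    rw [← integral_const_mul]
    refine le_trans (le_of_eq (integral_congr_ae ?_)) h1
    filter_upwards [coeFn_const_smul_one (P := P) c] with ω h
    rw [h, mul_comm]
  have hqy : ∫ ω, q ω ∂P = y := by
    have h1 := hqc 1
    have h2 := hqc (-1)
    linarith
  set h : Ω →ₘ[P] ℝ := AEEqFun.mk (fun ω => q ω / y) (hqm.div_const y).aestronglyMeasurable with hh
  have hcoe : ∀ᵐ ω ∂P, h ω = q ω / y := AEEqFun.coeFn_mk _ _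
  refine ⟨h, ⟨⟨?_, fun g hg => ?_⟩, ?_⟩, ?_⟩
  · rw [← AEEqFun.coeFn_le]
    filter_upwards [hcoe, AEEqFun.coeFn_zero (β := ℝ) (μ := P)] with ω h1 h2
    rw [h1, h2]
    exact div_nonneg (hq0 ω) hy.le
  · have hg0 : ∀ᵐ ω ∂P, 0 ≤ g ω := by
      filter_upwards [AEEqFun.coeFn_le.2 (hC.nonneg g hg),
        AEEqFun.coeFn_zero (β := ℝ) (μ := P)] with ω h1 h2
      rwa [h2] at h1
    have hk : ∀ k : ℕ, ∫⁻ ω, ENNReal.ofReal (min (g ω) k * h ω) ∂P ≤ 1 := by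
      intro k
      set gk : Ω →ₘ[P] ℝ := g ⊓ ((k : ℝ) • (1 : Ω →ₘ[P] ℝ)) with hgk
      have hgkc : ∀ᵐ ω ∂P, gk ω = min (g ω) k := by
        filter_upwards [AEEqFun.coeFn_inf g ((k : ℝ) • (1 : Ω →ₘ[P] ℝ)),
          coeFn_const_smul_one (P := P) (k : ℝ)] with ω h1 h2
        rw [h1, h2]
      have hgkC : gk ∈ C := by
        refine hC.solid gk g ?_ inf_le_left hg
        rw [← AEEqFun.coeFn_le]
        filter_upwards [hgkc, hg0, AEEqFun.coeFn_zero (β := ℝ) (μ := P)] with ω h1 h2 h3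
        rw [h1, h3]
        exact le_min h2 k.cast_nonneg
      have hsub : ∀ᵐ ω ∂P, (gk - (1 : Ω →ₘ[P] ℝ)) ω = min (g ω) k - 1 := by
        filter_upwards [AEEqFun.coeFn_sub gk (1 : Ω →ₘ[P] ℝ), hgkc,
          AEEqFun.coeFn_one (β := ℝ) (μ := P)] with ω h1 h2 h3
        rw [h1, Pi.sub_apply, h2, h3]; rfl
      obtain ⟨h1, h2⟩ := hbd (sub_one_mem_boundedClaims hC hgkC) (M := k + 1) (by
        filter_upwards [hsub, hg0] with ω h1 h2
        rw [h1, abs_le]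
        have h3 : 0 ≤ min (g ω) (k : ℝ) := le_min h2 k.cast_nonneg
        have h4 : min (g ω) (k : ℝ) ≤ k := min_le_right _ _
        constructor <;> linarith)
      have heq : (fun ω => q ω * (gk - (1 : Ω →ₘ[P] ℝ)) ω) =ᵐ[P]
          fun ω => q ω * min (g ω) k - q ω := by
        filter_upwards [hsub] with ω h1
        rw [h1]; ring
      have h3 : Integrable (fun ω => q ω * min (g ω) k) P := by
        have := ((integrable_congr heq).1 h1).add hqi
        refine this.congr (Eventually.of_forall fun ω => ?_)
        simp
      rw [integral_congr_ae heq, integral_sub h3 hqi, hqy] at h2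
      have h5 : ∀ᵐ ω ∂P, ENNReal.ofReal (min (g ω) k * h ω) =
          ENNReal.ofReal (q ω * min (g ω) k / y) := by
        filter_upwards [hcoe] with ω h1
        rw [h1]; congr 1; ring
      rw [lintegral_congr_ae h5,
        ← ofReal_integral_eq_lintegral_ofReal (h3.div_const y), integral_div]
      · rw [ENNReal.ofReal_le_one, div_le_one hy]; linarith
      · filter_upwards [hg0] with ω h1
        exact div_nonneg (mul_nonneg (hq0 ω) (le_min h1 k.cast_nonneg)) hy.le
    calc ∫⁻ ω, ENNReal.ofReal (g ω * h ω) ∂P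
        ≤ ∫⁻ ω, liminf (fun k : ℕ => ENNReal.ofReal (min (g ω) k * h ω)) atTop ∂P := by
          refine lintegral_mono fun ω => le_liminf_of_le (by isBoundedDefault) ?_
          obtain ⟨N, hN⟩ := exists_nat_ge (g ω)
          filter_upwards [eventually_ge_atTop N] with k hk
          rw [min_eq_left (hN.trans (by exact_mod_cast hk))]
      _ ≤ liminf (fun k : ℕ => ∫⁻ ω, ENNReal.ofReal (min (g ω) k * h ω) ∂P) atTop :=
          lintegral_liminf_le' fun k => ((g.measurable.min measurable_const).mul
            h.measurable).ennreal_ofReal.aemeasurable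
      _ ≤ 1 := liminf_le_of_le (by isBoundedDefault) fun b hb => by
          obtain ⟨k, hbk⟩ := hb.exists
          exact hbk.trans (hk k)
  · have h1 : ∀ᵐ ω ∂P, ENNReal.ofReal (h ω) = ENNReal.ofReal (q ω / y) :=
      hcoe.mono fun ω h1 => by rw [h1]
    rw [lintegral_congr_ae h1,
      ← ofReal_integral_eq_lintegral_ofReal (hqi.div_const y), integral_div, hqy, div_self hy.ne',
      ENNReal.ofReal_one]
    exact Eventually.of_forall fun ω => div_nonneg (hq0 ω) hy.le
  · have hyq : ∀ᵐ ω ∂P, excess U (y * h ω) = excess U (q ω) := by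
      filter_upwards [hcoe] with ω h1
      rw [h1, mul_div_cancel₀ _ hy.ne']
    rw [lintegral_congr_ae hyq]
    set Z : ℕ → Ω → ℝ := fun n ω => truncMargInv U n (q ω) with hZ
    have hZm : ∀ n, Measurable (Z n) := fun n => (measurable_truncMargInv hU n).comp hqm
    have hn : ∀ n, ∫⁻ ω, ENNReal.ofReal (U (Z n ω) - q ω * Z n ω - U 0) ∂P ≤
        ENNReal.ofReal (s - U 0) := by
      intro n
      have hb : ∀ᵐ ω ∂P, ‖Z n ω‖ ≤ n := Eventually.of_forall fun ω => abs_truncMargInv_le n _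
      have hmem : MemLp (Z n) ∞ P := memLp_top_of_bound (hZm n).aestronglyMeasurable n hb
      obtain ⟨h1, h2⟩ := hq (hmem.toLp (Z n))
      have h3 := hm1 (hmem.toLp (Z n))
      rw [h2] at h3
      have h4 : (fun ω => q ω * hmem.toLp (Z n) ω) =ᵐ[P] fun ω => q ω * Z n ω := by
        filter_upwards [hmem.coeFn_toLp] with ω h
        rw [h]
      have h5 : (fun ω => U (hmem.toLp (Z n) ω)) =ᵐ[P] fun ω => U (Z n ω) := by
        filter_upwards [hmem.coeFn_toLp] with ω h
        rw [h]
      rw [integral_congr_ae h4, integral_congr_ae h5] at h3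
      have h6 : Integrable (fun ω => U (Z n ω)) P :=
        hU.integrable_comp_of_bound (hZm n).aestronglyMeasurable hb
      have h7 := (integrable_congr h4).1 h1
      have h9 : Integrable (fun ω => U (Z n ω) - q ω * Z n ω) P := h6.sub h7
      have h10 : Integrable (fun ω => U (Z n ω) - q ω * Z n ω - U 0) P :=
        h9.sub (integrable_const _)
      rw [← ofReal_integral_eq_lintegral_ofReal h10
        (Eventually.of_forall fun ω => truncMargInv_value hU (hq0 ω))]
      refine ENNReal.ofReal_le_ofReal ?_
      have h8 : ∫ ω, (U (Z n ω) - q ω * Z n ω - U 0) ∂P =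
          ∫ ω, U (Z n ω) ∂P - ∫ ω, q ω * Z n ω ∂P - U 0 := by
        rw [integral_sub h9 (integrable_const _), integral_sub h6 h7]
        simp
      rw [h8]
      linarith
    calc ∫⁻ ω, excess U (q ω) ∂P
        ≤ ∫⁻ ω, liminf (fun n => ENNReal.ofReal (U (Z n ω) - q ω * Z n ω - U 0)) atTop ∂P :=
          lintegral_mono fun ω => excess_le_liminf hU (hq0 ω)
      _ ≤ liminf (fun n => ∫⁻ ω, ENNReal.ofReal (U (Z n ω) - q ω * Z n ω - U 0) ∂P) atTop :=
          lintegral_liminf_le fun n => (((hU.continuous.measurable.comp (hZm n)).sub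
            (hqm.mul (hZm n))).sub_const _).ennreal_ofReal
      _ ≤ ENNReal.ofReal (s - U 0) := liminf_le_of_le (by isBoundedDefault) fun b hb => by
          obtain ⟨n, hbn⟩ := hb.exists
          exact hbn.trans (hn n)

end

end

section

variable {Ω : Type*} [MeasurableSpace Ω] {P : Measure Ω}

/-! ### Expectations of extended real random variables -/

lemma expect_eq_integral {F : Ω → EReal} {f : Ω → ℝ} (hf : Integrable f P)
    (hF : ∀ᵐ ω ∂P, F ω = (f ω : EReal)) : expect P F = ((∫ ω, f ω ∂P : ℝ) : EReal) := by
  have h1 : ∫⁻ ω, (F ω).toENNReal ∂P = ∫⁻ ω, ENNReal.ofReal (f ω) ∂P :=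
    lintegral_congr_ae (hF.mono fun ω h => by simp [h])
  have h2 : ∫⁻ ω, (-F ω).toENNReal ∂P = ∫⁻ ω, ENNReal.ofReal (-f ω) ∂P :=
    lintegral_congr_ae (hF.mono fun ω h => by
      simp only [h]; rw [← EReal.coe_neg, EReal.real_coe_toENNReal])
  rw [expect, h1, h2, integral_eq_lintegral_pos_part_sub_lintegral_neg_part hf, EReal.coe_sub,
    EReal.coe_ennreal_toReal hf.lintegral_lt_top.ne,
    EReal.coe_ennreal_toReal (show ∫⁻ ω, ENNReal.ofReal (-f ω) ∂P ≠ ⊤ from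
      hf.neg.lintegral_lt_top.ne)]

variable [IsProbabilityMeasure P]

section
variable {U : ℝ → ℝ} {y : ℝ} {h : Ω →ₘ[P] ℝ}

lemma lintegral_excess_ne_top_of_dualObjective (hd : dualObjective U y h ≠ ⊤) :
    ∫⁻ ω, excess U (y * h ω) ∂P ≠ ⊤ := by
  intro htop
  apply hd
  have h1 : ∀ q, (-legendre U q).toENNReal ≤ ENNReal.ofReal (-U 0) := by
    intro q
    rw [← EReal.real_coe_toENNReal]
    refine EReal.toENNReal_le_toENNReal ?_
    rw [EReal.coe_neg, EReal.neg_le_neg_iff]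
    simpa using le_legendre U q 0
  have h2 : ∀ q, excess U q ≤ (legendre U q).toENNReal + ENNReal.ofReal (-U 0) := by
    intro q
    rw [excess, sub_eq_add_neg, ← EReal.real_coe_toENNReal, EReal.coe_neg]
    exact EReal.toENNReal_add_le
  have h3 : ∫⁻ ω, (legendre U (y * h ω)).toENNReal ∂P = ⊤ := by
    have h4 : ∫⁻ ω, excess U (y * h ω) ∂P ≤
        ∫⁻ ω, (legendre U (y * h ω)).toENNReal ∂P + ∫⁻ _, ENNReal.ofReal (-U 0) ∂P := by
      rw [← lintegral_add_right _ measurable_const]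
      exact lintegral_mono fun ω => h2 _
    rw [htop, top_le_iff, ENNReal.add_eq_top] at h4
    rcases h4 with h4 | h4
    · exact h4
    · simp at h4
  have h5 : ∫⁻ ω, (-legendre U (y * h ω)).toENNReal ∂P ≠ ⊤ := by
    refine ((lintegral_mono fun ω => h1 (y * h ω)).trans_lt ?_).ne
    simp
  rw [dualObjective, expect, h3]
  rw [← EReal.coe_ennreal_toReal h5, EReal.coe_ennreal_top, EReal.top_sub_coe]

section
variable (hfin : ∫⁻ ω, excess U (y * h ω) ∂P ≠ ⊤)
include hfin

omit [IsProbabilityMeasure P] in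
lemma ae_legendre_ne_top : ∀ᵐ ω ∂P, legendre U (y * h ω) ≠ ⊤ := by
  have hm : Measurable fun ω => excess U (y * h ω) :=
    (measurable_excess U).comp (h.measurable.const_mul y)
  filter_upwards [ae_lt_top hm hfin] with ω hω
  exact excess_ne_top.1 hω.ne

omit [IsProbabilityMeasure P] in
lemma lintegral_excess_eq : ∫⁻ ω, excess U (y * h ω) ∂P =
    ∫⁻ ω, ENNReal.ofReal (conj U (y * h ω) - U 0) ∂P :=
  lintegral_congr_ae ((ae_legendre_ne_top hfin).mono fun _ hω => excess_eq hω)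

omit [IsProbabilityMeasure P] in
lemma ae_zero_le_conj_sub : ∀ᵐ ω ∂P, 0 ≤ conj U (y * h ω) - U 0 :=
  (ae_legendre_ne_top hfin).mono fun _ hω => zero_le_conj_sub hω

lemma integrable_conj : Integrable (fun ω => conj U (y * h ω)) P := by
  have hm : Measurable fun ω => conj U (y * h ω) :=
    (measurable_conj U).comp (h.measurable.const_mul y)
  have h1 : Integrable (fun ω => conj U (y * h ω) - U 0) P := by
    refine ⟨(hm.sub_const _).aestronglyMeasurable, ?_⟩
    rw [hasFiniteIntegral_iff_ofReal (ae_zero_le_conj_sub hfin), ← lintegral_excess_eq hfin]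
    exact hfin.lt_top
  refine (h1.add (integrable_const (U 0))).congr (Eventually.of_forall fun ω => ?_)
  simp

lemma le_integral_conj : U 0 ≤ ∫ ω, conj U (y * h ω) ∂P := by
  have h1 := integral_mono_ae (integrable_const (U 0)) (integrable_conj hfin)
    ((ae_zero_le_conj_sub hfin).mono fun ω hω => by simpa using hω)
  simpa using h1

lemma lintegral_excess_eq_ofReal : ∫⁻ ω, excess U (y * h ω) ∂P =
    ENNReal.ofReal (∫ ω, conj U (y * h ω) ∂P - U 0) := by
  have h1 : Integrable (fun ω => conj U (y * h ω) - U 0) P :=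
    (integrable_conj hfin).sub (integrable_const _)
  rw [lintegral_excess_eq hfin, ← ofReal_integral_eq_lintegral_ofReal h1
    (ae_zero_le_conj_sub hfin), integral_sub (integrable_conj hfin) (integrable_const _)]
  simp

lemma dualObjective_eq : dualObjective U y h = ((∫ ω, conj U (y * h ω) ∂P : ℝ) : EReal) :=
  expect_eq_integral (integrable_conj hfin)
    ((ae_legendre_ne_top hfin).mono fun _ hω => (coe_conj hω).symm)

lemma lintegral_excess_scale (hU : IsUtility U) (hAE : HasReasonableAE U) (hy : 0 < y)
    (hh : ∀ᵐ ω ∂P, 0 ≤ h ω) {z : ℝ} (hz : 0 < z) : ∫⁻ ω, excess U (z * h ω) ∂P ≠ ⊤ := by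
  obtain ⟨K, hK, hKq⟩ := hU.exists_excess_scale hAE (div_pos hz hy)
  have hm : Measurable fun ω => excess U (y * h ω) :=
    (measurable_excess U).comp (h.measurable.const_mul y)
  have h1 : ∫⁻ ω, excess U (z * h ω) ∂P ≤ ∫⁻ ω, (K * excess U (y * h ω) + K) ∂P := by
    refine lintegral_mono_ae ?_
    filter_upwards [hh] with ω hω
    have := hKq (y * h ω) (mul_nonneg hy.le hω)
    rwa [← mul_assoc, div_mul_cancel₀ _ hy.ne'] at this
  refine (h1.trans_lt ?_).ne
  rw [lintegral_add_right _ measurable_const, lintegral_const_mul _ hm]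
  simp only [lintegral_const, measure_univ, mul_one]
  exact ENNReal.add_lt_top.2 ⟨ENNReal.mul_lt_top hK.lt_top hfin.lt_top, hK.lt_top⟩

end

/-! ### Weak duality -/

/-- The Fenchel gap of a claim `f` and a multiple `y h` of a density. -/
def gap (U : ℝ → ℝ) (y : ℝ) (h f : Ω →ₘ[P] ℝ) (ω : Ω) : ℝ :=
  conj U (y * h ω) + y * h ω * f ω - U (f ω)

omit [IsProbabilityMeasure P] in
lemma gap_nonneg (hfin : ∫⁻ ω, excess U (y * h ω) ∂P ≠ ⊤) (f : Ω →ₘ[P] ℝ) :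
    ∀ᵐ ω ∂P, 0 ≤ gap U y h f ω := by
  filter_upwards [ae_legendre_ne_top hfin] with ω hω
  have := le_conj hω (f ω)
  rw [gap]
  linarith

variable {C : Set (Ω →ₘ[P] ℝ)} {x : ℝ} {f : Ω →ₘ[P] ℝ}

lemma integrable_gap (hC : IsAdmissibleSet C) (hh : h ∈ acDensities C)
    (hfin : ∫⁻ ω, excess U (y * h ω) ∂P ≠ ⊤) (hf : f ∈ boundedClaims C x)
    (hUf : Integrable (fun ω => U (f ω)) P) :
    Integrable (gap U y h f) P ∧ ∫ ω, gap U y h f ω ∂P =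
      ∫ ω, conj U (y * h ω) ∂P + y * ∫ ω, h ω * f ω ∂P - ∫ ω, U (f ω) ∂P := by
  have h1 := integrable_conj hfin
  have h2 : Integrable (fun ω => y * h ω * f ω) P := by
    simpa only [mul_assoc] using (integral_mul_le hC hh hf).1.const_mul y
  have h3 : Integrable (fun ω => conj U (y * h ω) + y * h ω * f ω) P := h1.add h2
  refine ⟨h3.sub hUf, ?_⟩
  simp only [gap]
  rw [integral_sub h3 hUf, integral_add h1 h2]
  simp only [mul_assoc, integral_const_mul]

lemma integral_gap_le (hC : IsAdmissibleSet C) (hh : h ∈ acDensities C) (hy : 0 < y)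
    (hfin : ∫⁻ ω, excess U (y * h ω) ∂P ≠ ⊤) (hf : f ∈ boundedClaims C x)
    (hUf : Integrable (fun ω => U (f ω)) P) :
    ∫ ω, gap U y h f ω ∂P ≤ ∫ ω, conj U (y * h ω) ∂P + x * y - ∫ ω, U (f ω) ∂P := by
  rw [(integrable_gap hC hh hfin hf hUf).2]
  have := mul_le_mul_of_nonneg_left (integral_mul_le hC hh hf).2 hy.le
  linarith

lemma integral_utility_le (hC : IsAdmissibleSet C) (hh : h ∈ acDensities C) (hy : 0 < y)
    (hfin : ∫⁻ ω, excess U (y * h ω) ∂P ≠ ⊤) (hf : f ∈ boundedClaims C x)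
    (hUf : Integrable (fun ω => U (f ω)) P) :
    ∫ ω, U (f ω) ∂P ≤ ∫ ω, conj U (y * h ω) ∂P + x * y := by
  have h1 := integral_gap_le hC hh hy hfin hf hUf
  have h2 := integral_nonneg_of_ae (gap_nonneg hfin f)
  linarith

end

lemma IsUtility.measurable_utilityExt {U : ℝ → ℝ} (hU : IsUtility U) : Measurable (utilityExt U) := by
  refine Monotone.measurable fun a b hab => ?_
  induction a with
  | bot => simp [utilityExt]
  | top => rw [top_le_iff.1 hab]
  | coe x =>
    induction b with
    | bot => simp at hab
    | top => rw [utilityExt_top, utilityExt_coe]; exact le_utilityTop U x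
    | coe y =>
      rw [utilityExt_coe, utilityExt_coe, EReal.coe_le_coe_iff]
      exact hU.strictMono.monotone (by exact_mod_cast hab)

lemma abs_coe_sub_coe (a b : ℝ) : ((a : EReal) - (b : EReal)).abs = ENNReal.ofReal |a - b| := by
  rw [← EReal.coe_sub, EReal.abs_def]

omit [IsProbabilityMeasure P] in
/-- The utility of a claim in `C_U(x)` is integrable, and is a limit in `L¹` of utilities of
claims in `C_b(x)`. -/
lemma utilityClaims_integrable {U : ℝ → ℝ} (hU : IsUtility U) {C : Set (Ω →ₘ[P] ℝ)} {x : ℝ}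
    {g : Ω →ₘ[P] EReal} (hg : g ∈ utilityClaims C U x) :
    ∃ (G : Ω → ℝ) (f : ℕ → (Ω →ₘ[P] ℝ)), Integrable G P ∧
      (∀ᵐ ω ∂P, utilityExt U (g ω) = (G ω : EReal)) ∧ (∀ n, f n ∈ boundedClaims C x) ∧
      (∀ n, Integrable (fun ω => U (f n ω)) P) ∧
      Tendsto (fun n => ∫⁻ ω, ENNReal.ofReal |U (f n ω) - G ω| ∂P) atTop (𝓝 0) ∧
      Tendsto (fun n => ∫ ω, U (f n ω) ∂P) atTop (𝓝 (∫ ω, G ω ∂P)) := by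
  obtain ⟨hgb, f, hf, hfi, hlim⟩ := hg
  have hgm : Measurable fun ω => utilityExt U (g ω) := hU.measurable_utilityExt.comp g.measurable
  have hUm : ∀ n, Measurable fun ω => U (f n ω) := fun n =>
    hU.continuous.measurable.comp (f n).measurable
  obtain ⟨N, hN⟩ := (hlim.eventually (gt_mem_nhds zero_lt_one)).exists
  have habs : Measurable fun ω => (((U (f N ω) : ℝ) : EReal) - utilityExt U (g ω)).abs := by
    have : Measurable fun a : EReal => a.abs := by
      have h1 : (fun a : EReal => a.abs) = fun a => max a.toENNReal (-a).toENNReal := by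
        funext a
        induction a with
        | bot => simp
        | top => simp
        | coe a =>
          rw [EReal.abs_def, ← EReal.coe_neg, EReal.real_coe_toENNReal, EReal.real_coe_toENNReal,
            abs_eq_max_neg]
          exact ENNReal.ofReal_max a (-a)
      rw [h1]
      exact measurable_ereal_toENNReal.max (measurable_ereal_toENNReal.comp measurable_neg)
    exact this.comp ((hUm N).coe_real_ereal.sub hgm)
  have hfinite : ∀ᵐ ω ∂P, utilityExt U (g ω) = ((utilityExt U (g ω)).toReal : EReal) := by
    filter_upwards [ae_lt_top habs (hN.trans ENNReal.one_lt_top).ne] with ω hω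
    generalize utilityExt U (g ω) = a at hω
    induction a with
    | bot => simp at hω
    | top => simp at hω
    | coe a => simp
  set G : Ω → ℝ := fun ω => (utilityExt U (g ω)).toReal with hG
  have hGm : Measurable G := hgm.ereal_toReal
  have heq : ∀ n, ∫⁻ ω, (((U (f n ω) : ℝ) : EReal) - utilityExt U (g ω)).abs ∂P =
      ∫⁻ ω, ENNReal.ofReal |U (f n ω) - G ω| ∂P := fun n => by
    refine lintegral_congr_ae (hfinite.mono fun ω hω => ?_)
    simp only
    rw [hω, abs_coe_sub_coe]
  simp only [heq] at hlim hN
  have hGi : Integrable G P := by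
    have h1 : Integrable (fun ω => U (f N ω) - G ω) P := by
      refine ⟨((hUm N).sub hGm).aestronglyMeasurable, ?_⟩
      rw [hasFiniteIntegral_iff_norm]
      exact hN.trans ENNReal.one_lt_top
    refine ((hfi N).sub h1).congr (Eventually.of_forall fun ω => ?_)
    simp
  refine ⟨G, f, hGi, hfinite, hf, hfi, hlim, ?_⟩
  refine tendsto_integral_of_L1 G hGi.aestronglyMeasurable (Eventually.of_forall hfi) ?_
  refine hlim.congr fun n => lintegral_congr fun ω => ?_
  rw [← Real.norm_eq_abs, ofReal_norm]

omit [IsProbabilityMeasure P] in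
lemma expectedUtility_eq {U : ℝ → ℝ} {g : Ω →ₘ[P] EReal} {G : Ω → ℝ} (hG : Integrable G P)
    (h : ∀ᵐ ω ∂P, utilityExt U (g ω) = (G ω : EReal)) :
    expectedUtility U g = ((∫ ω, G ω ∂P : ℝ) : EReal) :=
  expect_eq_integral hG h

lemma primalValue_le {U : ℝ → ℝ} (hU : IsUtility U) {C : Set (Ω →ₘ[P] ℝ)}
    (hC : IsAdmissibleSet C) {y : ℝ} {h : Ω →ₘ[P] ℝ} (hh : h ∈ acDensities C) (hy : 0 < y)
    (hfin : ∫⁻ ω, excess U (y * h ω) ∂P ≠ ⊤) (x : ℝ) :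
    primalValue C U x ≤ ((∫ ω, conj U (y * h ω) ∂P + x * y : ℝ) : EReal) := by
  refine iSup₂_le fun g hg => ?_
  obtain ⟨G, f, hGi, hGe, hf, hfi, -, hlim⟩ := utilityClaims_integrable hU hg
  rw [expectedUtility_eq hGi hGe, EReal.coe_le_coe_iff]
  exact le_of_tendsto' hlim fun n => integral_utility_le hC hh hy hfin (hf n) (hfi n)

omit [IsProbabilityMeasure P] in
lemma integral_le_primalValue {U : ℝ → ℝ} {C : Set (Ω →ₘ[P] ℝ)} {x : ℝ}
    {f : Ω →ₘ[P] ℝ} (hf : f ∈ boundedClaims C x) (hfi : Integrable (fun ω => U (f ω)) P) :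
    ((∫ ω, U (f ω) ∂P : ℝ) : EReal) ≤ primalValue C U x := by
  set g : Ω →ₘ[P] EReal := AEEqFun.comp Real.toEReal continuous_coe_real_ereal f with hg
  have hgc : ∀ᵐ ω ∂P, g ω = (f ω : EReal) := AEEqFun.coeFn_comp _ _ _
  have hUg : ∀ᵐ ω ∂P, utilityExt U (g ω) = ((U (f ω) : ℝ) : EReal) :=
    hgc.mono fun ω h => by rw [h, utilityExt_coe]
  have hmem : g ∈ utilityClaims C U x := by
    refine ⟨hgc.mono fun ω h => by rw [h]; simp, fun _ => f, fun _ => hf, fun _ => hfi, ?_⟩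
    refine tendsto_const_nhds.congr fun n => ?_
    have : ∫⁻ ω, (((U (f ω) : ℝ) : EReal) - utilityExt U (g ω)).abs ∂P = ∫⁻ _, 0 ∂P :=
      lintegral_congr_ae (hUg.mono fun ω h => by simp only [h, abs_coe_sub_coe]; simp)
    rw [this, lintegral_zero]
  rw [← expectedUtility_eq hfi hUg]
  exact le_iSup₂ (f := fun g (_ : g ∈ utilityClaims C U x) => expectedUtility U g) g hmem

end

section

variable {Ω : Type*} [MeasurableSpace Ω] {P : Measure Ω} [IsProbabilityMeasure P]

/-! ### The value function over bounded claims -/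

/-- `y` is a supergradient of `f` at `x`. -/
def IsSupergradient (f : ℝ → ℝ) (x y : ℝ) : Prop := ∀ z, f z ≤ f x + y * (z - x)

lemma exists_supergradient {f : ℝ → ℝ} (hf : ConcaveOn ℝ univ f) (x : ℝ) :
    ∃ y, IsSupergradient f x y := by
  have hx : x ∈ interior (univ : Set ℝ) := by simp
  have hg : ConvexOn ℝ univ (-f) := hf.neg
  refine ⟨-derivWithin (-f) (Ioi x) x, fun z => ?_⟩
  rcases lt_trichotomy z x with h | rfl | h
  · have h1 := (hg.slope_le_leftDeriv_of_mem_interior (mem_univ z) hx h).trans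
      (hg.leftDeriv_le_rightDeriv_of_mem_interior hx)
    rw [slope_def_field, div_le_iff₀ (by linarith)] at h1
    simp only [Pi.neg_apply] at h1
    linarith
  · simp
  · have h1 := hg.rightDeriv_le_slope_of_mem_interior hx (mem_univ z) h
    rw [slope_def_field, le_div_iff₀ (by linarith)] at h1
    simp only [Pi.neg_apply] at h1
    linarith

/-- Expected utilities of the bounded elements of `C_b(x)`. -/
def boundedValues (C : Set (Ω →ₘ[P] ℝ)) (U : ℝ → ℝ) (x : ℝ) : Set ℝ :=
  {t | ∃ f ∈ boundedClaims C x, (∃ M : ℝ, ∀ᵐ ω ∂P, |f ω| ≤ M) ∧ ∫ ω, U (f ω) ∂P = t}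

/-- The value function over the bounded elements of `C_b(x)`. -/
def boundedValue (C : Set (Ω →ₘ[P] ℝ)) (U : ℝ → ℝ) (x : ℝ) : ℝ := sSup (boundedValues C U x)

section
variable {C : Set (Ω →ₘ[P] ℝ)} (hC : IsAdmissibleSet C) {U : ℝ → ℝ} (hU : IsUtility U)
include hC

lemma utility_mem_boundedValues (x : ℝ) : U x ∈ boundedValues C U x := by
  refine ⟨x • 1, const_mem_boundedClaims hC x, ⟨|x|, ?_⟩, ?_⟩
  · exact (coeFn_const_smul_one x).mono fun ω h => by rw [h]
  · have : ∫ ω, U ((x • (1 : Ω →ₘ[P] ℝ)) ω) ∂P = ∫ _, U x ∂P :=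
      integral_congr_ae ((coeFn_const_smul_one x).mono fun ω h => by simp only [h])
    rw [this]
    simp

include hU

lemma exists_boundedValues_combo {x y a b s t : ℝ} (ha : 0 < a) (hb : 0 < b) (hab : a + b = 1)
    (hs : s ∈ boundedValues C U x) (ht : t ∈ boundedValues C U y) :
    ∃ r ∈ boundedValues C U (a * x + b * y), a * s + b * t ≤ r := by
  obtain ⟨f, hf, ⟨M, hM⟩, rfl⟩ := hs
  obtain ⟨g, hg, ⟨N, hN⟩, rfl⟩ := ht
  have hcoe : ∀ᵐ ω ∂P, (a • f + b • g) ω = a * f ω + b * g ω := by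
    filter_upwards [AEEqFun.coeFn_add (a • f) (b • g), AEEqFun.coeFn_smul a f,
      AEEqFun.coeFn_smul b g] with ω h1 h2 h3
    rw [h1, Pi.add_apply, h2, h3]; rfl
  have hbd : ∀ᵐ ω ∂P, |(a • f + b • g) ω| ≤ a * M + b * N := by
    filter_upwards [hcoe, hM, hN] with ω h1 h2 h3
    rw [h1]
    refine (abs_add_le _ _).trans ?_
    rw [abs_mul, abs_mul, abs_of_pos ha, abs_of_pos hb]
    gcongr
  refine ⟨_, ⟨_, combo_mem_boundedClaims hC ha hb hf hg, ⟨_, hbd⟩, rfl⟩, ?_⟩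
  have h1 := hU.integrable_comp_of_bound f.aestronglyMeasurable hM
  have h2 := hU.integrable_comp_of_bound g.aestronglyMeasurable hN
  rw [← integral_const_mul, ← integral_const_mul, ← integral_add (h1.const_mul a) (h2.const_mul b)]
  refine integral_mono_ae ((h1.const_mul a).add (h2.const_mul b))
    (hU.integrable_comp_of_bound (AEEqFun.aestronglyMeasurable _) hbd) ?_
  filter_upwards [hcoe] with ω h3
  rw [h3]
  exact hU.strictConcave.concaveOn.2 (mem_univ _) (mem_univ _) ha.le hb.le hab

lemma exists_boundedValues_mono {x y s : ℝ} (hxy : x ≤ y) (hs : s ∈ boundedValues C U x) :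
    ∃ r ∈ boundedValues C U y, s ≤ r := by
  obtain ⟨f, hf, ⟨M, hM⟩, rfl⟩ := hs
  have hcoe : ∀ᵐ ω ∂P, (f + (y - x) • (1 : Ω →ₘ[P] ℝ)) ω = f ω + (y - x) := by
    filter_upwards [AEEqFun.coeFn_add f ((y - x) • (1 : Ω →ₘ[P] ℝ)),
      coeFn_const_smul_one (P := P) (y - x)] with ω h1 h2
    rw [h1, Pi.add_apply, h2]
  have hbd : ∀ᵐ ω ∂P, |(f + (y - x) • (1 : Ω →ₘ[P] ℝ)) ω| ≤ M + |y - x| := by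
    filter_upwards [hcoe, hM] with ω h1 h2
    rw [h1]
    exact (abs_add_le _ _).trans (by gcongr)
  have hmem := add_mem_boundedClaims hC hf (const_mem_boundedClaims hC (y - x))
  rw [add_sub_cancel] at hmem
  refine ⟨_, ⟨_, hmem, ⟨_, hbd⟩, rfl⟩, ?_⟩
  refine integral_mono_ae (hU.integrable_comp_of_bound f.aestronglyMeasurable hM)
    (hU.integrable_comp_of_bound (AEEqFun.aestronglyMeasurable _) hbd) ?_
  filter_upwards [hcoe] with ω h3
  rw [h3]
  exact hU.strictMono.monotone (by linarith)

lemma bddAbove_boundedValues {x₀ : ℝ} (h : BddAbove (boundedValues C U x₀)) (x : ℝ) :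
    BddAbove (boundedValues C U x) := by
  obtain ⟨p, hp⟩ := h
  rcases le_or_gt x x₀ with hx | hx
  · refine ⟨p, fun s hs => ?_⟩
    obtain ⟨r, hr, hsr⟩ := exists_boundedValues_mono hC hU hx hs
    exact hsr.trans (hp hr)
  · refine ⟨2 * (p - 1 / 2 * U (2 * x₀ - x)), fun s hs => ?_⟩
    obtain ⟨r, hr, hsr⟩ := exists_boundedValues_combo hC hU (a := 1 / 2) (b := 1 / 2)
      (by norm_num) (by norm_num) (by norm_num) hs
      (utility_mem_boundedValues hC (U := U) (2 * x₀ - x))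
    rw [show 1 / 2 * x + 1 / 2 * (2 * x₀ - x) = x₀ by ring] at hr
    have := hsr.trans (hp hr)
    linarith

variable (hbdd : ∀ x, BddAbove (boundedValues C U x))
include hbdd

omit hU in
lemma utility_le_boundedValue (x : ℝ) : U x ≤ boundedValue C U x :=
  le_csSup (hbdd x) (utility_mem_boundedValues hC x)

lemma concaveOn_boundedValue : ConcaveOn ℝ univ (boundedValue C U) := by
  rw [concaveOn_iff_forall_pos]
  refine ⟨convex_univ, fun x _ y _ a b ha hb hab => ?_⟩
  simp only [smul_eq_mul]
  refine le_of_forall_pos_le_add fun ε hε => ?_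
  obtain ⟨s, hs, hxs⟩ := exists_lt_of_lt_csSup ⟨_, utility_mem_boundedValues hC (U := U) x⟩
    (show boundedValue C U x - ε < sSup (boundedValues C U x) by rw [boundedValue]; linarith)
  obtain ⟨t, ht, hyt⟩ := exists_lt_of_lt_csSup ⟨_, utility_mem_boundedValues hC (U := U) y⟩
    (show boundedValue C U y - ε < sSup (boundedValues C U y) by rw [boundedValue]; linarith)
  obtain ⟨r, hr, hst⟩ := exists_boundedValues_combo hC hU ha hb hab hs ht
  have h1 : r ≤ boundedValue C U (a * x + b * y) := le_csSup (hbdd _) hr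
  have h2 : ε = a * ε + b * ε := by rw [← add_mul, hab, one_mul]
  nlinarith

/-- A supergradient is positive as long as the value is below the supremum of the utility. -/
lemma supergradient_pos {x y : ℝ} (hx : (boundedValue C U x : EReal) < utilityTop U)
    (hy : IsSupergradient (boundedValue C U) x y) : 0 < y := by
  obtain ⟨z, hz⟩ := lt_iSup_iff.1 hx
  rw [EReal.coe_lt_coe_iff] at hz
  have h1 := utility_le_boundedValue hC hbdd z
  have h2 := utility_le_boundedValue hC hbdd x
  have h3 := hy z
  have h4 : x < z := hU.strictMono.lt_iff_lt.1 (h2.trans_lt hz)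
  by_contra! hcon
  nlinarith

omit hbdd in
/-- Strong duality. -/
lemma exists_dual_of_supergradient (hbdd : ∀ x, BddAbove (boundedValues C U x)) {x y : ℝ}
    (hy : 0 < y) (hxy : IsSupergradient (boundedValue C U) x y) :
    ∃ h ∈ acDensities C, ∫⁻ ω, excess U (y * h ω) ∂P ≠ ⊤ ∧
      boundedValue C U x = ∫ ω, conj U (y * h ω) ∂P + x * y := by
  have hs : ∀ (z : ℝ) (f : Ω →ₘ[P] ℝ), f ∈ boundedClaims C z → (∃ M : ℝ, ∀ᵐ ω ∂P, |f ω| ≤ M) →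
      ∫ ω, U (f ω) ∂P - z * y ≤ boundedValue C U x - x * y := by
    intro z f hf hM
    have h1 : ∫ ω, U (f ω) ∂P ≤ boundedValue C U z := le_csSup (hbdd z) ⟨f, hf, hM, rfl⟩
    have h2 := hxy z
    linarith
  obtain ⟨h, hh, hle⟩ := exists_acDensity hU hC hy hs
  have hfin : ∫⁻ ω, excess U (y * h ω) ∂P ≠ ⊤ := (hle.trans_lt ENNReal.ofReal_lt_top).ne
  refine ⟨h, hh, hfin, le_antisymm ?_ ?_⟩
  · refine csSup_le ⟨_, utility_mem_boundedValues hC (U := U) x⟩ ?_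
    rintro _ ⟨f, hf, ⟨M, hM⟩, rfl⟩
    exact integral_utility_le hC hh hy hfin hf
      (hU.integrable_comp_of_bound f.aestronglyMeasurable hM)
  · rw [lintegral_excess_eq_ofReal hfin] at hle
    have h1 : U 0 ≤ boundedValue C U x - x * y := by
      have h2 := utility_le_boundedValue hC hbdd 0
      have h3 := hxy 0
      linarith
    rw [ENNReal.ofReal_le_ofReal_iff (by linarith)] at hle
    linarith

omit hbdd in
lemma boundedValue_le {y : ℝ} {h : Ω →ₘ[P] ℝ} (hh : h ∈ acDensities C) (hy : 0 < y)
    (hfin : ∫⁻ ω, excess U (y * h ω) ∂P ≠ ⊤) (x : ℝ) :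
    boundedValue C U x ≤ ∫ ω, conj U (y * h ω) ∂P + x * y := by
  refine csSup_le ⟨_, utility_mem_boundedValues hC (U := U) x⟩ ?_
  rintro _ ⟨f, hf, ⟨M, hM⟩, rfl⟩
  exact integral_utility_le hC hh hy hfin hf
    (hU.integrable_comp_of_bound f.aestronglyMeasurable hM)

omit hbdd in
/-- The value function stays below the supremum of the utility function. -/
lemma boundedValue_lt_utilityTop {h : Ω →ₘ[P] ℝ} (hh : h ∈ acDensities C)
    (hfin : ∀ z, 0 < z → ∫⁻ ω, excess U (z * h ω) ∂P ≠ ⊤) (x : ℝ) :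
    (boundedValue C U x : EReal) < utilityTop U := by
  by_contra! hcon
  have hleg0 : legendre U 0 ≠ ⊤ := by
    rw [legendre_zero]
    exact (hcon.trans_lt (EReal.coe_lt_top _)).ne
  set L := conj U 0 with hL
  have hUL : ∀ t, U t ≤ L := fun t => by simpa using le_conj hleg0 t
  have hLx : L ≤ boundedValue C U x := by
    rw [← EReal.coe_le_coe_iff, hL, coe_conj hleg0, legendre_zero]; exact hcon
  have hle : ∀ z, 0 < z → L ≤ ∫ ω, conj U (z * h ω) ∂P + x * z := fun z hz =>
    hLx.trans (boundedValue_le hC hU hh hz (hfin z hz) x)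
  have hfin1 : ∫⁻ ω, excess U (1 * h ω) ∂P ≠ ⊤ := hfin 1 one_pos
  set z : ℕ → ℝ := fun n => 1 / ((n : ℝ) + 1) with hz
  have hz0 : ∀ n, 0 < z n := fun n => by positivity
  have hz1 : ∀ n, z n ≤ 1 := fun n => by
    rw [hz]; simp only; rw [div_le_one (by positivity)]; linarith [n.cast_nonneg (α := ℝ)]
  have hzlim : Tendsto z atTop (𝓝 0) := tendsto_one_div_add_atTop_nhds_zero_nat
  set φ : ℕ → Ω → ℝ := fun n ω => (L - conj U (z n * h ω)) / z n + (conj U (1 * h ω) - L) with hφ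
  have hφm : ∀ n, Measurable (φ n) := fun n =>
    ((measurable_const.sub ((measurable_conj U).comp (h.measurable.const_mul _))).div_const _).add
      (((measurable_conj U).comp (h.measurable.const_mul _)).sub_const _)
  have hφi : ∀ n, Integrable (φ n) P ∧ ∫ ω, φ n ω ∂P ≤ x + ∫ ω, conj U (1 * h ω) ∂P - L := by
    intro n
    have h1 := integrable_conj (hfin _ (hz0 n))
    have h2 := integrable_conj hfin1
    have h3 : Integrable (fun ω => (L - conj U (z n * h ω)) / z n) P :=
      ((integrable_const L).sub h1).div_const _
    have h4 : Integrable (fun ω => conj U (1 * h ω) - L) P := h2.sub (integrable_const L)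
    refine ⟨h3.add h4, ?_⟩
    simp only [hφ]
    rw [integral_add h3 h4, integral_div, integral_sub (integrable_const L) h1,
      integral_sub h2 (integrable_const L)]
    simp only [integral_const, probReal_univ, one_smul]
    have h5 : (L - ∫ ω, conj U (z n * h ω) ∂P) / z n ≤ x := by
      rw [div_le_iff₀ (hz0 n)]
      linarith [hle _ (hz0 n)]
    linarith
  have hφ0 : ∀ n, ∀ᵐ ω ∂P, 0 ≤ φ n ω := by
    intro n
    filter_upwards [ae_legendre_ne_top (hfin _ (hz0 n)), ae_legendre_ne_top hfin1] with ω h1 h2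
    have h3 : conj U (z n * h ω) ≤ (1 - z n) * L + z n * conj U (1 * h ω) := by
      rw [← EReal.coe_le_coe_iff, coe_conj h1]
      refine iSup_le fun t => ?_
      rw [EReal.coe_le_coe_iff]
      have h4 := le_conj h2 t
      have h5 := hUL t
      have h6 := hz0 n
      have h7 := hz1 n
      nlinarith
    have h8 : L - conj U (1 * h ω) ≤ (L - conj U (z n * h ω)) / z n := by
      rw [le_div_iff₀ (hz0 n)]
      linarith
    simp only [hφ]
    linarith
  have hfatou : ∫⁻ ω, liminf (fun n => ENNReal.ofReal (φ n ω)) atTop ∂P ≠ ⊤ := by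
    refine ((lintegral_liminf_le fun n => (hφm n).ennreal_ofReal).trans
      (liminf_le_of_le (by isBoundedDefault) (a := ENNReal.ofReal
        (x + ∫ ω, conj U (1 * h ω) ∂P - L)) fun b hb => ?_)).trans_lt ENNReal.ofReal_lt_top |>.ne
    obtain ⟨n, hn⟩ := hb.exists
    refine hn.trans ?_
    rw [← ofReal_integral_eq_lintegral_ofReal (hφi n).1 (hφ0 n)]
    exact ENNReal.ofReal_le_ofReal (hφi n).2
  have hzero : ∀ᵐ ω ∂P, h ω = 0 := by
    filter_upwards [ae_lt_top (Measurable.liminf fun n => (hφm n).ennreal_ofReal) hfatou,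
      acDensities_nonneg hh] with ω h1 h2
    by_contra hne
    have hpos : 0 < h ω := lt_of_le_of_ne h2 (Ne.symm hne)
    have hlim : Tendsto (fun n => φ n ω) atTop atTop := by
      rw [tendsto_atTop]
      intro b
      set M := (b - (conj U (1 * h ω) - L)) / h ω with hM
      have h3 : Tendsto (fun n => z n * h ω) atTop (𝓝 0) := by simpa using hzlim.mul_const (h ω)
      filter_upwards [h3.eventually (gt_mem_nhds (hU.deriv_pos M))] with n hn
      have hq : 0 < z n * h ω := mul_pos (hz0 n) hpos
      have h4 := (hU.lt_margInv_iff hq).2 hn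
      have h5 := hU.conj_eq hq
      have h6 := hUL (margInv U (z n * h ω))
      have h7 : M * h ω ≤ (L - conj U (z n * h ω)) / z n := by
        rw [le_div_iff₀ (hz0 n)]
        nlinarith
      rw [hM, div_mul_cancel₀ _ hpos.ne'] at h7
      simp only [hφ]
      linarith
    have h8 : Tendsto (fun n => ENNReal.ofReal (φ n ω)) atTop (𝓝 ⊤) :=
      ENNReal.tendsto_ofReal_atTop.comp hlim
    rw [h8.liminf_eq] at h1
    exact lt_irrefl _ h1
  have h1 := integral_acDensities hh
  rw [integral_congr_ae hzero] at h1
  simp at h1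

end

end

section

variable {Ω : Type*} [MeasurableSpace Ω] {P : Measure Ω}

/-! ### Optimising sequences -/

lemma ae_tendsto_zero_of_tsum {a : ℕ → Ω → ℝ≥0∞} (ha : ∀ n, AEMeasurable (a n) P)
    (hsum : ∑' n, ∫⁻ ω, a n ω ∂P ≠ ⊤) :
    (∀ᵐ ω ∂P, Tendsto (fun n => a n ω) atTop (𝓝 0)) ∧
    ∃ R : Ω → ℝ, Integrable R P ∧ ∀ᵐ ω ∂P, ∀ n, (a n ω).toReal ≤ R ω := by
  rw [← lintegral_tsum ha] at hsum
  have hm : AEMeasurable (fun ω => ∑' n, a n ω) P := AEMeasurable.tsum ha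
  have hfin := ae_lt_top' hm hsum
  refine ⟨hfin.mono fun ω hω => ENNReal.tendsto_atTop_zero_of_tsum_ne_top hω.ne,
    fun ω => (∑' n, a n ω).toReal, integrable_toReal_of_lintegral_ne_top hm hsum,
    hfin.mono fun ω hω n => ENNReal.toReal_mono hω.ne (ENNReal.le_tsum n)⟩

lemma tsum_ofReal_geometric_ne_top {b : ℕ → ℝ≥0∞} (hb : ∀ n, b n ≤ ENNReal.ofReal ((1 / 2) ^ n)) :
    ∑' n, b n ≠ ⊤ := by
  refine ((ENNReal.tsum_le_tsum hb).trans_lt ?_).ne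
  rw [← ENNReal.ofReal_tsum_of_nonneg (fun n => by positivity) summable_geometric_two]
  exact ENNReal.ofReal_lt_top

/-- The utility of the optimal claim. -/
def optUtility (U : ℝ → ℝ) (q : ℝ) : ℝ := conj U q + q * margInv U q

variable [IsProbabilityMeasure P]

section
variable {C : Set (Ω →ₘ[P] ℝ)} (hC : IsAdmissibleSet C) {U : ℝ → ℝ} (hU : IsUtility U)
  {x y w : ℝ} {h : Ω →ₘ[P] ℝ} (hh : h ∈ acDensities C) (hy : 0 < y)
  (hfin : ∀ z, 0 < z → ∫⁻ ω, excess U (z * h ω) ∂P ≠ ⊤)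
  (hw : w = ∫ ω, conj U (y * h ω) ∂P + x * y)

omit [IsProbabilityMeasure P] in
lemma measurable_gap (U : ℝ → ℝ) (y : ℝ) (h f : Ω →ₘ[P] ℝ) (hU : Continuous U) :
    Measurable (gap U y h f) :=
  (((measurable_conj U).comp (h.measurable.const_mul y)).add
    ((h.measurable.const_mul y).mul f.measurable)).sub (hU.measurable.comp f.measurable)

include hC hU hh hy hfin hw

/-- Along a fast maximising sequence the Fenchel gap tends to zero. -/
lemma gap_dominated {f : ℕ → (Ω →ₘ[P] ℝ)} (hf : ∀ n, f n ∈ boundedClaims C x)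
    (hfi : ∀ n, Integrable (fun ω => U (f n ω)) P)
    (happ : ∀ n, w - (1 / 2) ^ n ≤ ∫ ω, U (f n ω) ∂P) :
    (∀ᵐ ω ∂P, Tendsto (fun n => gap U y h (f n) ω) atTop (𝓝 0)) ∧
    ∃ R : Ω → ℝ, Integrable R P ∧ ∀ᵐ ω ∂P, ∀ n, gap U y h (f n) ω ≤ R ω := by
  have h0 : ∀ᵐ ω ∂P, ∀ n, 0 ≤ gap U y h (f n) ω :=
    ae_all_iff.2 fun n => gap_nonneg (hfin y hy) (f n)
  obtain ⟨h1, R, hR, hle⟩ := ae_tendsto_zero_of_tsum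
    (a := fun n ω => ENNReal.ofReal (gap U y h (f n) ω))
    (fun n => (measurable_gap U y h (f n) hU.continuous).ennreal_ofReal.aemeasurable)
    (P := P) (tsum_ofReal_geometric_ne_top fun n => by
      rw [← ofReal_integral_eq_lintegral_ofReal
        (integrable_gap hC hh (hfin y hy) (hf n) (hfi n)).1 (gap_nonneg (hfin y hy) (f n))]
      refine ENNReal.ofReal_le_ofReal ?_
      have h2 := integral_gap_le hC hh hy (hfin y hy) (hf n) (hfi n)
      have h3 := happ n
      linarith)
  refine ⟨?_, R, hR, ?_⟩
  · filter_upwards [h1, h0] with ω h2 h3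
    have := (ENNReal.tendsto_toReal ENNReal.zero_ne_top).comp h2
    refine this.congr fun n => ?_
    simp [ENNReal.toReal_ofReal (h3 n)]
  · filter_upwards [hle, h0] with ω h2 h3 n
    have := h2 n
    rwa [ENNReal.toReal_ofReal (h3 n)] at this

lemma tendsto_of_maximizing {f : ℕ → (Ω →ₘ[P] ℝ)} (hf : ∀ n, f n ∈ boundedClaims C x)
    (hfi : ∀ n, Integrable (fun ω => U (f n ω)) P)
    (happ : ∀ n, w - (1 / 2) ^ n ≤ ∫ ω, U (f n ω) ∂P) :
    (∀ᵐ ω ∂P, Tendsto (fun n => (f n ω : EReal)) atTop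
      (𝓝 (invMarginal U ((y * h ω : ℝ) : EReal)))) ∧
    (∀ᵐ ω ∂P, Tendsto (fun n => y * h ω * f n ω) atTop
      (𝓝 (y * h ω * margInv U (y * h ω)))) ∧
    (∀ᵐ ω ∂P, Tendsto (fun n => U (f n ω)) atTop (𝓝 (optUtility U (y * h ω)))) := by
  have hgap := (gap_dominated hC hU hh hy hfin hw hf hfi happ).1
  have h1 : ∀ᵐ ω ∂P, Tendsto (fun n => (f n ω : EReal)) atTop
      (𝓝 (invMarginal U ((y * h ω : ℝ) : EReal))) := by
    filter_upwards [hgap, ae_legendre_ne_top (hfin y hy), acDensities_nonneg hh] with ω h1 h2 h3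
    exact hU.tendsto_of_gap (mul_nonneg hy.le h3) h2 h1
  have h2 : ∀ᵐ ω ∂P, Tendsto (fun n => y * h ω * f n ω) atTop
      (𝓝 (y * h ω * margInv U (y * h ω))) := by
    filter_upwards [h1, acDensities_nonneg hh] with ω h1 h2
    rcases (mul_nonneg hy.le h2).eq_or_lt with h3 | h3
    · simp [← h3]
    · rw [hU.invMarginal_coe h3, EReal.tendsto_coe] at h1
      exact h1.const_mul _
  refine ⟨h1, h2, ?_⟩
  filter_upwards [h2, hgap] with ω h2 h3
  have h4 := (h2.const_add (conj U (y * h ω))).sub h3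
  rw [sub_zero] at h4
  refine h4.congr fun n => ?_
  rw [gap]; ring

/-- Convergence in `L¹` along fast maximising sequences. -/
lemma optUtility_of_maximizing {f : ℕ → (Ω →ₘ[P] ℝ)} (hf : ∀ n, f n ∈ boundedClaims C x)
    (hfi : ∀ n, Integrable (fun ω => U (f n ω)) P)
    (happ : ∀ n, w - (1 / 2) ^ n ≤ ∫ ω, U (f n ω) ∂P) :
    Integrable (fun ω => y * h ω * margInv U (y * h ω)) P ∧
    ∫ ω, y * h ω * margInv U (y * h ω) ∂P = x * y ∧
    Tendsto (fun n => ∫⁻ ω, ENNReal.ofReal |U (f n ω) - optUtility U (y * h ω)| ∂P) atTop (𝓝 0) := by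
  obtain ⟨hgap, R, hR, hgR⟩ := gap_dominated hC hU hh hy hfin hw hf hfi happ
  obtain ⟨-, hlim, hUlim⟩ := tendsto_of_maximizing hC hU hh hy hfin hw hf hfi happ
  have hy2 : 0 < y / 2 := by positivity
  have hy3 : 0 < 2 * y := by positivity
  have i1 := integrable_conj (hfin y hy)
  have i2 := integrable_conj (hfin _ hy2)
  have i3 := integrable_conj (hfin _ hy3)
  set H : Ω → ℝ := fun ω => 2 * |conj U (y / 2 * h ω) - conj U (y * h ω)| +
    |conj U (2 * y * h ω) - conj U (y * h ω)| + 2 * R ω with hH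
  have hHi : Integrable H P :=
    (((i2.sub i1).abs.const_mul 2).add (i3.sub i1).abs).add (hR.const_mul 2)
  have hdom : ∀ᵐ ω ∂P, ∀ n, |y * h ω * f n ω| ≤ H ω := by
    filter_upwards [hgR, ae_legendre_ne_top (hfin _ hy2), ae_legendre_ne_top (hfin _ hy3),
      ae_all_iff.2 fun n => gap_nonneg (hfin y hy) (f n)] with ω h1 h2 h3 h0 n
    have h4 := le_conj h2 (f n ω)
    have h5 := le_conj h3 (f n ω)
    have h6 := h1 n
    have h7 := h0 n
    rw [gap] at h6 h7
    have h8 := le_abs_self (conj U (y / 2 * h ω) - conj U (y * h ω))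
    have h9 := le_abs_self (conj U (2 * y * h ω) - conj U (y * h ω))
    have h10 := abs_nonneg (conj U (y / 2 * h ω) - conj U (y * h ω))
    have h11 := abs_nonneg (conj U (2 * y * h ω) - conj U (y * h ω))
    simp only [hH]
    rw [abs_le]
    constructor
    · linarith
    · linarith
  have hmI : ∀ n, AEStronglyMeasurable (fun ω => y * h ω * f n ω) P := fun n =>
    ((h.measurable.const_mul y).mul (f n).measurable).aestronglyMeasurable
  have hqi : Integrable (fun ω => y * h ω * margInv U (y * h ω)) P := by
    refine hHi.mono' (aestronglyMeasurable_of_tendsto_ae atTop hmI hlim) ?_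
    filter_upwards [hdom, hlim] with ω h1 h2
    exact le_of_tendsto h2.norm (Eventually.of_forall h1)
  have hU_le : ∀ n, ∫ ω, U (f n ω) ∂P ≤ w := fun n => by
    rw [hw]; exact integral_utility_le hC hh hy (hfin y hy) (hf n) (hfi n)
  have hUw : Tendsto (fun n => ∫ ω, U (f n ω) ∂P) atTop (𝓝 w) := by
    refine tendsto_of_tendsto_of_tendsto_of_le_of_le ?_ tendsto_const_nhds happ hU_le
    have : Tendsto (fun n : ℕ => ((1 : ℝ) / 2) ^ n) atTop (𝓝 0) :=
      tendsto_pow_atTop_nhds_zero_of_lt_one (by norm_num) (by norm_num)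
    simpa using this.const_sub w
  have hgapi : Tendsto (fun n => ∫ ω, gap U y h (f n) ω ∂P) atTop (𝓝 0) := by
    refine squeeze_zero (fun n => integral_nonneg_of_ae (gap_nonneg (hfin y hy) (f n)))
      (fun n => integral_gap_le hC hh hy (hfin y hy) (hf n) (hfi n)) ?_
    rw [← hw]
    simpa using hUw.const_sub w
  refine ⟨hqi, ?_, ?_⟩
  · have l1 : Tendsto (fun n => ∫ ω, y * h ω * f n ω ∂P) atTop
        (𝓝 (∫ ω, y * h ω * margInv U (y * h ω) ∂P)) :=
      tendsto_integral_of_dominated_convergence H hmI hHi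
        (fun n => hdom.mono fun ω h1 => h1 n) hlim
    refine tendsto_nhds_unique l1 ?_
    have l2 := (hgapi.add hUw).sub_const (∫ ω, conj U (y * h ω) ∂P)
    rw [zero_add, hw, add_sub_cancel_left] at l2
    refine l2.congr fun n => ?_
    rw [(integrable_gap hC hh (hfin y hy) (hf n) (hfi n)).2]
    simp only [mul_assoc, integral_const_mul]
    ring
  · have hoi : Integrable (fun ω => optUtility U (y * h ω)) P := i1.add hqi
    have l1 : Tendsto (fun n => ∫ ω, |U (f n ω) - optUtility U (y * h ω)| ∂P) atTop
        (𝓝 (∫ _, 0 ∂P)) := by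
      refine tendsto_integral_of_dominated_convergence
        (fun ω => H ω + |y * h ω * margInv U (y * h ω)| + |R ω|)
        (fun n => ((hfi n).sub hoi).abs.aestronglyMeasurable) ((hHi.add hqi.abs).add hR.abs)
        (fun n => ?_) ?_
      · filter_upwards [hdom, hgR, gap_nonneg (hfin y hy) (f n)] with ω h1 h2 h3
        rw [Real.norm_eq_abs, abs_abs]
        have h4 : U (f n ω) - optUtility U (y * h ω) =
            y * h ω * f n ω - y * h ω * margInv U (y * h ω) - gap U y h (f n) ω := by
          rw [gap, optUtility]; ring
        rw [h4]
        refine (abs_sub _ _).trans (add_le_add ((abs_sub _ _).trans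
          (add_le_add (h1 n) le_rfl)) ?_)
        rw [abs_of_nonneg h3]
        exact (h2 n).trans (le_abs_self _)
      · filter_upwards [hUlim] with ω h1
        have := (h1.sub_const (optUtility U (y * h ω))).abs
        simpa using this
    rw [integral_zero] at l1
    have l2 := ENNReal.tendsto_ofReal l1
    rw [ENNReal.ofReal_zero] at l2
    refine l2.congr fun n => ?_
    exact ofReal_integral_eq_lintegral_ofReal ((hfi n).sub hoi).abs
      (Eventually.of_forall fun ω => abs_nonneg _)

end

lemma exists_maximizing {C : Set (Ω →ₘ[P] ℝ)} (hC : IsAdmissibleSet C) {U : ℝ → ℝ}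
    (hU : IsUtility U) (x : ℝ) : ∃ f : ℕ → (Ω →ₘ[P] ℝ), (∀ n, f n ∈ boundedClaims C x) ∧
      (∀ n, Integrable (fun ω => U (f n ω)) P) ∧
      ∀ n, boundedValue C U x - (1 / 2) ^ n ≤ ∫ ω, U (f n ω) ∂P := by
  have : ∀ n : ℕ, ∃ f : Ω →ₘ[P] ℝ, f ∈ boundedClaims C x ∧ Integrable (fun ω => U (f ω)) P ∧
      boundedValue C U x - (1 / 2) ^ n ≤ ∫ ω, U (f ω) ∂P := by
    intro n
    have hpos : (0 : ℝ) < (1 / 2) ^ n := by positivity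
    obtain ⟨_, ⟨f, hf, ⟨M, hM⟩, rfl⟩, hlt⟩ :=
      exists_lt_of_lt_csSup ⟨_, utility_mem_boundedValues hC (U := U) x⟩
      (show boundedValue C U x - (1 / 2) ^ n < sSup (boundedValues C U x) by
        rw [boundedValue]; linarith)
    exact ⟨f, hf, hU.integrable_comp_of_bound f.aestronglyMeasurable hM, hlt.le⟩
  choose f h1 h2 h3 using this
  exact ⟨f, h1, h2, h3⟩

end

section

/-- A function whose supergradient relation is a bijection from `ℝ` onto `(0, ∞)` is a utility
function. -/
lemma isUtility_of_supergradient {u : ℝ → ℝ} (hex : ∀ x, ∃ y, IsSupergradient u x y)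
    (hpos : ∀ x y, IsSupergradient u x y → 0 < y)
    (hleft : ∀ x y z, IsSupergradient u x y → IsSupergradient u z y → x = z)
    (hsurj : ∀ y, 0 < y → ∃ x, IsSupergradient u x y)
    (hright : ∀ x y z, IsSupergradient u x y → IsSupergradient u x z → y = z) : IsUtility u := by
  choose d hd using hex
  have hanti : StrictAnti d := by
    intro a b hab
    have h1 := hd a b
    have h2 := hd b a
    have h3 : d b ≤ d a := by nlinarith
    refine h3.lt_of_ne fun h => hab.ne ?_
    exact hleft a (d a) b (hd a) (h ▸ hd b)
  have hrange : ∀ y, 0 < y → ∃ x, d x = y := fun y hy => by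
    obtain ⟨x, hx⟩ := hsurj y hy
    exact ⟨x, hright x _ _ (hd x) hx⟩
  have hcont : Continuous d := by
    rw [continuous_iff_continuousAt]
    intro x
    rw [ContinuousAt, tendsto_order]
    constructor
    · intro b hb
      obtain ⟨b', hb', hb'x⟩ := exists_between (max_lt hb (hpos x _ (hd x)))
      obtain ⟨x', rfl⟩ := hrange b' ((le_max_right _ _).trans_lt hb')
      filter_upwards [gt_mem_nhds (hanti.lt_iff_gt.1 hb'x)] with z hz
      exact ((le_max_left _ _).trans_lt hb').trans (hanti hz)
    · intro b hb
      obtain ⟨x', rfl⟩ := hrange b ((hpos x _ (hd x)).trans hb)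
      filter_upwards [lt_mem_nhds (hanti.lt_iff_gt.1 hb)] with z hz
      exact hanti hz
  have hderiv : ∀ x, HasDerivAt u (d x) x := by
    intro x
    have : HasDerivAt (fun z => -u z) (-d x) x := by
      refine hasDerivAt_of_subgradient (g := fun z => -d z) univ_mem ?_ ?_
        hcont.continuousAt.neg
      · intro z _
        have := hd x z
        linarith
      · intro z _
        have := hd z x
        linarith
    simpa using this.fun_neg
  have hdu : deriv u = d := funext fun x => (hderiv x).deriv
  have hdiff : Differentiable ℝ u := fun x => (hderiv x).differentiableAt
  refine ⟨?_, ?_, ?_, ?_, ?_⟩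
  · refine strictMono_of_deriv_pos fun x => ?_
    rw [hdu]; exact hpos x _ (hd x)
  · exact StrictAnti.strictConcaveOn_univ_of_deriv hdiff.continuous (by rw [hdu]; exact hanti)
  · exact contDiff_one_iff_deriv.2 ⟨hdiff, by rw [hdu]; exact hcont⟩
  · rw [hdu, tendsto_atTop]
    intro b
    obtain ⟨x, hx⟩ := hrange (max b 1) (zero_lt_one.trans_le (le_max_right _ _))
    filter_upwards [eventually_le_atBot x] with z hz
    exact (le_max_left b 1).trans (hx ▸ hanti.antitone hz)
  · rw [hdu, tendsto_order]
    constructor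
    · intro b hb
      exact Eventually.of_forall fun x => hb.trans (hpos x _ (hd x))
    · intro b hb
      obtain ⟨x, rfl⟩ := hrange b hb
      filter_upwards [eventually_gt_atTop x] with z hz
      exact hanti hz

variable {Ω : Type*} [MeasurableSpace Ω] {P : Measure Ω} [IsProbabilityMeasure P]

section
variable {C : Set (Ω →ₘ[P] ℝ)} (hC : IsAdmissibleSet C) {U : ℝ → ℝ} (hU : IsUtility U)
include hC hU

/-- A point at which the value function and a multiple of a density determine each other. -/
lemma density_unique {x y₁ y₂ : ℝ} {h₁ h₂ : Ω →ₘ[P] ℝ} (hh₁ : h₁ ∈ acDensities C)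
    (hh₂ : h₂ ∈ acDensities C) (hy₁ : 0 < y₁) (hy₂ : 0 < y₂)
    (hf₁ : ∀ z, 0 < z → ∫⁻ ω, excess U (z * h₁ ω) ∂P ≠ ⊤)
    (hf₂ : ∀ z, 0 < z → ∫⁻ ω, excess U (z * h₂ ω) ∂P ≠ ⊤)
    (hw₁ : boundedValue C U x = ∫ ω, conj U (y₁ * h₁ ω) ∂P + x * y₁)
    (hw₂ : boundedValue C U x = ∫ ω, conj U (y₂ * h₂ ω) ∂P + x * y₂) : y₁ = y₂ ∧ h₁ = h₂ := by
  obtain ⟨f, hf, hfi, happ⟩ := exists_maximizing hC hU x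
  have h1 := (tendsto_of_maximizing hC hU hh₁ hy₁ hf₁ hw₁ hf hfi happ).1
  have h2 := (tendsto_of_maximizing hC hU hh₂ hy₂ hf₂ hw₂ hf hfi happ).1
  have heq : ∀ᵐ ω ∂P, y₁ * h₁ ω = y₂ * h₂ ω := by
    filter_upwards [h1, h2, acDensities_nonneg hh₁, acDensities_nonneg hh₂] with ω a1 a2 a3 a4
    exact hU.invMarginal_inj (mul_nonneg hy₁.le a3) (mul_nonneg hy₂.le a4)
      (tendsto_nhds_unique a1 a2)
  have hy : y₁ = y₂ := by
    have := integral_congr_ae heq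
    rwa [integral_const_mul, integral_const_mul, integral_acDensities hh₁,
      integral_acDensities hh₂, mul_one, mul_one] at this
  refine ⟨hy, AEEqFun.ext (heq.mono fun ω hω => ?_)⟩
  rw [hy] at hω
  exact mul_left_cancel₀ hy₂.ne' hω

/-- The consequences of the standing assumptions. -/
lemma exists_finite_dual (hAE : HasReasonableAE U)
    (hfin : ∃ x : ℝ, primalValue C U x < utilityTop U) :
    (∀ x, BddAbove (boundedValues C U x)) ∧
    ∃ h ∈ acDensities C, ∀ z, 0 < z → ∫⁻ ω, excess U (z * h ω) ∂P ≠ ⊤ := by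
  obtain ⟨x₀, hx₀⟩ := hfin
  have hle : ∀ t ∈ boundedValues C U x₀, (t : EReal) ≤ primalValue C U x₀ := by
    rintro _ ⟨f, hf, ⟨M, hM⟩, rfl⟩
    exact integral_le_primalValue hf (hU.integrable_comp_of_bound f.aestronglyMeasurable hM)
  have hbot : primalValue C U x₀ ≠ ⊥ :=
    ((EReal.bot_lt_coe _).trans_le (hle _ (utility_mem_boundedValues hC x₀))).ne'
  have hcoe : ((primalValue C U x₀).toReal : EReal) = primalValue C U x₀ :=
    EReal.coe_toReal (hx₀.trans_le le_top).ne hbot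
  have hbdd := bddAbove_boundedValues hC hU (x₀ := x₀) ⟨(primalValue C U x₀).toReal, fun t ht => by
    rw [← EReal.coe_le_coe_iff, hcoe]; exact hle t ht⟩
  have hlt : (boundedValue C U x₀ : EReal) < utilityTop U := by
    refine lt_of_le_of_lt ?_ hx₀
    rw [← hcoe, EReal.coe_le_coe_iff]
    refine csSup_le ⟨_, utility_mem_boundedValues hC x₀⟩ fun t ht => ?_
    rw [← EReal.coe_le_coe_iff, hcoe]
    exact hle t ht
  obtain ⟨y, hy⟩ := exists_supergradient (concaveOn_boundedValue hC hU hbdd) x₀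
  have hy0 := supergradient_pos hC hU hbdd hlt hy
  obtain ⟨h, hh, hf, -⟩ := exists_dual_of_supergradient hC hU hbdd hy0 hy
  exact ⟨hbdd, h, hh, fun z hz =>
    lintegral_excess_scale hf hU hAE hy0 (acDensities_nonneg hh) hz⟩

lemma exists_supergradient_point (hbdd : ∀ x, BddAbove (boundedValues C U x)) {h : Ω →ₘ[P] ℝ}
    (hh : h ∈ acDensities C) (hfin : ∀ z, 0 < z → ∫⁻ ω, excess U (z * h ω) ∂P ≠ ⊤) {y : ℝ}
    (hy : 0 < y) : ∃ x, IsSupergradient (boundedValue C U) x y := by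
  have hconc := concaveOn_boundedValue hC hU hbdd
  have hcont : Continuous (boundedValue C U) :=
    continuousOn_univ.1 (hconc.continuousOn isOpen_univ)
  set g : ℝ → ℝ := fun x => boundedValue C U x - x * y with hg
  have hgc : Continuous g := by fun_prop
  have hlim : Tendsto g (cocompact ℝ) atBot := by
    rw [cocompact_eq_atBot_atTop, tendsto_sup]
    constructor
    · have h1 : Tendsto (fun x : ℝ => ∫ ω, conj U (2 * y * h ω) ∂P + y * x) atBot atBot :=
        tendsto_atBot_add_const_left _ _ (tendsto_id.const_mul_atBot hy)
      refine tendsto_atBot_mono (fun x => ?_) h1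
      have := boundedValue_le hC hU hh (by positivity) (hfin (2 * y) (by positivity)) x
      simp only [hg]
      linarith
    · have h1 : Tendsto (fun x : ℝ => ∫ ω, conj U (y / 2 * h ω) ∂P + -(y / 2) * x) atTop atBot :=
        tendsto_atBot_add_const_left _ _ (tendsto_id.const_mul_atTop_of_neg (by linarith))
      refine tendsto_atBot_mono (fun x => ?_) h1
      have := boundedValue_le hC hU hh (by positivity) (hfin (y / 2) (by positivity)) x
      simp only [hg]
      linarith
  obtain ⟨x, hx⟩ := hgc.exists_forall_ge hlim
  refine ⟨x, fun z => ?_⟩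
  have := hx z
  simp only [hg] at this
  linarith

/-- The value function is a utility function. -/
lemma isUtility_boundedValue (hAE : HasReasonableAE U)
    (hfin : ∃ x : ℝ, primalValue C U x < utilityTop U) : IsUtility (boundedValue C U) := by
  obtain ⟨hbdd, h₀, hh₀, hf₀⟩ := exists_finite_dual hC hU hAE hfin
  have hpos : ∀ x y, IsSupergradient (boundedValue C U) x y → 0 < y := fun x y hxy =>
    supergradient_pos hC hU hbdd (boundedValue_lt_utilityTop hC hU hh₀ hf₀ x) hxy
  have hdual : ∀ x y, IsSupergradient (boundedValue C U) x y → ∃ h ∈ acDensities C,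
      (∀ z, 0 < z → ∫⁻ ω, excess U (z * h ω) ∂P ≠ ⊤) ∧
      boundedValue C U x = ∫ ω, conj U (y * h ω) ∂P + x * y := by
    intro x y hxy
    obtain ⟨h, hh, hf, hw⟩ := exists_dual_of_supergradient hC hU hbdd (hpos x y hxy) hxy
    exact ⟨h, hh, fun z hz =>
      lintegral_excess_scale hf hU hAE (hpos x y hxy) (acDensities_nonneg hh) hz, hw⟩
  refine isUtility_of_supergradient
    (fun x => exists_supergradient (concaveOn_boundedValue hC hU hbdd) x) hpos ?_
    (fun y hy => exists_supergradient_point hC hU hbdd hh₀ hf₀ hy) ?_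
  · intro x y z hxy hzy
    obtain ⟨h, hh, hf, hw⟩ := hdual x y hxy
    have hy := hpos x y hxy
    have hw' : boundedValue C U z = ∫ ω, conj U (y * h ω) ∂P + z * y := by
      have h1 := hxy z
      have h2 := hzy x
      linarith
    obtain ⟨f, hfb, hfi, happ⟩ := exists_maximizing hC hU x
    obtain ⟨f', hfb', hfi', happ'⟩ := exists_maximizing hC hU z
    have e1 := (optUtility_of_maximizing hC hU hh hy hf hw hfb hfi happ).2.1
    have e2 := (optUtility_of_maximizing hC hU hh hy hf hw' hfb' hfi' happ').2.1
    rw [e1] at e2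
    exact mul_right_cancel₀ hy.ne' e2
  · intro x y z hxy hxz
    obtain ⟨h, hh, hf, hw⟩ := hdual x y hxy
    obtain ⟨h', hh', hf', hw'⟩ := hdual x z hxz
    exact (density_unique hC hU hh hh' (hpos _ _ hxy) (hpos _ _ hxz) hf hf' hw hw').1

end

end

section

variable {Ω : Type*} [MeasurableSpace Ω] {P : Measure Ω} [IsProbabilityMeasure P]

/-! ### The optimal claim -/

omit [IsProbabilityMeasure P] in
lemma exists_optimal_claim {U : ℝ → ℝ} (hU : IsUtility U) {y : ℝ} (hy : 0 < y) {h : Ω →ₘ[P] ℝ}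
    (hh : ∀ᵐ ω ∂P, 0 ≤ h ω) : ∃ g : Ω →ₘ[P] EReal,
      ∀ᵐ ω ∂P, g ω = invMarginal U ((y * h ω : ℝ) : EReal) := by
  obtain ⟨J, hJ, hJe⟩ := hU.exists_measurable_invMarginal
  have hm : Measurable fun ω => J (y * h ω) := hJ.comp (h.measurable.const_mul y)
  refine ⟨AEEqFun.mk _ hm.aestronglyMeasurable, ?_⟩
  filter_upwards [AEEqFun.coeFn_mk _ hm.aestronglyMeasurable, hh] with ω h1 h2
  rw [h1, hJe _ (mul_nonneg hy.le h2)]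

section
variable {C : Set (Ω →ₘ[P] ℝ)} (hC : IsAdmissibleSet C) {U : ℝ → ℝ} (hU : IsUtility U)
  {x y : ℝ} {h : Ω →ₘ[P] ℝ} (hh : h ∈ acDensities C) (hy : 0 < y)
  (hfin : ∀ z, 0 < z → ∫⁻ ω, excess U (z * h ω) ∂P ≠ ⊤)
  (hw : boundedValue C U x = ∫ ω, conj U (y * h ω) ∂P + x * y)
include hC hU hh hy hfin hw

lemma integrable_optimal : Integrable (fun ω => y * h ω * margInv U (y * h ω)) P ∧
    ∫ ω, y * h ω * margInv U (y * h ω) ∂P = x * y := by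
  obtain ⟨f, hf, hfi, happ⟩ := exists_maximizing hC hU x
  have := optUtility_of_maximizing hC hU hh hy hfin hw hf hfi happ
  exact ⟨this.1, this.2.1⟩

lemma integral_optUtility : Integrable (fun ω => optUtility U (y * h ω)) P ∧
    ∫ ω, optUtility U (y * h ω) ∂P = boundedValue C U x := by
  obtain ⟨h1, h2⟩ := integrable_optimal hC hU hh hy hfin hw
  have h3 := integrable_conj (hfin y hy)
  refine ⟨h3.add h1, ?_⟩
  simp only [optUtility]
  rw [integral_add h3 h1, h2, hw]

variable {g : Ω →ₘ[P] EReal} (hg : ∀ᵐ ω ∂P, g ω = invMarginal U ((y * h ω : ℝ) : EReal))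
include hg

omit [IsProbabilityMeasure P] hC hw in
lemma utilityExt_optimal : ∀ᵐ ω ∂P, utilityExt U (g ω) = (optUtility U (y * h ω) : EReal) := by
  filter_upwards [hg, ae_legendre_ne_top (hfin y hy), acDensities_nonneg hh] with ω h1 h2 h3
  rw [h1, hU.utilityExt_invMarginal (mul_nonneg hy.le h3) h2, optUtility]

lemma optimal_mem_utilityClaims : g ∈ utilityClaims C U x := by
  obtain ⟨f, hf, hfi, happ⟩ := exists_maximizing hC hU x
  refine ⟨?_, f, hf, hfi, ?_⟩
  · filter_upwards [hg, acDensities_nonneg hh] with ω h1 h2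
    rw [h1]
    exact hU.invMarginal_ne_bot (mul_nonneg hy.le h2)
  · refine (optUtility_of_maximizing hC hU hh hy hfin hw hf hfi happ).2.2.congr fun n => ?_
    refine lintegral_congr_ae ?_
    filter_upwards [utilityExt_optimal hU hh hy hfin hg] with ω h1
    rw [h1, abs_coe_sub_coe]

lemma expectedUtility_optimal : expectedUtility U g = (boundedValue C U x : EReal) := by
  obtain ⟨h1, h2⟩ := integral_optUtility hC hU hh hy hfin hw
  rw [expectedUtility_eq h1 (utilityExt_optimal hU hh hy hfin hg), h2]

lemma primalValue_eq : primalValue C U x = (boundedValue C U x : EReal) := by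
  refine le_antisymm ?_ ?_
  · rw [hw]
    exact primalValue_le hU hC hh hy (hfin y hy) x
  · rw [← expectedUtility_optimal hC hU hh hy hfin hw hg]
    exact le_iSup₂ (f := fun g (_ : g ∈ utilityClaims C U x) => expectedUtility U g) g
      (optimal_mem_utilityClaims hC hU hh hy hfin hw hg)

lemma isPrimalSolution_optimal : IsPrimalSolution C U x g := by
  refine ⟨optimal_mem_utilityClaims hC hU hh hy hfin hw hg, fun g' hg' => ?_⟩
  rw [expectedUtility_optimal hC hU hh hy hfin hw hg,
    ← primalValue_eq hC hU hh hy hfin hw hg]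
  exact le_iSup₂ (f := fun g (_ : g ∈ utilityClaims C U x) => expectedUtility U g) g' hg'

lemma primalSolution_unique {g' : Ω →ₘ[P] EReal} (hg' : IsPrimalSolution C U x g') : g' = g := by
  obtain ⟨G, f, hGi, hGe, hf, hfi, hL1, hlim⟩ := utilityClaims_integrable hU hg'.1
  have hle := hg'.2 g (optimal_mem_utilityClaims hC hU hh hy hfin hw hg)
  rw [expectedUtility_optimal hC hU hh hy hfin hw hg, expectedUtility_eq hGi hGe,
    EReal.coe_le_coe_iff] at hle
  have hev : ∀ n : ℕ, ∀ᶠ k in atTop, boundedValue C U x - (1 / 2) ^ n ≤ ∫ ω, U (f k ω) ∂P ∧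
      ∫⁻ ω, ENNReal.ofReal |U (f k ω) - G ω| ∂P ≤ ENNReal.ofReal ((1 / 2) ^ n) := by
    intro n
    have hpos : (0 : ℝ) < (1 / 2) ^ n := by positivity
    have h1 := hlim.eventually (lt_mem_nhds
      (show boundedValue C U x - (1 / 2) ^ n < ∫ ω, G ω ∂P by linarith))
    have h2 := hL1.eventually (gt_mem_nhds (ENNReal.ofReal_pos.2 hpos))
    filter_upwards [h1, h2] with k h3 h4 using ⟨h3.le, h4.le⟩
  obtain ⟨φ, -, hφ⟩ := extraction_forall_of_eventually hev
  obtain ⟨-, -, h3⟩ := tendsto_of_maximizing hC hU hh hy hfin hw (f := fun n => f (φ n))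
    (fun n => hf _) (fun n => hfi _) (fun n => (hφ n).1)
  obtain ⟨h4, -⟩ := ae_tendsto_zero_of_tsum (P := P)
    (a := fun n ω => ENNReal.ofReal |U (f (φ n) ω) - G ω|)
    (fun n => ((hfi _).sub hGi).abs.aestronglyMeasurable.aemeasurable.ennreal_ofReal)
    (tsum_ofReal_geometric_ne_top fun n => (hφ n).2)
  refine AEEqFun.ext ?_
  filter_upwards [h3, h4, hGe, utilityExt_optimal hU hh hy hfin hg, hg'.1.1,
    (optimal_mem_utilityClaims hC hU hh hy hfin hw hg).1] with ω a1 a2 a3 a4 a5 a6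
  refine hU.utilityExt_injOn a5 a6 ?_
  rw [a3, a4]
  have a7 : Tendsto (fun n => U (f (φ n) ω)) atTop (𝓝 (G ω)) := by
    rw [tendsto_iff_dist_tendsto_zero]
    have := (ENNReal.tendsto_toReal ENNReal.zero_ne_top).comp a2
    refine this.congr fun n => ?_
    simp [Real.dist_eq]
  rw [tendsto_nhds_unique a7 a1]

lemma expect_optimal_marginal : ((x * y : ℝ) : EReal)
    = expect P (fun ω => g ω * marginalExt U (g ω)) := by
  obtain ⟨h1, h2⟩ := integrable_optimal hC hU hh hy hfin hw
  rw [← h2]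
  refine (expect_eq_integral h1 ?_).symm
  filter_upwards [hg, acDensities_nonneg hh] with ω a1 a2
  have hq := mul_nonneg hy.le a2
  rw [a1, hU.marginalExt_invMarginal hq]
  rcases hq.eq_or_lt with hq0 | hq0
  · rw [← hq0]; simp
  · rw [hU.invMarginal_coe hq0, ← EReal.coe_mul, mul_comm]

omit hg in
lemma expect_dual_derivative : ((-x : ℝ) : EReal)
    = expect P (fun ω => ((h ω * legendreDeriv U (y * h ω) : ℝ) : EReal)) := by
  obtain ⟨h1, h2⟩ := integrable_optimal hC hU hh hy hfin hw
  have h3 : ∫ ω, -(y * h ω * margInv U (y * h ω)) / y ∂P = -x := by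
    rw [integral_div, integral_neg, h2]
    field_simp
  rw [← h3]
  refine (expect_eq_integral (h1.neg.div_const y) ?_).symm
  filter_upwards [acDensities_nonneg hh] with ω a2
  rw [EReal.coe_eq_coe_iff]
  rcases a2.eq_or_lt with hq0 | hq0
  · simp [← hq0]
  · have h4 : legendreDeriv U (y * h ω) = -margInv U (y * h ω) :=
      hU.deriv_conj (mul_pos hy hq0)
    rw [h4]
    simp only [Pi.neg_apply]
    field_simp

omit hg in
lemma elastic_bound_value {A B : ℝ}
    (hAB : ∀ t, |t * deriv U t| ≤ A * (U t - t * deriv U t - U 0) + B)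
    (hA : 0 ≤ A) (hB : 0 ≤ B) :
    |x * y| ≤ A * (boundedValue C U x - x * y - U 0) + B := by
  obtain ⟨h1, h2⟩ := integrable_optimal hC hU hh hy hfin hw
  have h3 := integrable_conj (hfin y hy)
  have h4 : Integrable (fun ω => conj U (y * h ω) - U 0) P := h3.sub (integrable_const _)
  rw [← h2]
  refine (abs_integral_le_integral_abs).trans ?_
  have h5 : ∫ ω, (A * (conj U (y * h ω) - U 0) + B) ∂P =
      A * (boundedValue C U x - x * y - U 0) + B := by
    rw [integral_add (h4.const_mul A) (integrable_const _), integral_const_mul,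
      integral_sub h3 (integrable_const _), hw]
    simp
  rw [h2, ← h5]
  refine integral_mono_ae h1.abs ((h4.const_mul A).add (integrable_const _)) ?_
  filter_upwards [acDensities_nonneg hh, ae_legendre_ne_top (hfin y hy)] with ω a1 a2
  rcases (mul_nonneg hy.le a1).eq_or_lt with hq | hq
  · rw [← hq] at a2 ⊢
    have := mul_nonneg hA (zero_le_conj_sub a2)
    simp only [zero_mul, abs_zero]
    linarith
  · have h6 := hAB (margInv U (y * h ω))
    rw [hU.deriv_margInv hq] at h6
    rw [hU.conj_eq hq, mul_comm]
    exact h6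

end

/-! ### Continuity of the dual optimiser -/

omit [IsProbabilityMeasure P] in
lemma tendsto_lintegral_abs_sub {C : Set (Ω →ₘ[P] ℝ)} {k : ℕ → (Ω →ₘ[P] ℝ)} {h : Ω →ₘ[P] ℝ}
    (hk : ∀ n, k n ∈ acDensities C) (hh : h ∈ acDensities C)
    (hlim : ∀ᵐ ω ∂P, Tendsto (fun n => k n ω) atTop (𝓝 (h ω))) :
    Tendsto (fun n => ∫⁻ ω, ENNReal.ofReal |k n ω - h ω| ∂P) atTop (𝓝 0) := by
  have hi := integrable_acDensities hh
  have hmin : ∀ n, Integrable (fun ω => min (k n ω) (h ω)) P := fun n =>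
    (integrable_acDensities (hk n)).inf hi
  have h1 : Tendsto (fun n => ∫ ω, min (k n ω) (h ω) ∂P) atTop (𝓝 (∫ ω, h ω ∂P)) := by
    refine tendsto_integral_of_dominated_convergence (fun ω => h ω)
      (fun n => (hmin n).aestronglyMeasurable) hi (fun n => ?_) ?_
    · filter_upwards [acDensities_nonneg (hk n), acDensities_nonneg hh] with ω a1 a2
      rw [Real.norm_of_nonneg (le_min a1 a2)]
      exact min_le_right _ _
    · filter_upwards [hlim] with ω a1
      simpa using a1.min (tendsto_const_nhds (x := h ω))
  have h2 : ∀ n, ∫ ω, |k n ω - h ω| ∂P = 2 - 2 * ∫ ω, min (k n ω) (h ω) ∂P := by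
    intro n
    have h3 : ∀ ω, |k n ω - h ω| = k n ω + h ω - 2 * min (k n ω) (h ω) := fun ω => by
      rcases le_total (k n ω) (h ω) with hle | hle
      · rw [min_eq_left hle, abs_of_nonpos (by linarith)]; ring
      · rw [min_eq_right hle, abs_of_nonneg (by linarith)]; ring
    have h4 : Integrable (fun ω => k n ω + h ω) P := (integrable_acDensities (hk n)).add hi
    simp only [h3]
    rw [integral_sub h4 ((hmin n).const_mul 2), integral_add (integrable_acDensities (hk n)) hi,
      integral_acDensities (hk n), integral_acDensities hh, integral_const_mul]
    norm_num
  have h5 : Tendsto (fun n => ∫ ω, |k n ω - h ω| ∂P) atTop (𝓝 0) := by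
    simp only [h2]
    have := (h1.const_mul 2).const_sub 2
    rw [integral_acDensities hh] at this
    simpa using this
  have h6 := ENNReal.tendsto_ofReal h5
  rw [ENNReal.ofReal_zero] at h6
  exact h6.congr fun n => ofReal_integral_eq_lintegral_ofReal
    ((integrable_acDensities (hk n)).sub hi).abs (Eventually.of_forall fun ω => abs_nonneg _)

lemma tendsto_dual_optimizer {C : Set (Ω →ₘ[P] ℝ)} (hC : IsAdmissibleSet C) {U : ℝ → ℝ}
    (hU : IsUtility U) {k : ℝ → (Ω →ₘ[P] ℝ)} {v : ℝ → ℝ} {x y : ℝ} (hy : 0 < y)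
    (hk : ∀ z, 0 < z → k z ∈ acDensities C)
    (hfin : ∀ z, 0 < z → ∀ t, 0 < t → ∫⁻ ω, excess U (t * k z ω) ∂P ≠ ⊤)
    (hv : ∀ z, 0 < z → ∫ ω, conj U (z * k z ω) ∂P = v z) (hvc : ContinuousAt v y)
    (hx : boundedValue C U x = v y + x * y) :
    Tendsto (fun z => ∫⁻ ω, ENNReal.ofReal |k z ω - k y ω| ∂P) (𝓝 y) (𝓝 0) := by
  refine tendsto_of_subseq_tendsto fun z hz => ?_
  obtain ⟨f, hf, hfi, happ⟩ := exists_maximizing hC hU x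
  have hw : boundedValue C U x = ∫ ω, conj U (y * k y ω) ∂P + x * y := by rw [hv y hy, hx]
  have hev : ∀ n : ℕ, ∀ᶠ m in atTop, 0 < z m ∧
      v (z m) + x * z m - boundedValue C U x < (1 / 2) ^ (n + 1) := by
    intro n
    have hpos : (0 : ℝ) < (1 / 2) ^ (n + 1) := by positivity
    have h1 : Tendsto (fun t => v t + x * t - boundedValue C U x) (𝓝 y)
        (𝓝 (v y + x * y - boundedValue C U x)) :=
      (hvc.tendsto.add (tendsto_id.const_mul x)).sub_const _
    rw [hx, sub_self] at h1
    rw [← hx] at h1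
    exact (hz.eventually (lt_mem_nhds hy)).and
      ((h1.comp hz).eventually (gt_mem_nhds hpos))
  obtain ⟨φ, hφmono, hφ⟩ := extraction_forall_of_eventually hev
  refine ⟨φ, ?_⟩
  set zn : ℕ → ℝ := fun n => z (φ n) with hzn
  have hz0 : ∀ n, 0 < zn n := fun n => (hφ n).1
  have hzlim : Tendsto zn atTop (𝓝 y) := hz.comp hφmono.tendsto_atTop
  have hgap0 : ∀ᵐ ω ∂P, ∀ n, 0 ≤ gap U (zn n) (k (zn n)) (f (n + 1)) ω :=
    ae_all_iff.2 fun n => gap_nonneg (hfin _ (hz0 n) _ (hz0 n)) _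
  obtain ⟨hgap, -⟩ := ae_tendsto_zero_of_tsum (P := P)
    (a := fun n ω => ENNReal.ofReal (gap U (zn n) (k (zn n)) (f (n + 1)) ω))
    (fun n => (measurable_gap U _ _ _ hU.continuous).ennreal_ofReal.aemeasurable)
    (tsum_ofReal_geometric_ne_top fun n => by
      rw [← ofReal_integral_eq_lintegral_ofReal
        (integrable_gap hC (hk _ (hz0 n)) (hfin _ (hz0 n) _ (hz0 n)) (hf _) (hfi _)).1
        (gap_nonneg (hfin _ (hz0 n) _ (hz0 n)) _)]
      refine ENNReal.ofReal_le_ofReal ?_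
      have h1 := integral_gap_le hC (hk _ (hz0 n)) (hz0 n) (hfin _ (hz0 n) _ (hz0 n))
        (hf (n + 1)) (hfi _)
      rw [hv _ (hz0 n)] at h1
      have h2 := happ (n + 1)
      have h3 := (hφ n).2
      have h4 : (1 / 2 : ℝ) ^ n = (1 / 2) ^ (n + 1) + (1 / 2) ^ (n + 1) := by ring
      rw [h4]
      simp only [hzn] at h1 ⊢
      linarith)
  obtain ⟨hflim, -, -⟩ := tendsto_of_maximizing hC hU (hk y hy) hy (hfin y hy) hw hf hfi happ
  refine tendsto_lintegral_abs_sub (fun n => hk _ (hz0 n)) (hk y hy) ?_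
  filter_upwards [hgap, hgap0, hflim, acDensities_nonneg (hk y hy),
    ae_all_iff.2 fun n => acDensities_nonneg (hk _ (hz0 n)),
    ae_all_iff.2 fun n => ae_legendre_ne_top (hfin _ (hz0 n) _ (hz0 n))]
    with ω a1 a2 a3 a4 a5 a6
  have a7 : Tendsto (fun n => gap U (zn n) (k (zn n)) (f (n + 1)) ω) atTop (𝓝 0) := by
    have := (ENNReal.tendsto_toReal ENNReal.zero_ne_top).comp a1
    refine this.congr fun n => ?_
    simp [ENNReal.toReal_ofReal (a2 n)]
  have a8 := hU.tendsto_dual_of_gap (mul_nonneg hy.le a4)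
    (fun n => mul_nonneg (hz0 n).le (a5 n)) a6 (a3.comp (tendsto_add_atTop_nat 1)) a7
  have a9 := a8.div hzlim hy.ne'
  rw [mul_div_cancel_left₀ _ hy.ne'] at a9
  refine a9.congr fun n => ?_
  rw [Pi.div_apply, mul_div_cancel_left₀ _ (hz0 n).ne']

end

end

end AbstractDuality

open AbstractDuality in
theorem mainTheorem8 {Ω : Type*} [MeasurableSpace Ω] (P : Measure Ω) [IsProbabilityMeasure P]
    (C : Set (Ω →ₘ[P] ℝ)) (hC : IsAdmissibleSet C)
    (U : ℝ → ℝ) (hU : IsUtility U) (hAE : HasReasonableAE U)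
    (hfin : ∃ x : ℝ, primalValue C U x < utilityTop U) :
    ∃ (u v : ℝ → ℝ) (hhat : ℝ → (Ω →ₘ[P] ℝ)) (ghat : ℝ → (Ω →ₘ[P] EReal)),
      -- the value functions are finite, with values `u` and `v`
      (∀ x : ℝ, primalValue C U x = (u x : EReal)) ∧
      (∀ y : ℝ, 0 < y → dualValue C U y = (v y : EReal)) ∧
      -- 1) conjugacy, smoothness, strict concavity, Inada conditions, asymptotic elasticity
      (∀ x : ℝ, IsGLB ((fun y : ℝ => v y + x * y) '' Ioi 0) (u x)) ∧
      (∀ y : ℝ, 0 < y → IsLUB (range fun x : ℝ => u x - x * y) (v y)) ∧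
      ContDiff ℝ 1 u ∧ ContDiffOn ℝ 1 v (Ioi 0) ∧
      StrictConcaveOn ℝ univ u ∧ StrictConcaveOn ℝ (Ioi 0) (fun y => -v y) ∧
      Tendsto (deriv u) atBot atTop ∧ Tendsto (deriv v) atTop atTop ∧
      Tendsto (deriv u) atTop (𝓝 0) ∧ Tendsto (deriv v) (𝓝[>] 0) atBot ∧
      HasReasonableAE u ∧
      -- 2) existence, uniqueness and continuity in variation norm of the dual optimiser
      (∀ y : ℝ, 0 < y → IsDualSolution C U y (hhat y) ∧
        ∀ h, IsDualSolution C U y h → h = hhat y) ∧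
      (∀ y : ℝ, 0 < y →
        Tendsto (fun z => ∫⁻ ω, ENNReal.ofReal |hhat z ω - hhat y ω| ∂P) (𝓝 y) (𝓝 0)) ∧
      -- 3) existence, uniqueness and form of the primal optimiser, with `ŷ(x) = u'(x)`
      (∀ x : ℝ, IsPrimalSolution C U x (ghat x) ∧
        (∀ g, IsPrimalSolution C U x g → g = ghat x) ∧
        0 < deriv u x ∧
        ∀ᵐ ω ∂P, ghat x ω
          = invMarginal U ((deriv u x * hhat (deriv u x) ω : ℝ) : EReal)) ∧
      -- 4) derivative formulae; both products vanish where they have the form `0 · ∞`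
      (∀ y : ℝ, 0 < y → ((deriv v y : ℝ) : EReal)
        = expect P (fun ω => ((hhat y ω * legendreDeriv U (y * hhat y ω) : ℝ) : EReal))) ∧
      (∀ x : ℝ, ((x * deriv u x : ℝ) : EReal)
        = expect P (fun ω => ghat x ω * marginalExt U (ghat x ω))) := by

  set u := boundedValue C U with hu
  have huU : IsUtility u := isUtility_boundedValue hC hU hAE hfin
  obtain ⟨hbdd, -⟩ := exists_finite_dual hC hU hAE hfin
  have hex : ∀ y : ℝ, ∃ h : Ω →ₘ[P] ℝ, 0 < y → h ∈ acDensities C ∧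
      (∀ z, 0 < z → ∫⁻ ω, excess U (z * h ω) ∂P ≠ ⊤) ∧
      u (margInv u y) = ∫ ω, conj U (y * h ω) ∂P + margInv u y * y := by
    intro y
    rcases le_or_gt y 0 with hy | hy
    · exact ⟨0, fun h => absurd h (not_lt.2 hy)⟩
    · have hsup : IsSupergradient u (margInv u y) y := fun z => by
        have := huU.le_tangent (margInv u y) z
        rwa [huU.deriv_margInv hy] at this
      obtain ⟨h, hh, hf, hw⟩ := exists_dual_of_supergradient hC hU hbdd hy hsup
      exact ⟨h, fun _ => ⟨hh, fun z hz =>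
        lintegral_excess_scale hf hU hAE hy (acDensities_nonneg hh) hz, hw⟩⟩
  choose k hk using hex
  have hkd : ∀ y, 0 < y → k y ∈ acDensities C := fun y hy => (hk y hy).1
  have hkf : ∀ y, 0 < y → ∀ z, 0 < z → ∫⁻ ω, excess U (z * k y ω) ∂P ≠ ⊤ := fun y hy => (hk y hy).2.1
  have hkv : ∀ y, 0 < y → ∫ ω, conj U (y * k y ω) ∂P = conj u y := fun y hy => by
    have := (hk y hy).2.2
    rw [huU.conj_eq hy]
    linarith
  have hd : ∀ x, 0 < deriv u x := huU.deriv_pos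
  have hkx : ∀ x, u x = ∫ ω, conj U (deriv u x * k (deriv u x) ω) ∂P + x * deriv u x := fun x => by
    have := (hk _ (hd x)).2.2
    rwa [huU.margInv_deriv] at this
  have hgex : ∀ x, ∃ g : Ω →ₘ[P] EReal, ∀ᵐ ω ∂P,
      g ω = invMarginal U ((deriv u x * k (deriv u x) ω : ℝ) : EReal) := fun x =>
    exists_optimal_claim hU (hd x) (acDensities_nonneg (hkd _ (hd x)))
  choose g hg using hgex
  have hdual_le : ∀ y, 0 < y → ∀ h ∈ acDensities C, dualObjective U y (k y) ≤ dualObjective U y h := by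
    intro y hy h hh
    rcases eq_or_ne (dualObjective U y h) ⊤ with htop | htop
    · rw [htop]; exact le_top
    · have hf := lintegral_excess_ne_top_of_dualObjective htop
      rw [dualObjective_eq hf, dualObjective_eq (hkf y hy y hy), EReal.coe_le_coe_iff]
      have h1 := boundedValue_le hC hU hh hy hf (margInv u y)
      have h2 := (hk y hy).2.2
      linarith
  have hdualeq : ∀ y, 0 < y → dualObjective U y (k y) = (conj u y : EReal) := fun y hy => by
    rw [dualObjective_eq (hkf y hy y hy), hkv y hy]
  have hneg : ∀ y, 0 < y → deriv (conj u) y = -margInv u y := fun y hy => huU.deriv_conj hy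
  refine ⟨u, conj u, k, g, ?_, ?_, huU.isGLB_conj, fun y hy => huU.isLUB_conj hy, huU.contDiff,
    huU.contDiffOn_conj, huU.strictConcave, huU.strictConcaveOn_neg_conj, huU.inada_bot,
    huU.tendsto_deriv_conj_atTop, huU.inada_top, huU.tendsto_deriv_conj_zero, ?_, ?_, ?_, ?_, ?_, ?_⟩
  · exact fun x => primalValue_eq hC hU (hkd _ (hd x)) (hd x) (hkf _ (hd x)) (hkx x) (hg x)
  · intro y hy
    rw [← hdualeq y hy]
    exact le_antisymm (iInf₂_le _ (hkd y hy)) (le_iInf₂ (hdual_le y hy))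
  · obtain ⟨A, B, hA, hB, hAB⟩ := hU.elastic_bound hAE
    have hb : ∀ x, |x * deriv u x| ≤ A * (u x - x * deriv u x - U 0) + B := fun x =>
      elastic_bound_value hC hU (hkd _ (hd x)) (hd x) (hkf _ (hd x)) (hkx x) hAB hA hB
    have hv0 : ∀ x, 0 ≤ u x - x * deriv u x - U 0 := fun x => by
      have h1 := le_integral_conj (hkf _ (hd x) _ (hd x))
      have h2 := hkx x
      linarith
    refine ⟨huU.limsup_elasticity_lt_one (A := A) (B := B - A * U 0) hA fun x => ?_,
      huU.one_lt_liminf_elasticity (A := A + 2) (B := B - (A + 2) * U 0) (by linarith)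
        fun x => ?_⟩
    · linarith [hb x]
    · linarith [hb x, hv0 x]
  · intro y hy
    refine ⟨⟨hkd y hy, hdual_le y hy⟩, fun h hh => ?_⟩
    have h1 := hh.2 _ (hkd y hy)
    have hf : ∫⁻ ω, excess U (y * h ω) ∂P ≠ ⊤ := by
      refine lintegral_excess_ne_top_of_dualObjective (h1.trans_lt ?_).ne
      rw [hdualeq y hy]
      exact EReal.coe_lt_top _
    rw [dualObjective_eq hf, dualObjective_eq (hkf y hy y hy), EReal.coe_le_coe_iff] at h1
    have h2 := boundedValue_le hC hU hh.1 hy hf (margInv u y)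
    have h3 := (hk y hy).2.2
    exact (density_unique hC hU hh.1 (hkd y hy) hy hy
      (fun z hz => lintegral_excess_scale hf hU hAE hy (acDensities_nonneg hh.1) hz)
      (hkf y hy) (le_antisymm h2 (by linarith)) h3).2
  · intro y hy
    refine tendsto_dual_optimizer hC hU (v := conj u) (x := margInv u y) hy hkd hkf hkv
      (huU.hasDerivAt_conj hy).continuousAt ?_
    rw [huU.conj_eq hy]
    ring
  · intro x
    exact ⟨isPrimalSolution_optimal hC hU (hkd _ (hd x)) (hd x) (hkf _ (hd x)) (hkx x) (hg x),
      fun g' hg' => primalSolution_unique hC hU (hkd _ (hd x)) (hd x) (hkf _ (hd x)) (hkx x)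
        (hg x) hg', hd x, hg x⟩
  · intro y hy
    rw [hneg y hy]
    exact expect_dual_derivative hC hU (hkd y hy) hy (hkf y hy) (hk y hy).2.2
  · intro x
    exact expect_optimal_marginal hC hU (hkd _ (hd x)) (hd x) (hkf _ (hd x)) (hkx x) (hg x)
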